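/- Let $n\ge 1$. Let $Q=\{z\in\mathbb C^{n+2}:\sum z_i^2=1\}$, identified with $TS^{n+1}=\{(x,v)\in\mathbb R^{n+2}\times\mathbb R^{n+2}: |x|=1,\ x\cdot v=0\}$ by $(x,v)\mapsto \cosh|v|\,x+i\,\frac{\sinh|v|}{|v|}\,v$; Stenzel's complex structure on $TS^{n+1}$ is that of $Q$. For $0<R\le\infty$ let $Q_R\subset Q$ be the tube $|v|<R$ (so $Q_\infty=Q$), and for $z\in Q$ let $r(z)=|v|$, i.e. $|z|^2=\cosh 2r$. Let $X_{i,j}\in\mathfrak{so}(n+2)$ have $ij$-th entry $1$, $ji$-th entry $-1$ and other entries $0$, put $B(X,Y)=-\frac12\operatorname{Tr}XY$, and let $\mathfrak p_1,\mathfrak p_2$ ($\mathfrak p_3$) be spanned by $X_{i,n+1}$, $X_{i,n+2}$, $1\le i\le n$ (by $X_{n+1,n+2}$). For $\Lambda\le0$ consider the system $$a_u=\tfrac12a(b^2+c^2-a^2),\quad b_u=\tfrac12b(c^2+a^2-b^2),\quad c_u=\tfrac n2c\Bigl(a^2+b^2-c^2-\tfrac{2\Lambda}{n}a^2b^2\Bigr).$$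 An unstable curve of a critical point $(0,K,L)$ is a non-constant solution on a maximal interval $(-\infty,\eta)$, $\eta\le\infty$, which tends to $(0,K,L)$ as $u\to-\infty$. A solution with $abc\ne0$ defines on $(-\infty,\eta)\times SO(n+2)/SO(n)$ the metric $g_{a,b,c}=dt^2+a^2B|_{\mathfrak p_1}+b^2B|_{\mathfrak p_2}+c^2B|_{\mathfrak p_3}$, $dt=abc\,du$, and the almost complex structure $J_{a,b,c}$ with $X_{i,n+1}\mapsto-\frac ab X_{i,n+2}$, $\partial_t\mapsto-\frac1cX_{n+1,n+2}$. Say that $(a,b,c)$ is realized by a metric $g$ on $Q_R$ if $abc\neq 0$ and there is a function $r(u)$ with $dr=ab\,du$, $r\to0$ as $u\to-\infty$, $u\mapsto|r(u)|$ a bijection of $(-\infty,\eta)$ onto $(0,R)$, such that the $SO(n+2)$-equivariant map $(u,A\,SO(n))\mapsto A(\cosh r(u)\,e_{n+2}+i\sinh r(u)\,e_{n+1})$ onto the complement of the zero section in $Q_R$ carries $g_{a,b,c}$ to $g$ and $J_{a,b,c}$ to the complex structure of $Q_R$. (1) Let $\Lambda\le0$, $K\ne0$, and let $(a,b,c)$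 be an unstable curve of $(0,K,K)$ or $(0,K,-K)$. Then $(a,b,c)$ is realized by a smooth complete Kähler metric $g$ with $\mathrm{Ric}_g=\Lambda g$ on a tube $Q_R$ with its complex structure, zero section included, where $R=\infty$ if $\Lambda=0$ and $R<\infty$ if $\Lambda<0$. If $\Lambda=0$, then $g$ can be taken to be a Stenzel metric: there are a constant $k$ and a function $f$ on $[0,\infty)$ with $$\frac{d}{ds}\Bigl(f'(s)^{n+1}\Bigr)=(n+1)k\sinh^n s,\qquad f'(0)=0,\qquad f'>0\ \text{on}\ (0,\infty),\qquad(*)$$ such that $\phi(r)=f(2r)$ is a smooth function on $Q$ and a Kähler potential of $g$ (the Kähler form is $i\partial\bar\partial\phi$). (2) Conversely, for every constant $k$ and every $f$ satisfying $(*)$ there is a smooth Riemannian metric $g$ on $Q$ with Kähler potential $\phi(r)=f(2r)$, where $\phi(r)$ is smooth on $Q$. Every such $g$ is complete, Kähler and Ricci-flat, and it realizes, with $R=\infty$, some unstable curve of $(0,K,K)$, $K>0$, of the system with $\Lambda=0$. -/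

import Mathlib

open Filter Topology
open scoped ContDiff ENNReal

noncomputable section

namespace StenzelTube

/-! ### The quadric and its tubes -/

/-- `ℂ^m` with its Hermitian norm. -/
abbrev CC (m : ℕ) := EuclideanSpace ℂ (Fin m)

/-- The affine quadric `∑ zᵢ² = 1` in `ℂ^{n+2}`. -/
def quadric (n : ℕ) : Set (CC (n + 2)) := {z | ∑ i, z i ^ 2 = 1}

/-- The total space of `TS^{n+1}`, as the set of pairs `(x, v)` with `|x| = 1` and `v ⊥ x`. -/
def tangentSphere (n : ℕ) :
    Set (EuclideanSpace ℝ (Fin (n + 2)) × EuclideanSpace ℝ (Fin (n + 2))) :=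
  {p | ‖p.1‖ = 1 ∧ inner ℝ p.1 p.2 = 0}

/-- The identification of `TS^{n+1}` with the quadric,
`(x, v) ↦ cosh |v| x + i (sinh |v| / |v|) v` (and `(x, 0) ↦ x`). The complex structure
of the quadric is multiplication by `i` on its tangent spaces. -/
def toQuadric (n : ℕ) (p : EuclideanSpace ℝ (Fin (n + 2)) × EuclideanSpace ℝ (Fin (n + 2))) :
    CC (n + 2) :=
  WithLp.toLp 2 fun i =>
    ((Real.cosh ‖p.2‖ * p.1 i : ℝ) : ℂ)
      + Complex.I * ((Real.sinh ‖p.2‖ / ‖p.2‖ * p.2 i : ℝ) : ℂ)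

/-- The tube of radius `R` (possibly `R = ⊤`) about the zero section of `TS^{n+1}`, as a
subset of the quadric. -/
def tube (n : ℕ) (R : EReal) : Set (CC (n + 2)) :=
  toQuadric n '' {p | p ∈ tangentSphere n ∧ ((‖p.2‖ : ℝ) : EReal) < R}

/-- The function `r` on the quadric: `|z|² = cosh (2 r)`. -/
def radius {n : ℕ} (z : CC (n + 2)) : ℝ := Real.arcosh (‖z‖ ^ 2) / 2

theorem norm_sq_toQuadric {n : ℕ}
    {p : EuclideanSpace ℝ (Fin (n + 2)) × EuclideanSpace ℝ (Fin (n + 2))}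
    (hp : p ∈ tangentSphere n) : ‖toQuadric n p‖ ^ 2 = Real.cosh (2 * ‖p.2‖) := by
  obtain ⟨h1, -⟩ := hp
  have hx : ∑ i, p.1 i ^ 2 = 1 := by
    have := EuclideanSpace.real_norm_sq_eq p.1
    rw [h1] at this; linarith
  have hv : ∑ i, p.2 i ^ 2 = ‖p.2‖ ^ 2 := (EuclideanSpace.real_norm_sq_eq p.2).symm
  have key : ∀ i, ‖toQuadric n p i‖ ^ 2
      = Real.cosh ‖p.2‖ ^ 2 * p.1 i ^ 2 + (Real.sinh ‖p.2‖ / ‖p.2‖) ^ 2 * p.2 i ^ 2 := by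
    intro i
    have : toQuadric n p i = ((Real.cosh ‖p.2‖ * p.1 i : ℝ) : ℂ)
      + ((Real.sinh ‖p.2‖ / ‖p.2‖ * p.2 i : ℝ) : ℂ) * Complex.I := by
      simp only [toQuadric]; ring
    rw [this, ← Complex.normSq_eq_norm_sq, Complex.normSq_add_mul_I]; ring
  rw [EuclideanSpace.norm_sq_eq, Finset.sum_congr rfl fun i _ => key i, Finset.sum_add_distrib,
    ← Finset.mul_sum, ← Finset.mul_sum, hx, hv, Real.cosh_two_mul]
  rcases eq_or_ne ‖p.2‖ 0 with h | h
  · simp [h]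
  · field_simp

/-- Under the identification with `TS^{n+1}`, the function `radius` is `(x, v) ↦ |v|`. -/
theorem radius_toQuadric {n : ℕ}
    {p : EuclideanSpace ℝ (Fin (n + 2)) × EuclideanSpace ℝ (Fin (n + 2))}
    (hp : p ∈ tangentSphere n) : radius (toQuadric n p) = ‖p.2‖ := by
  rw [radius, norm_sq_toQuadric hp, Real.arcosh_cosh (by positivity)]; ring

/-- The tube of infinite radius is the whole quadric. -/
theorem tube_top (n : ℕ) : tube n ⊤ = quadric n := by
  ext z
  constructor
  · rintro ⟨⟨x, v⟩, ⟨⟨h1, h2⟩, -⟩, rfl⟩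
    simp only at h1 h2
    have hx : ∑ i, x i ^ 2 = 1 := by
      have := EuclideanSpace.real_norm_sq_eq x
      rw [h1] at this; linarith
    have hv : ∑ i, v i ^ 2 = ‖v‖ ^ 2 := (EuclideanSpace.real_norm_sq_eq v).symm
    have hxv : ∑ i, x i * v i = 0 := by
      rw [PiLp.inner_apply] at h2
      rw [← h2]; refine Finset.sum_congr rfl fun i _ => ?_
      simp [mul_comm]
    have e : ∀ i, toQuadric n (x, v) i ^ 2
        = ((Real.cosh ‖v‖ ^ 2 * x i ^ 2 - (Real.sinh ‖v‖ / ‖v‖) ^ 2 * v i ^ 2 : ℝ) : ℂ)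
          + Complex.I *
            ((2 * Real.cosh ‖v‖ * (Real.sinh ‖v‖ / ‖v‖) * (x i * v i) : ℝ) : ℂ) := by
      intro i
      simp only [toQuadric]
      push_cast
      ring_nf
      simp only [Complex.I_sq]
      ring
    change ∑ i, toQuadric n (x, v) i ^ 2 = 1
    rw [Finset.sum_congr rfl fun i _ => e i, Finset.sum_add_distrib, ← Finset.mul_sum,
      ← Complex.ofReal_sum, ← Complex.ofReal_sum, Finset.sum_sub_distrib, ← Finset.mul_sum,
      ← Finset.mul_sum, ← Finset.mul_sum, hx, hv, hxv]
    have : Real.cosh ‖v‖ ^ 2 * 1 - (Real.sinh ‖v‖ / ‖v‖) ^ 2 * ‖v‖ ^ 2 = 1 := by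
      rcases eq_or_ne ‖v‖ 0 with h | h
      · simp [h]
      · have := Real.cosh_sq_sub_sinh_sq ‖v‖
        field_simp
        linarith
    rw [this]; simp
  · intro hz
    have hz' : ∑ i, z i ^ 2 = 1 := hz
    set x : EuclideanSpace ℝ (Fin (n + 2)) := WithLp.toLp 2 fun i => (z i).re with hxdef
    set y : EuclideanSpace ℝ (Fin (n + 2)) := WithLp.toLp 2 fun i => (z i).im with hydef
    have hre : ‖x‖ ^ 2 - ‖y‖ ^ 2 = 1 := by
      have := congrArg Complex.re hz'
      rw [Complex.re_sum] at this
      rw [EuclideanSpace.real_norm_sq_eq, EuclideanSpace.real_norm_sq_eq,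
        ← Finset.sum_sub_distrib]
      simpa [sq] using this
    have him : ∑ i, x i * y i = 0 := by
      have := congrArg Complex.im hz'
      rw [Complex.im_sum] at this
      have h2 : ∑ i, 2 * (x i * y i) = 0 := by
        rw [← Complex.one_im, ← this]
        refine Finset.sum_congr rfl fun i _ => ?_
        simp [sq, hxdef, hydef]; ring
      rw [← Finset.mul_sum] at h2
      linarith
    set ρ := Real.arsinh ‖y‖ with hρ
    have hρ0 : 0 ≤ ρ := Real.arsinh_nonneg_iff.2 (norm_nonneg y)
    have hs : Real.sinh ρ = ‖y‖ := Real.sinh_arsinh _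
    have hc0 : 0 < Real.cosh ρ := Real.cosh_pos ρ
    have hc : Real.cosh ρ = ‖x‖ := by
      have := Real.cosh_sq_sub_sinh_sq ρ
      rw [hs] at this
      have h3 : Real.cosh ρ ^ 2 = ‖x‖ ^ 2 := by linarith
      exact (sq_eq_sq₀ hc0.le (norm_nonneg x)).1 h3
    have hv : ‖(ρ / ‖y‖) • y‖ = ρ := by
      rw [norm_smul, Real.norm_of_nonneg (by positivity)]
      rcases eq_or_ne ‖y‖ 0 with h | h
      · simp [hρ, h]
      · field_simp
    refine ⟨((Real.cosh ρ)⁻¹ • x, (ρ / ‖y‖) • y), ⟨⟨?_, ?_⟩, EReal.coe_lt_top _⟩, ?_⟩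
    · change ‖(Real.cosh ρ)⁻¹ • x‖ = 1
      rw [norm_smul, Real.norm_of_nonneg (by positivity), ← hc]
      field_simp
    · change inner ℝ ((Real.cosh ρ)⁻¹ • x) ((ρ / ‖y‖) • y) = 0
      have : inner ℝ x y = 0 := by
        rw [PiLp.inner_apply, ← him]
        refine Finset.sum_congr rfl fun i _ => ?_
        simp [mul_comm]
      rw [inner_smul_left, inner_smul_right, this]; simp
    · ext i
      have h1 : Real.cosh ρ * ((Real.cosh ρ)⁻¹ * (z i).re) = (z i).re := by field_simp
      have h2 : Real.sinh ρ / ρ * (ρ / ‖y‖ * (z i).im) = (z i).im := by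
        rw [hs]
        rcases eq_or_ne ‖y‖ 0 with h | h
        · have hy : y = 0 := norm_eq_zero.1 h
          have : (z i).im = 0 := by
            have := congrArg (fun w : EuclideanSpace ℝ (Fin (n + 2)) => w i) hy
            simpa [hydef] using this
          simp [this]
        · have : ρ ≠ 0 := by
            intro h0; rw [h0, Real.sinh_zero] at hs; exact h hs.symm
          field_simp
      change ((Real.cosh ‖(ρ / ‖y‖) • y‖ * ((Real.cosh ρ)⁻¹ * (z i).re) : ℝ) : ℂ)
        + Complex.I * ((Real.sinh ‖(ρ / ‖y‖) • y‖ / ‖(ρ / ‖y‖) • y‖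
          * (ρ / ‖y‖ * (z i).im) : ℝ) : ℂ) = z i
      rw [hv, h1, h2, mul_comm Complex.I, Complex.re_add_im]

/-! ### Kähler metrics on complex submanifolds of `ℂ^N` -/

/-- A field of real bilinear forms on `ℂ^N`; for a metric on a complex submanifold `M` only its
values at points of `M` on vectors tangent to `M` are ever used. -/
abbrev BilinField (N : ℕ) := CC N → CC N →L[ℝ] CC N →L[ℝ] ℝ

/-- `ψ : U → M` is the inverse of a local holomorphic coordinate system on the
`m`-dimensional complex submanifold `M` of `ℂ^N`. -/
structure IsHolChart {N : ℕ} (m : ℕ) (M : Set (CC N)) (U : Set (CC m)) (ψ : CC m → CC N) :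
    Prop where
  isOpen : IsOpen U
  holomorphic : DifferentiableOn ℂ ψ U
  mapsTo : Set.MapsTo ψ U M
  injOn : Set.InjOn ψ U
  immersion : ∀ x ∈ U, Function.Injective (fderiv ℂ ψ x)

/-- The pull-back `ψ^* g` at `x`. -/
def pull {N m : ℕ} (g : BilinField N) (ψ : CC m → CC N) (x v w : CC m) : ℝ :=
  g (ψ x) (fderiv ℂ ψ x v) (fderiv ℂ ψ x w)

/-- The symmetric form `(v, w) ↦ (D²h(v,w) + D²h(iv,iw)) / 2` at `x`; it is `ω(v, iw)`
for the `(1,1)`-form `ω = i ∂∂̄ h`. -/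
def levi {m : ℕ} (h : CC m → ℝ) (x v w : CC m) : ℝ :=
  (fderiv ℝ (fun y => fderiv ℝ h y w) x v
    + fderiv ℝ (fun y => fderiv ℝ h y (Complex.I • w)) x (Complex.I • v)) / 2

/-- `g` is a smooth Riemannian metric on the `m`-dimensional complex submanifold `M`. -/
structure IsRiemannian {N : ℕ} (m : ℕ) (M : Set (CC N)) (g : BilinField N) : Prop where
  smooth : ∀ U ψ, IsHolChart m M U ψ → ∀ v w, ContDiffOn ℝ ∞ (fun x => pull g ψ x v w) U
  symm : ∀ U ψ, IsHolChart m M U ψ → ∀ x ∈ U, ∀ v w, pull g ψ x v w = pull g ψ x w v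
  pos : ∀ U ψ, IsHolChart m M U ψ → ∀ x ∈ U, ∀ v, v ≠ 0 → 0 < pull g ψ x v v

/-- `g` is a Kähler metric on `M` with the complex structure of `M`: it is Hermitian, and the
form `ω(v, w) = g(iv, w)` is closed. -/
structure IsKahler {N : ℕ} (m : ℕ) (M : Set (CC N)) (g : BilinField N) : Prop where
  riemannian : IsRiemannian m M g
  hermitian : ∀ U ψ, IsHolChart m M U ψ → ∀ x ∈ U, ∀ v w,
    pull g ψ x (Complex.I • v) (Complex.I • w) = pull g ψ x v w
  closed : ∀ U ψ, IsHolChart m M U ψ → ∀ x ∈ U, ∀ v₁ v₂ v₃,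
    fderiv ℝ (fun y => pull g ψ y (Complex.I • v₂) v₃) x v₁
      + fderiv ℝ (fun y => pull g ψ y (Complex.I • v₃) v₁) x v₂
      + fderiv ℝ (fun y => pull g ψ y (Complex.I • v₁) v₂) x v₃ = 0

/-- `Φ` is a global Kähler potential of `g` on `M`: `Φ` is smooth on `M` and the form
`ω(v, w) = g(iv, w)` is `i ∂∂̄ Φ`. -/
def HasKahlerPotential {N : ℕ} (m : ℕ) (M : Set (CC N)) (g : BilinField N) (Φ : CC N → ℝ) :
    Prop :=
  ∀ U ψ, IsHolChart m M U ψ →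
    ContDiffOn ℝ ∞ (Φ ∘ ψ) U ∧ ∀ x ∈ U, ∀ v w, pull g ψ x v w = levi (Φ ∘ ψ) x v w

/-- The Hermitian matrix of `g` in the holomorphic coordinates given by `ψ`. -/
def hermMatrix {N m : ℕ} (g : BilinField N) (ψ : CC m → CC N) (x : CC m) :
    Matrix (Fin m) (Fin m) ℂ :=
  fun j k =>
    (pull g ψ x (EuclideanSpace.single j 1) (EuclideanSpace.single k 1) : ℂ)
      + Complex.I *
        (pull g ψ x (EuclideanSpace.single j 1) (Complex.I • EuclideanSpace.single k 1) : ℂ)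

/-- The Ricci tensor, in holomorphic coordinates, of a Kähler metric: the Ricci form is
`-i ∂∂̄ log det`. -/
def kahlerRicci {N m : ℕ} (g : BilinField N) (ψ : CC m → CC N) (x v w : CC m) : ℝ :=
  levi (fun y => -Real.log (hermMatrix g ψ y).det.re) x v w

/-- The Kähler metric `g` on `M` satisfies `Ric = Λ g`. -/
def IsKahlerEinstein {N : ℕ} (m : ℕ) (M : Set (CC N)) (Λ : ℝ) (g : BilinField N) : Prop :=
  IsKahler m M g ∧
    ∀ U ψ, IsHolChart m M U ψ → ∀ x ∈ U, ∀ v w, kahlerRicci g ψ x v w = Λ * pull g ψ x v w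

/-- The length of the `C¹` path `γ : [0,1] → M`. -/
def pathLength {N : ℕ} (g : BilinField N) (γ : ℝ → CC N) : ℝ≥0∞ :=
  ∫⁻ t in Set.Icc (0 : ℝ) 1,
    ENNReal.ofReal (Real.sqrt
      (g (γ t) (derivWithin γ (Set.Icc 0 1) t) (derivWithin γ (Set.Icc 0 1) t)))

/-- The Riemannian distance of `(M, g)`. -/
def riemDist {N : ℕ} (M : Set (CC N)) (g : BilinField N) (p q : CC N) : ℝ≥0∞ :=
  ⨅ γ ∈ {γ : ℝ → CC N | ContDiffOn ℝ 1 γ (Set.Icc 0 1) ∧ Set.MapsTo γ (Set.Icc 0 1) M ∧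
    γ 0 = p ∧ γ 1 = q}, pathLength g γ

/-- `(M, g)` is complete: every Cauchy sequence for the Riemannian distance converges. -/
def IsCompleteMetric {N : ℕ} (M : Set (CC N)) (g : BilinField N) : Prop :=
  ∀ s : ℕ → CC N, (∀ k, s k ∈ M) →
    (∀ ε : ℝ≥0∞, 0 < ε → ∃ k₀, ∀ i ≥ k₀, ∀ j ≥ k₀, riemDist M g (s i) (s j) < ε) →
    ∃ p ∈ M, Tendsto (fun k => riemDist M g (s k) p) atTop (𝓝 0)

/-! ### The first-order system and its unstable curves -/

/-- `(a, b, c)` solves the system on `(-∞, η)`. -/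
def IsSolution (n : ℕ) (Λ : ℝ) (η : EReal) (a b c : ℝ → ℝ) : Prop :=
  ∀ u : ℝ, (u : EReal) < η →
    HasDerivAt a (1 / 2 * a u * (b u ^ 2 + c u ^ 2 - a u ^ 2)) u ∧
    HasDerivAt b (1 / 2 * b u * (c u ^ 2 + a u ^ 2 - b u ^ 2)) u ∧
    HasDerivAt c (1 / 2 * n * c u *
      (a u ^ 2 + b u ^ 2 - c u ^ 2 - 2 * Λ / n * a u ^ 2 * b u ^ 2)) u

/-- `(a, b, c)`, on its maximal interval of existence `(-∞, η)`, is an unstable curve of the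
critical point `(0, K, L)`: a non-constant solution that tends to `(0, K, L)` as `u → -∞`. -/
structure IsUnstableCurve (n : ℕ) (Λ K L : ℝ) (η : EReal) (a b c : ℝ → ℝ) : Prop where
  bot_lt : ⊥ < η
  solution : IsSolution n Λ η a b c
  maximal : ∀ (η' : EReal) (a' b' c' : ℝ → ℝ), η ≤ η' → IsSolution n Λ η' a' b' c' →
    (∀ u : ℝ, (u : EReal) < η → a' u = a u ∧ b' u = b u ∧ c' u = c u) → η' = η
  tendsto_a : Tendsto a atBot (𝓝 0)
  tendsto_b : Tendsto b atBot (𝓝 K)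
  tendsto_c : Tendsto c atBot (𝓝 L)
  nonconstant : ¬ ∀ u : ℝ, (u : EReal) < η → a u = 0 ∧ b u = K ∧ c u = L

/-! ### The cohomogeneity one metric of a solution -/

/-- The matrix `X_{i,j}` of `so(n+2)`. -/
def X {n : ℕ} (i j : Fin (n + 2)) : Matrix (Fin (n + 2)) (Fin (n + 2)) ℝ :=
  Matrix.single i j 1 - Matrix.single j i 1

/-- `B(X, Y) = -½ Tr XY`. -/
def B {n : ℕ} (P Q : Matrix (Fin (n + 2)) (Fin (n + 2)) ℝ) : ℝ :=
  -(1 / 2) * (P * Q).trace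

/-- The index called `n+1` when coordinates are numbered from `1`. -/
def idx₁ (n : ℕ) : Fin (n + 2) := (Fin.last n).castSucc

/-- The index called `n+2` when coordinates are numbered from `1`. -/
def idx₂ (n : ℕ) : Fin (n + 2) := Fin.last (n + 1)

/-- `∑ ξᵢ X_{i,n+1}`, the general element of `𝔭₁`. -/
def p₁ {n : ℕ} (ξ : Fin n → ℝ) : Matrix (Fin (n + 2)) (Fin (n + 2)) ℝ :=
  ∑ i, ξ i • X (Fin.castAdd 2 i) (idx₁ n)

/-- `∑ ζᵢ X_{i,n+2}`, the general element of `𝔭₂`. -/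
def p₂ {n : ℕ} (ζ : Fin n → ℝ) : Matrix (Fin (n + 2)) (Fin (n + 2)) ℝ :=
  ∑ i, ζ i • X (Fin.castAdd 2 i) (idx₂ n)

/-- `θ X_{n+1,n+2}`, the general element of `𝔭₃`. -/
def p₃ (n : ℕ) (θ : ℝ) : Matrix (Fin (n + 2)) (Fin (n + 2)) ℝ :=
  θ • X (idx₁ n) (idx₂ n)

/-- A tangent vector `σ ∂/∂t + X` at a point of `(-∞, η) × SO(n+2)/SO(n)`,
with `X = p₁ ξ + p₂ ζ + p₃ θ` in `𝔭`. -/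
structure FrameVec (n : ℕ) where
  σ : ℝ
  ξ : Fin n → ℝ
  ζ : Fin n → ℝ
  θ : ℝ

/-- The metric `dt² + a² B|𝔭₁ + b² B|𝔭₂ + c² B|𝔭₃`. -/
def cohomMetric {n : ℕ} (a b c : ℝ) (V W : FrameVec n) : ℝ :=
  V.σ * W.σ + a ^ 2 * B (p₁ V.ξ) (p₁ W.ξ) + b ^ 2 * B (p₂ V.ζ) (p₂ W.ζ)
    + c ^ 2 * B (p₃ n V.θ) (p₃ n W.θ)

/-- The almost complex structure with `X_{i,n+1} ↦ -(a/b) X_{i,n+2}` and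
`∂/∂t ↦ -(1/c) X_{n+1,n+2}`. -/
def cohomJ {n : ℕ} (a b c : ℝ) (V : FrameVec n) : FrameVec n where
  σ := c * V.θ
  ξ := fun i => b / a * V.ζ i
  ζ := fun i => -(a / b) * V.ξ i
  θ := -(1 / c) * V.σ

/-- The action of real matrices on `ℂ^{n+2}`. -/
def act {n : ℕ} (A : Matrix (Fin (n + 2)) (Fin (n + 2)) ℝ) (z : CC (n + 2)) : CC (n + 2) :=
  WithLp.toLp 2 ((A.map Complex.ofReal).mulVec z.ofLp)

/-- The point `cosh r e_{n+2} + i sinh r e_{n+1}` of the quadric; its stabiliser in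
`SO(n+2)` is `SO(n)` if `r ≠ 0`, and it corresponds to the tangent vector `r e_{n+1}` of the
sphere at `e_{n+2}`. -/
def basePoint (n : ℕ) (r : ℝ) : CC (n + 2) :=
  EuclideanSpace.single (idx₂ n) (Real.cosh r : ℂ)
    + EuclideanSpace.single (idx₁ n) (Complex.I * (Real.sinh r : ℂ))

/-- The image of the tangent vector `V` at `(u, A SO(n))` under the differential of the
equivariant map `(u, A SO(n)) ↦ A (cosh r(u) e_{n+2} + i sinh r(u) e_{n+1})`, where
`∂/∂t = (abc)⁻¹ ∂/∂u`. -/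
def pushFrame {n : ℕ} (a b c r : ℝ → ℝ) (u : ℝ) (A : Matrix (Fin (n + 2)) (Fin (n + 2)) ℝ)
    (V : FrameVec n) : CC (n + 2) :=
  (V.σ / (a u * b u * c u)) • deriv (fun u' => act A (basePoint n (r u'))) u
    + act (A * (p₁ V.ξ + p₂ V.ζ + p₃ n V.θ)) (basePoint n (r u))

/-- The metric `g` on the tube of radius `R` in the quadric is an extension over the bolt of the
metric `(abc)² du² + a² B|𝔭₁ + b² B|𝔭₂ + c² B|𝔭₃` on `(-∞, η) × SO(n+2)/SO(n)`, and the complex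
structure of the tube is an extension of the almost complex structure `cohomJ`: the equivariant
map `(u, A SO(n)) ↦ A (cosh r(u) e_{n+2} + i sinh r(u) e_{n+1})`, where `dr = ab du` and `r → 0`
as `u → -∞`, identifies the former with the complement of the zero section in the tube.
(If `ab < 0` then `r < 0`, and the distance from the zero section is `|r|`.) -/
structure Realizes (n : ℕ) (η : EReal) (a b c r : ℝ → ℝ) (R : EReal) (g : BilinField (n + 2)) :
    Prop where
  ne_zero : ∀ u : ℝ, (u : EReal) < η → a u ≠ 0 ∧ b u ≠ 0 ∧ c u ≠ 0
  deriv_r : ∀ u : ℝ, (u : EReal) < η → HasDerivAt r (a u * b u) u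
  tendsto_r : Tendsto r atBot (𝓝 0)
  bijOn : Set.BijOn (fun u => |r u|) {u : ℝ | (u : EReal) < η} {s : ℝ | 0 < s ∧ (s : EReal) < R}
  metric : ∀ u : ℝ, (u : EReal) < η → ∀ A ∈ Matrix.specialOrthogonalGroup (Fin (n + 2)) ℝ,
    ∀ V W : FrameVec n,
      g (act A (basePoint n (r u))) (pushFrame a b c r u A V) (pushFrame a b c r u A W)
        = cohomMetric (a u) (b u) (c u) V W
  complexStructure : ∀ u : ℝ, (u : EReal) < η →
    ∀ A ∈ Matrix.specialOrthogonalGroup (Fin (n + 2)) ℝ, ∀ V : FrameVec n,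
      pushFrame a b c r u A (cohomJ (a u) (b u) (c u) V)
        = Complex.I • pushFrame a b c r u A V

/-! ### Stenzel's metrics -/

/-- `f` solves `((f')^{n+1})' = (n+1) k sinh^n` on `[0, ∞)` with `f'(0) = 0`, and `f' > 0` on
`(0, ∞)` (which is necessary for the metric with potential `f (2 r)` to be positive definite,
and forces `k > 0`). -/
def IsStenzelFunction (n : ℕ) (k : ℝ) (f : ℝ → ℝ) : Prop :=
  ∃ f' : ℝ → ℝ, f' 0 = 0 ∧ (∀ s, 0 < s → 0 < f' s) ∧
    ∀ s, 0 ≤ s → HasDerivWithinAt f (f' s) (Set.Ici 0) s ∧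
      HasDerivWithinAt (fun x => f' x ^ (n + 1)) ((n + 1) * k * Real.sinh s ^ n) (Set.Ici 0) s

/-- `g` is the metric on the quadric with Kähler potential `φ(r) = f(2r)`. -/
def IsStenzelMetric (n : ℕ) (f : ℝ → ℝ) (g : BilinField (n + 2)) : Prop :=
  IsRiemannian (n + 1) (quadric n) g ∧
    HasKahlerPotential (n + 1) (quadric n) g (fun z => f (2 * radius z))

end StenzelTube

end

open StenzelTube

/-! Everything reduces to one function of `τ = ‖z‖² = cosh 2r`. A potential `F(τ)` with `F' = G`
gives the form `radialMetric`. Its Hermitian determinant in a holomorphic chart of the quadric is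
`|δ|² · 2^(n+1) Gⁿ (τG + (τ²-1)G')`, where `δ` is holomorphic and nowhere zero. Since `log |δ|²` is
pluriharmonic, the metric satisfies `Ric = Λg` once `Gⁿ (τG + (τ²-1)G') = C exp(-ΛF)`; this is
`IsEinsteinProfile.isKahlerEinstein`. For `Λ = 0` and `f(s) = F(cosh s)` the equation becomes
Stenzel's, with `k = C`.

In the frame along `basePoint` the metric is diagonal, with `a² = 2G sinh² r`, `b² = 2G cosh² r`,
`c² = 2(τG + (τ²-1)G')`, and `tanh r = a/b` expresses that `J` is multiplication by `i`
(`realizes_of_profile`). Conversely, along an unstable curve `b² - a² > 0`, the function `r =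
artanh(a/b)` satisfies `dr = ab du`, and `τ = (a²+b²)/(b²-a²)` is strictly increasing. So `G(τ) =
(b²-a²)/2` is well defined, and the conservation of `(b²-a²)ⁿ c² exp(ΛF)` is the equation of the
profile (`IsPosCurve.conserved`, `IsPosCurve.exists_profile`).

The delicate point is smoothness across the zero section, where the equation is singular at `τ = 1`.
The function `J = (cosh r · G)^(n+1)/(n+1)` solves a linear equation `(n+1)J + 2(τ-1)J' = q`, whose
only solution continuous up to `τ = 1` is `∫₀¹ xⁿ q(1+(τ-1)x²) dx`. This formula is smooth at `τ =
1` and allows a bootstrap on the regularity of `F` (`eq_of_singular_ode`, `contDiffOn_of_integral`).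

Globally, `F` is unbounded along every unstable curve (`IsPosCurve.potential_unbounded`). If `Λ =
0`, then `G` is bounded, so `τ` is unbounded and the tube is the whole quadric. If `Λ < 0`, a
comparison gives `c² ≥ ε a²b²`, which bounds `r`. Completeness follows from a proper function of `τ`
with gradient at most one: a multiple of `log τ` if `Λ = 0`, a multiple of `F` if `Λ < 0`.

For the converse, Stenzel's equation determines `f` from `f(0)`, so every solution is a profile.
Solving `du = dr/(G sinh 2r)` recovers the curve, which is maximal because `r` is unbounded while
`dr/du = ab` would stay bounded if the curve could be prolonged (`IsEinsteinProfile.exists_curve`).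
-/

/-! ### Smoothness of holomorphic functions of several variables. -/

section SeveralComplexVariables

variable {E F : Type*} [NormedAddCommGroup E] [NormedSpace ℂ E]
  [NormedAddCommGroup F] [NormedSpace ℂ F]

/-- Restriction to complex lines makes the one-variable Cauchy formulas available. -/
theorem hasDerivAt_comp_line {f : E → F} {x v : E} {ζ : ℂ}
    (hf : DifferentiableAt ℂ f (x + ζ • v)) :
    HasDerivAt (fun ζ : ℂ => f (x + ζ • v)) (fderiv ℂ f (x + ζ • v) v) ζ := by
  have h1 : HasDerivAt (fun ζ : ℂ => x + ζ • v) v ζ := by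
    simpa using ((hasDerivAt_id ζ).smul_const v).const_add x
  exact hf.hasFDerivAt.comp_hasDerivAt ζ h1

theorem line_mem_closedBall {x₀ x v : E} {ζ : ℂ} {δ ε ε' : ℝ} (hx : x ∈ Metric.closedBall x₀ ε)
    (hζ : ‖ζ‖ ≤ δ) (hδ : δ * ‖v‖ ≤ ε') : x + ζ • v ∈ Metric.closedBall x₀ (ε + ε') := by
  rw [mem_closedBall_iff_norm] at hx ⊢
  calc ‖x + ζ • v - x₀‖ = ‖(x - x₀) + ζ • v‖ := by congr 1; abel
    _ ≤ ‖x - x₀‖ + ‖ζ • v‖ := norm_add_le _ _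
    _ ≤ ε + ε' := by
      rw [norm_smul]
      exact add_le_add hx ((mul_le_mul_of_nonneg_right hζ (norm_nonneg _)).trans hδ)

/-- The Cauchy estimate for the Fréchet derivative. -/
theorem norm_fderiv_le_of_norm_le {f : E → F} {x : E} {ε M : ℝ} (hε : 0 < ε)
    (hf : ∀ y ∈ Metric.closedBall x ε, DifferentiableAt ℂ f y)
    (hM : ∀ y ∈ Metric.closedBall x ε, ‖f y‖ ≤ M) : ‖fderiv ℂ f x‖ ≤ M / ε := by
  have hM0 : 0 ≤ M := (norm_nonneg _).trans (hM x (Metric.mem_closedBall_self hε.le))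
  refine ContinuousLinearMap.opNorm_le_bound _ (by positivity) fun v => ?_
  rcases eq_or_ne v 0 with rfl | hv
  · simp
  have hv' : 0 < ‖v‖ := norm_pos_iff.2 hv
  have hδ : 0 < ε / ‖v‖ := by positivity
  have hmem : ∀ ζ : ℂ, ‖ζ‖ ≤ ε / ‖v‖ → x + ζ • v ∈ Metric.closedBall x ε := fun ζ hζ => by
    simpa using line_mem_closedBall (x₀ := x) (x := x) (ε := 0) (by simp) hζ
      (by rw [div_mul_cancel₀ _ hv'.ne'] : ε / ‖v‖ * ‖v‖ ≤ ε)
  have hd : ∀ ζ : ℂ, ‖ζ‖ ≤ ε / ‖v‖ →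
      DifferentiableAt ℂ (fun ζ : ℂ => f (x + ζ • v)) ζ := fun ζ hζ =>
    (hasDerivAt_comp_line (hf _ (hmem ζ hζ))).differentiableAt
  have h := Complex.norm_deriv_le_of_forall_mem_sphere_norm_le (c := 0) (C := M)
    (f := fun ζ : ℂ => f (x + ζ • v)) hδ
    (DifferentiableOn.diffContOnCl fun ζ hζ => (hd ζ (by
      simpa using Metric.closure_ball_subset_closedBall hζ)).differentiableWithinAt)
    fun ζ hζ => hM _ (hmem ζ (by simpa using (mem_sphere_zero_iff_norm.1 hζ).le))
  have h0 : _root_.deriv (fun ζ : ℂ => f (x + ζ • v)) 0 = fderiv ℂ f x v := by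
    have := (hasDerivAt_comp_line (v := v) (hf _ (hmem 0 (by simpa using hδ.le)))).deriv
    simpa using this
  rw [h0] at h
  calc _ ≤ _ := h
    _ = M / ε * ‖v‖ := by field_simp

/-- Cauchy's formula on the line `x + ζ v` writes `fderiv ℂ f x v` as an integral of values of `f`
over a circle of fixed radius. The integrand is holomorphic in `x`, and the Cauchy estimate
dominates its derivative, so one may differentiate under the integral. -/
theorem DifferentiableOn.fderiv_apply_of_isOpen [FiniteDimensional ℂ E]
    [FiniteDimensional ℂ F] {f : E → F} {U : Set E} (hU : IsOpen U)
    (hf : DifferentiableOn ℂ f U) (v : E) :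
    DifferentiableOn ℂ (fun x => fderiv ℂ f x v) U := by
  intro x₀ hx₀
  have : ProperSpace E := FiniteDimensional.proper ℂ E
  have hdf : ∀ y ∈ U, DifferentiableAt ℂ f y := fun y hy => hf.differentiableAt (hU.mem_nhds hy)
  obtain ⟨r, hr, hrU⟩ := Metric.nhds_basis_closedBall.mem_iff.1 (hU.mem_nhds hx₀)
  -- The base point moves by at most one `ε`, the circle adds a second, and the Cauchy estimate on
  -- the circle uses the third.
  obtain ⟨ε, hε, hεr⟩ : ∃ ε : ℝ, 0 < ε ∧ r = ε + ε + ε := ⟨r / 3, by positivity, by ring⟩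
  have hsub : ∀ y ∈ Metric.closedBall x₀ (ε + ε + ε), DifferentiableAt ℂ f y := fun y hy =>
    hdf y (hrU (hεr ▸ hy))
  obtain ⟨M, hM⟩ := (isCompact_closedBall x₀ (ε + ε + ε)).exists_bound_of_continuousOn
    (f := f) fun y hy => (hsub y hy).continuousAt.continuousWithinAt
  have hbound : ∀ y ∈ Metric.closedBall x₀ (ε + ε), ‖fderiv ℂ f y‖ ≤ M / ε := by
    intro y hy
    have hyb : Metric.closedBall y ε ⊆ Metric.closedBall x₀ (ε + ε + ε) :=
      Metric.closedBall_subset_closedBall' (by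
        rw [Metric.mem_closedBall] at hy; linarith)
    exact norm_fderiv_le_of_norm_le hε (fun z hz => hsub z (hyb hz)) fun z hz => hM z (hyb hz)
  obtain ⟨δ, hδ, hδv⟩ : ∃ δ : ℝ, 0 < δ ∧ δ * ‖v‖ ≤ ε := by
    refine ⟨ε / (‖v‖ + 1), by positivity, ?_⟩
    rw [div_mul_eq_mul_div, div_le_iff₀ (by positivity)]
    nlinarith [norm_nonneg v]
  have hline : ∀ x ∈ Metric.closedBall x₀ ε, ∀ ζ : ℂ, ‖ζ‖ ≤ δ →
      x + ζ • v ∈ Metric.closedBall x₀ (ε + ε) := fun x hx ζ hζ =>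
    line_mem_closedBall hx hζ hδv
  have hmono : Metric.closedBall x₀ (ε + ε) ⊆ Metric.closedBall x₀ (ε + ε + ε) :=
    Metric.closedBall_subset_closedBall (by linarith)
  have hcircle : ∀ θ : ℝ, ‖circleMap 0 δ θ‖ = δ := fun θ => by simp [hδ.le]
  have hcirc_ne : ∀ θ : ℝ, circleMap 0 δ θ ≠ 0 := fun θ => by
    rw [← norm_pos_iff, hcircle]; exact hδ
  -- The kernel `dζ/ζ²` in terms of the angle.
  let w : ℝ → ℂ := fun θ => _root_.deriv (circleMap 0 δ) θ * ((circleMap 0 δ θ) ^ 2)⁻¹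
  have hw : Continuous w := by
    simp only [w, deriv_circleMap]
    have h1 : Continuous (circleMap 0 δ) := continuous_circleMap 0 δ
    refine (h1.mul continuous_const).mul ((h1.pow 2).inv₀ fun θ => pow_ne_zero 2 (hcirc_ne θ))
  have hwn : ∀ θ, ‖w θ‖ = δ⁻¹ := fun θ => by
    simp only [w, deriv_circleMap, norm_mul, norm_inv, norm_pow, hcircle, Complex.norm_I]
    field_simp
  have hformula : ∀ x ∈ Metric.ball x₀ ε, fderiv ℂ f x v =
      (2 * Real.pi * Complex.I : ℂ)⁻¹ •
        ∫ θ in (0 : ℝ)..2 * Real.pi, w θ • f (x + circleMap 0 δ θ • v) := by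
    intro x hx
    have hxc := Metric.ball_subset_closedBall hx
    let V : Set ℂ := (fun ζ : ℂ => x + ζ • v) ⁻¹' U
    have hV : IsOpen V := hU.preimage (by fun_prop)
    have hVb : Metric.closedBall (0 : ℂ) δ ⊆ V := fun ζ hζ =>
      hrU (hεr ▸ hmono (hline x hxc ζ (by simpa using hζ)))
    have key := Complex.two_pi_I_inv_smul_circleIntegral_sub_sq_inv_smul_of_differentiable
      (f := fun ζ : ℂ => f (x + ζ • v)) hV hVb
      (fun ζ hζ => (hasDerivAt_comp_line (hdf _ hζ)).differentiableAt.differentiableWithinAt)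
      (Metric.mem_ball_self hδ)
    have h0 : _root_.deriv (fun ζ : ℂ => f (x + ζ • v)) 0 = fderiv ℂ f x v := by
      have := (hasDerivAt_comp_line (v := v) (ζ := 0) (x := x)
        (hdf _ (hVb (Metric.mem_closedBall_self hδ.le)))).deriv
      simpa using this
    rw [h0] at key
    rw [← key]
    simp only [circleIntegral, smul_smul, sub_zero, w]
  have hcontF : ∀ x ∈ Metric.ball x₀ ε,
      Continuous fun θ : ℝ => w θ • f (x + circleMap 0 δ θ • v) := by
    intro x hx
    have hlc : Continuous fun θ : ℝ => x + circleMap 0 δ θ • v :=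
      continuous_const.add ((continuous_circleMap 0 δ).smul continuous_const)
    refine hw.smul (continuous_iff_continuousAt.2 fun θ => ?_)
    exact ContinuousAt.comp (f := fun θ : ℝ => x + circleMap 0 δ θ • v) (g := f)
      (hsub _ (hmono (hline x (Metric.ball_subset_closedBall hx) _ (hcircle θ).le))).continuousAt
      hlc.continuousAt
  have hder : HasFDerivAt
      (fun x => ∫ θ in (0 : ℝ)..2 * Real.pi, w θ • f (x + circleMap 0 δ θ • v))
      (∫ θ in (0 : ℝ)..2 * Real.pi, w θ • fderiv ℂ f (x₀ + circleMap 0 δ θ • v)) x₀ := by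
    refine intervalIntegral.hasFDerivAt_integral_of_dominated_of_fderiv_le
      (s := Metric.ball x₀ ε) (bound := fun _ => δ⁻¹ * (M / ε))
      (F' := fun x θ => w θ • fderiv ℂ f (x + circleMap 0 δ θ • v))
      (Metric.ball_mem_nhds x₀ hε) ?_ ?_ ?_ ?_ ?_ ?_
    · filter_upwards [Metric.ball_mem_nhds x₀ hε] with x hx
      exact (hcontF x hx).aestronglyMeasurable
    · exact (hcontF x₀ (Metric.mem_ball_self hε)).intervalIntegrable _ _
    · refine hw.aestronglyMeasurable.smul ?_
      borelize E
      borelize (E →L[ℂ] F)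
      have hm : Measurable fun θ : ℝ => fderiv ℂ f (x₀ + circleMap 0 δ θ • v) :=
        (measurable_fderiv ℂ f).comp (continuous_const.add
          ((continuous_circleMap 0 δ).smul continuous_const)).measurable
      have : FiniteDimensional ℂ (E →L[ℂ] F) := inferInstance
      have : ProperSpace (E →L[ℂ] F) := FiniteDimensional.proper ℂ _
      exact hm.aestronglyMeasurable
    · refine Eventually.of_forall fun θ _ x hx => ?_
      rw [norm_smul, hwn]
      exact mul_le_mul_of_nonneg_left
        (hbound _ (hline x (Metric.ball_subset_closedBall hx) _ (hcircle θ).le)) (by positivity)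
    · exact intervalIntegrable_const
    · refine Eventually.of_forall fun θ _ x hx => ?_
      have h1 := (hsub _ (hmono (hline x (Metric.ball_subset_closedBall hx) _
        (hcircle θ).le))).hasFDerivAt
      have h2 : HasFDerivAt (fun x => x + circleMap 0 δ θ • v) (ContinuousLinearMap.id ℂ E) x :=
        (hasFDerivAt_id x).add_const _
      exact ((h1.comp x h2).const_smul (w θ))
  refine DifferentiableAt.differentiableWithinAt ?_
  refine ((hder.const_smul (2 * Real.pi * Complex.I : ℂ)⁻¹).congr_of_eventuallyEq
    ?_).differentiableAt
  filter_upwards [Metric.ball_mem_nhds x₀ hε] with x hx using hformula x hx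

/-- A function of several complex variables which is complex differentiable is smooth. -/
theorem DifferentiableOn.contDiffOn_of_isOpen [FiniteDimensional ℂ E]
    [FiniteDimensional ℂ F] {f : E → F} {U : Set E} (hU : IsOpen U)
    (hf : DifferentiableOn ℂ f U) : ContDiffOn ℂ ∞ f U := by
  refine contDiffOn_infty.2 fun k => ?_
  induction k generalizing f with
  | zero => exact contDiffOn_zero.2 hf.continuousOn
  | succ k ih =>
    have := (contDiffOn_succ_iff_fderiv_of_isOpen (n := (k : WithTop ℕ∞)) (𝕜 := ℂ) (f := f) hU).2
      ⟨hf, by simp, contDiffOn_clm_apply.2 fun v => ih (hf.fderiv_apply_of_isOpen hU v)⟩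
    exact_mod_cast this

end SeveralComplexVariables

/-! ### The form `i ∂∂̄ h`: closedness, chain rule, pluriharmonic functions. -/

section LeviForm

theorem real_inner_eq_re {N : ℕ} (z w : CC N) : inner ℝ z w = (inner ℂ z w).re := by
  simp [PiLp.inner_apply, Complex.inner, mul_comm]

variable {m : ℕ} {U : Set (CC m)} {x : CC m}

theorem fderiv_fderiv_apply_comm {h : CC m → ℝ} (hU : IsOpen U) (hh : ContDiffOn ℝ 2 h U)
    (hx : x ∈ U) (v w : CC m) :
    fderiv ℝ (fun y => fderiv ℝ h y w) x v = fderiv ℝ (fun y => fderiv ℝ h y v) x w := by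
  have hc : ContDiffAt ℝ 2 h x := hh.contDiffAt (hU.mem_nhds hx)
  have hd : DifferentiableAt ℝ (fderiv ℝ h) x :=
    (hc.fderiv_right (m := 1) (by norm_num)).differentiableAt (by norm_num)
  have e : ∀ a b : CC m, fderiv ℝ (fun y => fderiv ℝ h y a) x b = fderiv ℝ (fderiv ℝ h) x b a := by
    intro a b
    have := (hd.hasFDerivAt.clm_apply (hasFDerivAt_const a x)).fderiv
    rw [this]; simp
  rw [e, e]
  exact (hc.isSymmSndFDerivAt (by simp)).eq v w

theorem ContDiffOn.fderiv_apply_of_isOpen {h : CC m → ℝ} (hU : IsOpen U)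
    (hh : ContDiffOn ℝ ∞ h U) (w : CC m) : ContDiffOn ℝ ∞ (fun y => fderiv ℝ h y w) U :=
  ContDiffOn.clm_apply (f := fderiv ℝ h) (g := fun _ => w)
    (hh.fderiv_of_isOpen hU (m := ∞) (by simp)) contDiffOn_const

theorem levi_congr {h h' : CC m → ℝ} (e : h =ᶠ[𝓝 x] h') (v w : CC m) :
    levi h x v w = levi h' x v w := by
  have e2 : ∀ w : CC m, (fun y => fderiv ℝ h y w) =ᶠ[𝓝 x] fun y => fderiv ℝ h' y w := fun w => by
    filter_upwards [Filter.EventuallyEq.fderiv (𝕜 := ℝ) e] with y hy using by rw [hy]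
  simp only [levi, (e2 _).fderiv_eq]

theorem levi_add {h h' : CC m → ℝ} (hU : IsOpen U) (hx : x ∈ U) (hh : ContDiffOn ℝ ∞ h U)
    (hh' : ContDiffOn ℝ ∞ h' U) (v w : CC m) :
    levi (fun y => h y + h' y) x v w = levi h x v w + levi h' x v w := by
  have e : ∀ w : CC m, (fun y => fderiv ℝ (fun y => h y + h' y) y w) =ᶠ[𝓝 x]
      fun y => fderiv ℝ h y w + fderiv ℝ h' y w := fun w => by
    filter_upwards [hU.mem_nhds hx] with y hy
    have := fderiv_add ((hh.contDiffAt (hU.mem_nhds hy)).differentiableAt (by simp))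
      ((hh'.contDiffAt (hU.mem_nhds hy)).differentiableAt (by simp))
    rw [show (fun y => h y + h' y) = h + h' from rfl, this]; rfl
  have e2 : ∀ v w : CC m, fderiv ℝ (fun y => fderiv ℝ h y w + fderiv ℝ h' y w) x v
      = fderiv ℝ (fun y => fderiv ℝ h y w) x v + fderiv ℝ (fun y => fderiv ℝ h' y w) x v := by
    intro v w
    have := fderiv_add (((hh.fderiv_apply_of_isOpen hU w).contDiffAt
        (hU.mem_nhds hx)).differentiableAt (by simp))
      (((hh'.fderiv_apply_of_isOpen hU w).contDiffAt (hU.mem_nhds hx)).differentiableAt (by simp))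
    exact congrArg (fun L => L v) this
  simp only [levi, (e _).fderiv_eq, e2]
  ring

theorem levi_const_mul {h : CC m → ℝ} (hU : IsOpen U) (hx : x ∈ U) (hh : ContDiffOn ℝ ∞ h U)
    (c : ℝ) (v w : CC m) :
    levi (fun y => c * h y) x v w = c * levi h x v w := by
  have e : ∀ w : CC m, (fun y => fderiv ℝ (fun y => c * h y) y w) =ᶠ[𝓝 x]
      fun y => c * fderiv ℝ h y w := fun w => by
    filter_upwards [hU.mem_nhds hx] with y hy
    rw [fderiv_const_mul ((hh.contDiffAt (hU.mem_nhds hy)).differentiableAt (by simp))]; rfl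
  have e2 : ∀ v w : CC m, fderiv ℝ (fun y => c * fderiv ℝ h y w) x v
      = c * fderiv ℝ (fun y => fderiv ℝ h y w) x v := by
    intro v w
    rw [fderiv_const_mul (((hh.fderiv_apply_of_isOpen hU w).contDiffAt
        (hU.mem_nhds hx)).differentiableAt (by simp))]; rfl
  simp only [levi, (e _).fderiv_eq, e2]
  ring

theorem levi_const (c : ℝ) (v w : CC m) : levi (fun _ => c) x v w = 0 := by
  simp [levi]

/-- The form `i ∂∂̄ h` is closed. -/
theorem levi_closed {h : CC m → ℝ} (hU : IsOpen U) (hx : x ∈ U) (hh : ContDiffOn ℝ ∞ h U)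
    (v₁ v₂ v₃ : CC m) :
    fderiv ℝ (fun y => levi h y (Complex.I • v₂) v₃) x v₁
      + fderiv ℝ (fun y => levi h y (Complex.I • v₃) v₁) x v₂
      + fderiv ℝ (fun y => levi h y (Complex.I • v₁) v₂) x v₃ = 0 := by
  have hd : ∀ a b : CC m,
      ContDiffOn ℝ ∞ (fun y => fderiv ℝ (fun y => fderiv ℝ h y a) y b) U := fun a b =>
    (hh.fderiv_apply_of_isOpen hU a).fderiv_apply_of_isOpen hU b
  have hda : ∀ a b : CC m,
      DifferentiableAt ℝ (fun y => fderiv ℝ (fun y => fderiv ℝ h y a) y b) x := fun a b =>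
    ((hd a b).contDiffAt (hU.mem_nhds hx)).differentiableAt (by simp)
  -- `T` is the third derivative of `h`, symmetric in all arguments. Each term of the cyclic sum is
  -- a difference of two of its entries, each with one argument multiplied by `i`, and the six
  -- entries cancel in pairs.
  let T : CC m → CC m → CC m → ℝ := fun a b c =>
    fderiv ℝ (fun y => fderiv ℝ (fun y => fderiv ℝ h y c) y b) x a
  have s12 : ∀ a b c, T a b c = T b a c := fun a b c =>
    fderiv_fderiv_apply_comm hU (contDiffOn_infty.1 (hh.fderiv_apply_of_isOpen hU c) 2) hx a b
  have s23 : ∀ a b c, T a b c = T a c b := fun a b c => by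
    have : (fun y => fderiv ℝ (fun y => fderiv ℝ h y c) y b) =ᶠ[𝓝 x]
        fun y => fderiv ℝ (fun y => fderiv ℝ h y b) y c := by
      filter_upwards [hU.mem_nhds hx] with y hy
      exact fderiv_fderiv_apply_comm hU (contDiffOn_infty.1 hh 2) hy b c
    simp only [T, this.fderiv_eq]
  have key : ∀ a b c : CC m, fderiv ℝ (fun y => levi h y (Complex.I • b) c) x a
      = (T a (Complex.I • b) c - T a b (Complex.I • c)) / 2 := by
    intro a b c
    have e : (fun y => levi h y (Complex.I • b) c) = fun y =>
        (2 : ℝ)⁻¹ * (fderiv ℝ (fun y => fderiv ℝ h y c) y (Complex.I • b)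
          - fderiv ℝ (fun y => fderiv ℝ h y (Complex.I • c)) y b) := by
      ext y
      simp only [levi, smul_smul, Complex.I_mul_I, neg_smul, one_smul, map_neg]
      ring
    have h1 := (((hda c (Complex.I • b)).hasFDerivAt.sub
      (hda (Complex.I • c) b).hasFDerivAt).const_mul (2 : ℝ)⁻¹).fderiv
    rw [e]
    refine (congrArg (fun L => L a) h1).trans ?_
    simp only [smul_apply, sub_apply, smul_eq_mul, T]
    ring
  rw [key, key, key]
  rw [s23 v₁ (Complex.I • v₂), s12 v₁ v₃, s23 v₂ (Complex.I • v₃), s12 v₂ v₁,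
    s23 v₃ (Complex.I • v₁), s12 v₃ v₂]
  ring

/-- This is `i∂∂̄ F(ρ) = F'(ρ) i∂∂̄ρ + F''(ρ) i∂ρ∧∂̄ρ`. Derivatives within `S` must be allowed: on
the zero section `ρ = ‖z‖²` takes the value `1`, the endpoint of the domain of `F`. -/
theorem levi_comp {ρ : CC m → ℝ} {F G G' : ℝ → ℝ} {S : Set ℝ} (hU : IsOpen U) (hx : x ∈ U)
    (hρ : ContDiffOn ℝ ∞ ρ U) (hS : Set.MapsTo ρ U S)
    (hF : ∀ τ ∈ S, HasDerivWithinAt F (G τ) S τ) (hG : ∀ τ ∈ S, HasDerivWithinAt G (G' τ) S τ)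
    (v w : CC m) :
    levi (F ∘ ρ) x v w = G (ρ x) * levi ρ x v w + G' (ρ x) *
      ((fderiv ℝ ρ x v * fderiv ℝ ρ x w
        + fderiv ℝ ρ x (Complex.I • v) * fderiv ℝ ρ x (Complex.I • w)) / 2) := by
  have chain : ∀ (F G : ℝ → ℝ), (∀ τ ∈ S, HasDerivWithinAt F (G τ) S τ) → ∀ y ∈ U,
      HasFDerivAt (F ∘ ρ) (G (ρ y) • fderiv ℝ ρ y) y := by
    intro F G hF y hy
    have h1 : HasFDerivWithinAt ρ (fderiv ℝ ρ y) U y :=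
      ((hρ.contDiffAt (hU.mem_nhds hy)).differentiableAt (by simp)).hasFDerivAt.hasFDerivWithinAt
    exact ((hF _ (hS hy)).comp_hasFDerivWithinAt y h1 hS).hasFDerivAt (hU.mem_nhds hy)
  have e : ∀ w : CC m, (fun y => fderiv ℝ (F ∘ ρ) y w) =ᶠ[𝓝 x]
      fun y => (G ∘ ρ) y * fderiv ℝ ρ y w := fun w => by
    filter_upwards [hU.mem_nhds hx] with y hy
    rw [(chain F G hF y hy).fderiv]; rfl
  have e2 : ∀ v w : CC m, fderiv ℝ (fun y => (G ∘ ρ) y * fderiv ℝ ρ y w) x v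
      = G (ρ x) * fderiv ℝ (fun y => fderiv ℝ ρ y w) x v
        + G' (ρ x) * (fderiv ℝ ρ x v * fderiv ℝ ρ x w) := by
    intro v w
    have hd := ((hρ.fderiv_apply_of_isOpen hU w).contDiffAt (hU.mem_nhds hx)).differentiableAt
      (by simp)
    refine (congrArg (fun L => L v) ((chain G G' hG x hx).mul hd.hasFDerivAt).fderiv).trans ?_
    simp
    ring
  simp only [levi, (e _).fderiv_eq, e2]
  ring

theorem hasFDerivAt_real {ψ : CC m → F} [NormedAddCommGroup F] [NormedSpace ℂ F]
    (hd : DifferentiableAt ℂ ψ x) :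
    HasFDerivAt (𝕜 := ℝ) ψ ((fderiv ℂ ψ x).restrictScalars ℝ) x :=
  hd.hasFDerivAt.restrictScalars ℝ

theorem fderiv_norm_sq_comp {N : ℕ} {ψ : CC m → CC N} (hd : DifferentiableAt ℂ ψ x) (w : CC m) :
    fderiv ℝ (fun y => ‖ψ y‖ ^ 2) x w = 2 * (inner ℂ (ψ x) (fderiv ℂ ψ x w)).re := by
  have h := (hasFDerivAt_real hd).norm_sq
  rw [h.fderiv]
  simp [real_inner_eq_re]

theorem levi_norm_sq_comp {N : ℕ} {ψ : CC m → CC N} (hU : IsOpen U)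
    (hψ : DifferentiableOn ℂ ψ U) (hx : x ∈ U) (v w : CC m) :
    levi (fun y => ‖ψ y‖ ^ 2) x v w
      = 2 * (inner ℂ (fderiv ℂ ψ x v) (fderiv ℂ ψ x w)).re := by
  have hd : ∀ y ∈ U, DifferentiableAt ℂ ψ y := fun y hy => hψ.differentiableAt (hU.mem_nhds hy)
  have hd2 : ∀ w, DifferentiableAt ℂ (fun y => fderiv ℂ ψ y w) x := fun w =>
    (hψ.fderiv_apply_of_isOpen hU w).differentiableAt (hU.mem_nhds hx)
  have e : ∀ w : CC m, (fun y => fderiv ℝ (fun y => ‖ψ y‖ ^ 2) y w) =ᶠ[𝓝 x]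
      fun y => 2 * inner ℝ (ψ y) (fderiv ℂ ψ y w) := fun w => by
    filter_upwards [hU.mem_nhds hx] with y hy
    rw [fderiv_norm_sq_comp (hd y hy), real_inner_eq_re]
  have e2 : ∀ v w : CC m, fderiv ℝ (fun y => 2 * inner ℝ (ψ y) (fderiv ℂ ψ y w)) x v
      = 2 * ((inner ℂ (ψ x) (fderiv ℂ (fun y => fderiv ℂ ψ y w) x v)).re
        + (inner ℂ (fderiv ℂ ψ x v) (fderiv ℂ ψ x w)).re) := by
    intro v w
    have h1 := ((hasFDerivAt_real (hd x hx)).inner ℝ (hasFDerivAt_real (hd2 w))).const_mul 2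
    rw [h1.fderiv]
    simp [real_inner_eq_re]
  -- The second derivative of `ψ` is complex bilinear, so its contributions at `(v, w)` and `(iv,
  -- iw)` cancel.
  have e3 : fderiv ℂ (fun y => fderiv ℂ ψ y (Complex.I • w)) x (Complex.I • v)
      = - fderiv ℂ (fun y => fderiv ℂ ψ y w) x v := by
    have : (fun y => fderiv ℂ ψ y (Complex.I • w)) = fun y => Complex.I • fderiv ℂ ψ y w := by
      ext1 y; rw [map_smul]
    rw [this, fderiv_fun_const_smul (hd2 w)]
    simp [smul_smul]
  simp only [levi, (e _).fderiv_eq, e2, e3]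
  simp only [map_smul, inner_neg_right, inner_smul_left, inner_smul_right, Complex.conj_I]
  rw [show ∀ z : ℂ, Complex.I * (-Complex.I * z) = z from fun z => by
    rw [← mul_assoc]; simp]
  simp
  ring

/-- The logarithm of the absolute value of a holomorphic function is pluriharmonic. -/
theorem levi_log_normSq {δ : CC m → ℂ} (hU : IsOpen U) (hδ : DifferentiableOn ℂ δ U)
    (h0 : ∀ y ∈ U, δ y ≠ 0) (hx : x ∈ U) (v w : CC m) :
    levi (fun y => Real.log (‖δ y‖ ^ 2)) x v w = 0 := by
  have hd : ∀ y ∈ U, DifferentiableAt ℂ δ y := fun y hy => hδ.differentiableAt (hU.mem_nhds hy)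
  have hq : ∀ w, DifferentiableAt ℂ (fun y => fderiv ℂ δ y w / δ y) x := fun w =>
    by
    have h1 := (hδ.fderiv_apply_of_isOpen hU w).differentiableAt (hU.mem_nhds hx)
    simp only [div_eq_mul_inv]
    exact h1.mul ((hd x hx).inv (h0 x hx))
  have e : ∀ w : CC m, (fun y => fderiv ℝ (fun y => Real.log (‖δ y‖ ^ 2)) y w) =ᶠ[𝓝 x]
      fun y => 2 * (fderiv ℂ δ y w / δ y).re := fun w => by
    filter_upwards [hU.mem_nhds hx] with y hy
    have hne : ‖δ y‖ ^ 2 ≠ 0 := pow_ne_zero 2 (norm_ne_zero_iff.2 (h0 y hy))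
    have h1 := ((hasFDerivAt_real (hd y hy)).norm_sq).log hne
    rw [h1.fderiv]
    simp only [smul_apply, ContinuousLinearMap.comp_apply, smul_eq_mul,
      innerSL_apply_apply, ContinuousLinearMap.coe_restrictScalars', nsmul_eq_mul]
    rw [Complex.inner, Complex.div_re, ← Complex.normSq_eq_norm_sq]
    have hne' : Complex.normSq (δ y) ≠ 0 := by rwa [Complex.normSq_eq_norm_sq]
    simp
    field_simp
  have e2 : ∀ v w : CC m, fderiv ℝ (fun y => 2 * (fderiv ℂ δ y w / δ y).re) x v
      = 2 * (fderiv ℂ (fun y => fderiv ℂ δ y w / δ y) x v).re := by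
    intro v w
    have h1 := ((Complex.reCLM.hasFDerivAt).comp x (hasFDerivAt_real (hq w))).const_mul 2
    have h2 : (fun y => 2 * (Complex.reCLM ∘ fun y => fderiv ℂ δ y w / δ y) y)
      = fun y => 2 * (fderiv ℂ δ y w / δ y).re := rfl
    rw [h2] at h1
    rw [h1.fderiv]
    simp
  -- `d log |δ|² = 2 Re(dδ/δ)`, and the derivative of the holomorphic form `dδ/δ` is complex
  -- bilinear; the two halves of `levi` are therefore opposite.
  have e3 : fderiv ℂ (fun y => fderiv ℂ δ y (Complex.I • w) / δ y) x (Complex.I • v)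
      = - fderiv ℂ (fun y => fderiv ℂ δ y w / δ y) x v := by
    have : (fun y => fderiv ℂ δ y (Complex.I • w) / δ y)
        = fun y => Complex.I • (fderiv ℂ δ y w / δ y) := by
      ext1 y; rw [map_smul, smul_div_assoc]
    rw [this, fderiv_fun_const_smul (hq w)]
    simp [← mul_assoc]
  simp only [levi, (e _).fderiv_eq, e2, e3]
  simp

end LeviForm

/-! ### The metric with potential `F(‖z‖²)`. -/

section RadialMetric

/-- The `U(N)`-invariant form `2 G Re⟨V, W⟩ + 2 G' Re(conj ⟨z, V⟩ ⟨z, W⟩)`, with `G`, `G'` evaluated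
at `‖z‖²`: for `G = F'` it is the form given by the Kähler potential `F (‖z‖²)`. -/
noncomputable def radialMetric (N : ℕ) (G G' : ℝ → ℝ) : BilinField N := fun z =>
  (2 * G (‖z‖ ^ 2)) • (id (innerSL ℝ) : CC N →L[ℝ] CC N →L[ℝ] ℝ) + (2 * G' (‖z‖ ^ 2)) •
    ((innerSL ℝ z).smulRight (innerSL ℝ z)
      + (innerSL ℝ (Complex.I • z)).smulRight (innerSL ℝ (Complex.I • z)))

theorem radialMetric_apply {N : ℕ} (G G' : ℝ → ℝ) (z V W : CC N) :
    radialMetric N G G' z V W = 2 * G (‖z‖ ^ 2) * (inner ℂ V W).re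
      + 2 * G' (‖z‖ ^ 2) * ((inner ℂ z V).re * (inner ℂ z W).re
        + (inner ℂ z V).im * (inner ℂ z W).im) := by
  simp only [radialMetric, id, add_apply, smul_apply, ContinuousLinearMap.smulRight_apply,
    smul_eq_mul]
  erw [innerSL_apply_apply]
  simp only [innerSL_apply_apply, real_inner_eq_re, inner_smul_left, Complex.conj_I]
  simp

theorem radialMetric_I_smul {N : ℕ} (G G' : ℝ → ℝ) (z V W : CC N) :
    radialMetric N G G' z (Complex.I • V) (Complex.I • W) = radialMetric N G G' z V W := by
  rw [radialMetric_apply, radialMetric_apply]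
  simp only [inner_smul_left, inner_smul_right, Complex.conj_I, Complex.mul_re, Complex.mul_im,
    Complex.neg_re, Complex.neg_im, Complex.I_re, Complex.I_im]
  ring

variable {m N : ℕ} {U : Set (CC m)} {x : CC m} {ψ : CC m → CC N}

theorem contDiffOn_real_of_differentiableOn {F : Type*} [NormedAddCommGroup F] [NormedSpace ℂ F]
    [FiniteDimensional ℂ F] {f : CC m → F} (hU : IsOpen U)
    (hf : DifferentiableOn ℂ f U) : ContDiffOn ℝ ∞ f U :=
  (hf.contDiffOn_of_isOpen hU).restrict_scalars ℝ

theorem contDiffOn_norm_sq_comp (hU : IsOpen U) (hψ : DifferentiableOn ℂ ψ U) :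
    ContDiffOn ℝ ∞ (fun y => ‖ψ y‖ ^ 2) U :=
  (contDiffOn_real_of_differentiableOn hU hψ).norm_sq ℝ

/-- The Levi form of `‖ψ‖²` is the induced Hermitian form because `ψ` is holomorphic; the chain rule
supplies the rank-one term with `G'`. -/
theorem pull_radialMetric {F G G' : ℝ → ℝ} {S : Set ℝ} (hU : IsOpen U)
    (hψ : DifferentiableOn ℂ ψ U) (hS : ∀ y ∈ U, ‖ψ y‖ ^ 2 ∈ S)
    (hF : ∀ τ ∈ S, HasDerivWithinAt F (G τ) S τ) (hG : ∀ τ ∈ S, HasDerivWithinAt G (G' τ) S τ)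
    (hx : x ∈ U) (v w : CC m) :
    pull (radialMetric N G G') ψ x v w = levi (fun y => F (‖ψ y‖ ^ 2)) x v w := by
  have hd := hψ.differentiableAt (hU.mem_nhds hx)
  have h := levi_comp hU hx (contDiffOn_norm_sq_comp hU hψ) hS hF hG v w
  rw [show (fun y => F (‖ψ y‖ ^ 2)) = F ∘ fun y => ‖ψ y‖ ^ 2 from rfl, h,
    levi_norm_sq_comp hU hψ hx, fderiv_norm_sq_comp hd, fderiv_norm_sq_comp hd,
    fderiv_norm_sq_comp hd, fderiv_norm_sq_comp hd, pull, radialMetric_apply]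
  simp only [map_smul, inner_smul_right]
  simp
  ring

end RadialMetric

/-! ### The determinant of the metric relative to the holomorphic volume form. -/

section Determinant

variable {m : ℕ}

/-- The square matrix with first column `y` and remaining columns those of `P`. -/
def adjoinCol (y : Fin (m + 1) → ℂ) (P : Matrix (Fin (m + 1)) (Fin m) ℂ) :
    Matrix (Fin (m + 1)) (Fin (m + 1)) ℂ :=
  Matrix.of fun i j => (Fin.cons (y i) (P i) : Fin (m + 1) → ℂ) j

theorem det_of_first_column {A : Matrix (Fin (m + 1)) (Fin (m + 1)) ℂ}
    (h : ∀ k : Fin m, A k.succ 0 = 0) :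
    A.det = A 0 0 * (A.submatrix Fin.succ Fin.succ).det := by
  rw [Matrix.det_succ_column_zero, Fin.sum_univ_succ, Finset.sum_eq_zero fun k _ => by simp [h k]]
  simp

theorem det_of_first_row {A : Matrix (Fin (m + 1)) (Fin (m + 1)) ℂ}
    (h : ∀ k : Fin m, A 0 k.succ = 0) :
    A.det = A 0 0 * (A.submatrix Fin.succ Fin.succ).det := by
  rw [Matrix.det_succ_row_zero, Fin.sum_univ_succ, Finset.sum_eq_zero fun k _ => by simp [h k]]
  simp

/-- The columns of `P` span the complement of `z` for the complex bilinear form, so only the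
component `(z·y) z` of `y` matters. Concretely, the transpose of `(z|P)` times `(y|P)` has first row
`(z·y, 0, …, 0)`. -/
theorem det_adjoinCol_mul {z y : Fin (m + 1) → ℂ} {P : Matrix (Fin (m + 1)) (Fin m) ℂ}
    (hz : ∑ i, z i * z i = 1) (hP : ∀ k, ∑ i, z i * P i k = 0)
    (h0 : (adjoinCol z P).det ≠ 0) :
    (adjoinCol y P).det = (∑ i, z i * y i) * (adjoinCol z P).det := by
  have key : ∀ y : Fin (m + 1) → ℂ, (adjoinCol z P).det * (adjoinCol y P).det
      = (∑ i, z i * y i) * (P.transpose * P).det := by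
    intro y
    have h1 := det_of_first_row (A := (adjoinCol z P).transpose * adjoinCol y P) fun k => by
      simpa [Matrix.mul_apply, adjoinCol] using hP k
    rw [Matrix.det_mul, Matrix.det_transpose] at h1
    rw [h1]
    congr 1
  have h1 := key y
  have h2 := key z
  rw [hz, one_mul] at h2
  rw [← h2] at h1
  refine mul_left_cancel₀ h0 ?_
  rw [h1]; ring

/-- The Gram matrix of the columns of `P` for the Hermitian form `α⟨V, W⟩ + β ⟨V, z⟩⟨z, W⟩`. -/
noncomputable def radialGram (z : Fin (m + 1) → ℂ) (P : Matrix (Fin (m + 1)) (Fin m) ℂ)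
    (α β : ℝ) : Matrix (Fin m) (Fin m) ℂ :=
  P.conjTranspose * ((α : ℂ) • (1 : Matrix (Fin (m + 1)) (Fin (m + 1)) ℂ)
    + (β : ℂ) • Matrix.vecMulVec z (star z)) * P

/-- The matrix determinant lemma. The extra factor `α` avoids the exponent `card ι - 1`. -/
theorem det_smul_one_add_vecMulVec {ι : Type*} [Fintype ι] [DecidableEq ι] (z w : ι → ℂ) {α : ℂ}
    (hα : α ≠ 0) (β : ℂ) :
    α * (α • (1 : Matrix ι ι ℂ) + β • Matrix.vecMulVec z w).det
      = α ^ Fintype.card ι * (α + β * ∑ i, w i * z i) := by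
  have e : α • (1 : Matrix ι ι ℂ) + β • Matrix.vecMulVec z w
      = α • (1 + Matrix.replicateCol Unit ((β / α) • z) * Matrix.replicateRow Unit w) := by
    ext i j
    simp [Matrix.vecMulVec_apply, Matrix.mul_apply]
    field_simp
  rw [e, Matrix.det_smul, Matrix.det_one_add_replicateCol_mul_replicateRow]
  simp only [dotProduct, Pi.smul_apply, smul_eq_mul]
  have : ∑ i, w i * (β / α * z i) = β / α * ∑ i, w i * z i := by
    rw [Finset.mul_sum]; exact Finset.sum_congr rfl fun i _ => by ring
  rw [this]
  field_simp

/-- With `h = α + β z z*` and a suitable `y`, the matrix `(z|P)* h (y|P)` is block triangular with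
the Gram matrix `P* h P` as a block. Computing its determinant also as a product and dividing by the
known factors leaves the Gram determinant. -/
theorem det_radialGram_aux {z : Fin (m + 2) → ℂ} {P : Matrix (Fin (m + 2)) (Fin (m + 1)) ℂ}
    (hz : ∑ i, z i * z i = 1) (hP : ∀ k, ∑ i, z i * P i k = 0)
    (h0 : (adjoinCol z P).det ≠ 0) {τ : ℝ} (hτ : ∑ i, star (z i) * z i = (τ : ℂ)) {α β : ℝ}
    (hα : α ≠ 0) (hβ : α + β * τ ≠ 0) :
    (radialGram z P α β).det
      = star (adjoinCol z P).det * (adjoinCol z P).det * α ^ m * ((α + β * τ) * τ - β) := by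
  set h : Matrix (Fin (m + 2)) (Fin (m + 2)) ℂ :=
    (α : ℂ) • (1 : Matrix (Fin (m + 2)) (Fin (m + 2)) ℂ) + (β : ℂ) • Matrix.vecMulVec z (star z)
    with hh
  have hα' : (α : ℂ) ≠ 0 := by exact_mod_cast hα
  have hβ' : (α + β * τ : ℂ) ≠ 0 := by exact_mod_cast hβ
  -- This is, up to scale, `h⁻¹` of the conjugate of `z`: `h y = α(α+βτ) z̄`, and `z̄` is Hermitian
  -- orthogonal to the columns of `P`.
  let y : Fin (m + 2) → ℂ := fun i => (α + β * τ) * star (z i) - β * z i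
  have hzy : ∑ i, z i * y i = (α + β * τ) * τ - β := by
    have : ∀ i, z i * y i = (α + β * τ) * (star (z i) * z i) - β * (z i * z i) := fun i => by
      simp only [y]; ring
    rw [Finset.sum_congr rfl fun i _ => this i, Finset.sum_sub_distrib, ← Finset.mul_sum,
      ← Finset.mul_sum, hz, hτ]
    ring
  have hzb : ∑ i, star (z i) * star (z i) = 1 := by
    rw [← map_one (starRingEnd ℂ), ← hz, map_sum]
    simp
  have hhy : h.mulVec y = fun i => α * (α + β * τ) * star (z i) := by
    have hzs : star z ⬝ᵥ y = α := by
      simp only [dotProduct, y, Pi.star_apply]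
      have : ∀ i, star (z i) * ((α + β * τ) * star (z i) - β * z i)
          = (α + β * τ) * (star (z i) * star (z i)) - β * (star (z i) * z i) := fun i => by ring
      rw [Finset.sum_congr rfl fun i _ => this i, Finset.sum_sub_distrib, ← Finset.mul_sum,
        ← Finset.mul_sum, hzb, hτ]
      ring
    ext i
    rw [hh, Matrix.add_mulVec, Matrix.smul_mulVec, Matrix.smul_mulVec, Matrix.one_mulVec,
      Matrix.vecMulVec_mulVec, hzs]
    simp [y]
    ring
  have hcol : ∀ j, (h * adjoinCol y P) j 0 = α * (α + β * τ) * star (z j) := fun j => by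
    have := congrFun hhy j
    simpa [Matrix.mulVec, dotProduct, Matrix.mul_apply, adjoinCol] using this
  have hA := det_of_first_column
    (A := (adjoinCol z P).conjTranspose * (h * adjoinCol y P)) fun k => by
      rw [Matrix.mul_apply]
      simp only [hcol]
      have : star (∑ i, z i * P i k) = 0 := by rw [hP k]; simp
      rw [star_sum] at this
      simp only [Matrix.conjTranspose_apply, adjoinCol, Matrix.of_apply, Fin.cons_succ]
      rw [← mul_zero ((α : ℂ) * (α + β * τ)), ← this, Finset.mul_sum]
      exact Finset.sum_congr rfl fun i _ => by rw [star_mul]; ring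
  have h00 : ((adjoinCol z P).conjTranspose * (h * adjoinCol y P)) 0 0 = α * (α + β * τ) := by
    rw [Matrix.mul_apply]
    simp only [hcol]
    simp only [Matrix.conjTranspose_apply, adjoinCol, Matrix.of_apply, Fin.cons_zero]
    conv_rhs => rw [← mul_one ((α : ℂ) * (α + β * τ)), ← hzb, Finset.mul_sum]
    exact Finset.sum_congr rfl fun i _ => by ring
  have hsub : ((adjoinCol z P).conjTranspose * (h * adjoinCol y P)).submatrix Fin.succ Fin.succ
      = radialGram z P α β := by
    rw [radialGram, Matrix.mul_assoc]
    ext i j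
    simp [Matrix.mul_apply, adjoinCol, hh]
  rw [h00, hsub, Matrix.det_mul, Matrix.det_mul, Matrix.det_conjTranspose,
    det_adjoinCol_mul (y := y) hz hP h0, hzy] at hA
  have hdet := det_smul_one_add_vecMulVec z (star z) hα' (β : ℂ)
  rw [← hh] at hdet
  simp only [Pi.star_apply, hτ, Fintype.card_fin] at hdet
  refine mul_left_cancel₀ (mul_ne_zero (mul_ne_zero hα' hα') hβ') ?_
  calc (α * α * (α + β * τ) : ℂ) * (radialGram z P α β).det
      = α * (α * (α + β * τ) * (radialGram z P α β).det) := by ring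
    _ = star (adjoinCol z P).det * (α * h.det) *
        (((α + β * τ) * τ - β) * (adjoinCol z P).det) := by rw [← hA]; ring
    _ = _ := by rw [hdet]; ring

/-- Both sides are continuous in `β`, and the excluded condition `α + βτ = 0` concerns a single
value of `β`. -/
theorem det_radialGram {z : Fin (m + 2) → ℂ} {P : Matrix (Fin (m + 2)) (Fin (m + 1)) ℂ}
    (hz : ∑ i, z i * z i = 1) (hP : ∀ k, ∑ i, z i * P i k = 0)
    (h0 : (adjoinCol z P).det ≠ 0) {τ : ℝ} (hτ : ∑ i, star (z i) * z i = (τ : ℂ)) {α β : ℝ}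
    (hα : α ≠ 0) :
    (radialGram z P α β).det
      = star (adjoinCol z P).det * (adjoinCol z P).det * α ^ m * ((α + β * τ) * τ - β) := by
  have hd : Dense ({b : ℝ | b = -α / τ}ᶜ) := by
    have : {b : ℝ | b = -α / τ}.Countable := Set.countable_singleton _
    exact this.dense_compl ℝ
  have hc : Continuous fun b : ℝ => (radialGram z P α b).det := by
    unfold radialGram
    fun_prop
  have hc' : Continuous fun b : ℝ =>
      star (adjoinCol z P).det * (adjoinCol z P).det * α ^ m * ((α + b * τ) * τ - b : ℂ) := by
    fun_prop
  refine congrFun (hc.ext_on hd hc' fun b hb => ?_) β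
  refine det_radialGram_aux hz hP h0 hτ hα fun hb' => hb ?_
  have hτ0 : τ ≠ 0 := by rintro rfl; simp at hb'; exact hα hb'
  rw [Set.mem_ofPred_eq]
  field_simp
  linarith

end Determinant

/-! ### The range of `‖z‖²` on a tube. -/

section Shell

/-- The values of `‖z‖²` on the tube of radius `R`. -/
def shell (R : EReal) : Set ℝ := {τ | 1 ≤ τ ∧ ((Real.arcosh τ / 2 : ℝ) : EReal) < R}

theorem shell_top : shell ⊤ = Set.Ici 1 := by
  ext τ; simp [shell]

theorem shell_coe {R : ℝ} (hR : 0 < R) : shell R = Set.Ico 1 (Real.cosh (2 * R)) := by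
  ext τ
  simp only [shell, Set.mem_Ico]
  refine and_congr_right fun h => ?_
  rw [EReal.coe_lt_coe_iff, div_lt_iff₀ two_pos, mul_comm R]
  conv_rhs => rw [← Real.cosh_arcosh h, Real.cosh_lt_cosh, abs_of_nonneg (Real.arcosh_nonneg h),
    abs_of_pos (by positivity : 0 < 2 * R)]

theorem shell_cases {R : EReal} (hR : 0 < R) :
    shell R = Set.Ici 1 ∨ ∃ T : ℝ, 1 < T ∧ shell R = Set.Ico 1 T := by
  induction R with
  | bot => simp at hR
  | top => exact Or.inl shell_top
  | coe R =>
    have hR' : 0 < R := by exact_mod_cast hR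
    exact Or.inr ⟨_, by rw [Real.one_lt_cosh]; positivity, shell_coe hR'⟩

theorem one_mem_shell {R : EReal} (hR : 0 < R) : (1 : ℝ) ∈ shell R := by
  simpa [shell] using hR

theorem uniqueDiffOn_shell {R : EReal} (hR : 0 < R) : UniqueDiffOn ℝ (shell R) := by
  rcases shell_cases hR with h | ⟨T, -, h⟩
  · rw [h]; exact uniqueDiffOn_Ici 1
  · rw [h]; exact uniqueDiffOn_Ico 1 T

theorem ordConnected_shell {R : EReal} (hR : 0 < R) : (shell R).OrdConnected := by
  rcases shell_cases hR with h | ⟨T, -, h⟩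
  · rw [h]; exact Set.ordConnected_Ici
  · rw [h]; exact Set.ordConnected_Ico

theorem shell_mem_nhds {R : EReal} (hR : 0 < R) {τ : ℝ} (hτ : τ ∈ shell R) (h1 : 1 < τ) :
    shell R ∈ 𝓝 τ := by
  rcases shell_cases hR with h | ⟨T, -, h⟩
  · rw [h]; exact Ici_mem_nhds h1
  · rw [h] at hτ ⊢; exact Ico_mem_nhds h1 hτ.2

theorem mem_tube_iff {n : ℕ} {R : EReal} {z : CC (n + 2)} :
    z ∈ tube n R ↔ z ∈ quadric n ∧ ‖z‖ ^ 2 ∈ shell R := by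
  have aux : ∀ p ∈ tangentSphere n, (((‖p.2‖ : ℝ) : EReal) < R ↔
      ‖toQuadric n p‖ ^ 2 ∈ shell R) := by
    intro p hp
    simp only [shell, norm_sq_toQuadric hp]
    have := radius_toQuadric hp
    rw [radius, norm_sq_toQuadric hp] at this
    rw [Set.mem_ofPred_eq, this]
    exact ⟨fun h => ⟨Real.one_le_cosh _, h⟩, fun h => h.2⟩
  constructor
  · rintro ⟨p, ⟨hp, hR⟩, rfl⟩
    exact ⟨tube_top n ▸ ⟨p, ⟨hp, EReal.coe_lt_top _⟩, rfl⟩, (aux p hp).1 hR⟩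
  · rintro ⟨hz, hR⟩
    obtain ⟨p, ⟨hp, -⟩, rfl⟩ := (tube_top n).symm ▸ hz
    exact ⟨p, ⟨hp, (aux p hp).2 hR⟩, rfl⟩

end Shell

/-! ### Estimates on tangent vectors of the quadric. -/

section TangentVectors

/-- The tangent space of the quadric at `z`. -/
def quadricTangent {N : ℕ} (z : CC N) : Set (CC N) := {V | ∑ i, z i * V i = 0}

/-- Cauchy–Schwarz for `τz - z̄` in place of `z`: a tangent vector satisfies `⟨z̄, V⟩ = 0`, and `‖τz
- z̄‖² = τ(τ²-1)`. The gain over the plain inequality is the factor `τ²-1`, which vanishes on the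
zero section. -/
theorem norm_inner_sq_mul_le {n : ℕ} {z V : CC (n + 2)} (hz : z ∈ quadric n)
    (hV : V ∈ quadricTangent z) :
    ‖z‖ ^ 2 * ‖inner ℂ z V‖ ^ 2 ≤ ((‖z‖ ^ 2) ^ 2 - 1) * ‖V‖ ^ 2 := by
  have hz' : ∑ i, z i ^ 2 = 1 := hz
  have hV' : ∑ i, z i * V i = 0 := hV
  have hz0 : 0 < ‖z‖ := by
    rw [norm_pos_iff]; rintro rfl; simp at hz'
  set τ := ‖z‖ ^ 2 with hτ
  have hτ0 : 0 < τ := by positivity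
  set zb : CC (n + 2) := WithLp.toLp 2 fun i => star (z i) with hzb
  have hbz : inner ℂ zb z = (1 : ℂ) := by
    rw [PiLp.inner_apply, ← hz']
    exact Finset.sum_congr rfl fun i _ => by simp [hzb, sq]
  have hzbz : inner ℂ z zb = (1 : ℂ) := by rw [← inner_conj_symm, hbz]; simp
  have hbV : inner ℂ zb V = (0 : ℂ) := by
    rw [PiLp.inner_apply, ← hV']
    exact Finset.sum_congr rfl fun i _ => by simp [hzb, mul_comm]
  have hbn : ‖zb‖ ^ 2 = τ := by
    rw [hτ, EuclideanSpace.norm_sq_eq, EuclideanSpace.norm_sq_eq]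
    exact Finset.sum_congr rfl fun i _ => by simp [hzb]
  have h1 : inner ℂ ((τ : ℂ) • z - zb) V = τ * inner ℂ z V := by
    rw [inner_sub_left, inner_smul_left, hbV]; simp
  have h2 : ‖(τ : ℂ) • z - zb‖ ^ 2 = τ ^ 3 - τ := by
    rw [@norm_sub_sq ℂ, norm_smul, inner_smul_left, hzbz, mul_pow, ← hτ, hbn]
    simp
    ring
  have h3 := norm_inner_le_norm (𝕜 := ℂ) ((τ : ℂ) • z - zb) V
  have h4 := pow_le_pow_left₀ (norm_nonneg _) h3 2
  rw [h1, mul_pow, h2, norm_mul, mul_pow] at h4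
  simp only [Complex.norm_real, Real.norm_eq_abs, sq_abs] at h4
  refine le_of_mul_le_mul_left ?_ hτ0
  linarith

theorem one_le_norm_sq_of_mem_quadric {n : ℕ} {z : CC (n + 2)} (hz : z ∈ quadric n) :
    1 ≤ ‖z‖ ^ 2 := (mem_tube_iff.1 (tube_top n ▸ hz : z ∈ tube n ⊤)).2.1

theorem radialMetric_self {N : ℕ} (G G' : ℝ → ℝ) (z V : CC N) :
    radialMetric N G G' z V V
      = 2 * G (‖z‖ ^ 2) * ‖V‖ ^ 2 + 2 * G' (‖z‖ ^ 2) * ‖inner ℂ z V‖ ^ 2 := by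
  rw [radialMetric_apply, ← inner_self_eq_norm_sq (𝕜 := ℂ) V, ← Complex.normSq_eq_norm_sq,
    Complex.normSq_apply]
  rfl

theorem radialMetric_lower_bound {n : ℕ} {G G' : ℝ → ℝ} {z V : CC (n + 2)} (hz : z ∈ quadric n)
    (hV : V ∈ quadricTangent z) (hG : 0 < G (‖z‖ ^ 2)) :
    2 * (‖z‖ ^ 2 * G (‖z‖ ^ 2) + ((‖z‖ ^ 2) ^ 2 - 1) * G' (‖z‖ ^ 2)) * ‖inner ℂ z V‖ ^ 2
      ≤ ((‖z‖ ^ 2) ^ 2 - 1) * radialMetric (n + 2) G G' z V V := by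
  have h := norm_inner_sq_mul_le hz hV
  rw [radialMetric_self]
  nlinarith [mul_le_mul_of_nonneg_left h hG.le]

/-- Only negative `G'` is in question. Then the sharp bound on `⟨z, V⟩` reduces positivity to that
of `τG + (τ²-1)G'`. -/
theorem radialMetric_pos {n : ℕ} {G G' : ℝ → ℝ} {z V : CC (n + 2)} (hz : z ∈ quadric n)
    (hV : V ∈ quadricTangent z) (hV0 : V ≠ 0) (hG : 0 < G (‖z‖ ^ 2))
    (hc : 0 < ‖z‖ ^ 2 * G (‖z‖ ^ 2) + ((‖z‖ ^ 2) ^ 2 - 1) * G' (‖z‖ ^ 2)) :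
    0 < radialMetric (n + 2) G G' z V V := by
  have h := norm_inner_sq_mul_le hz hV
  have hn : 0 < ‖V‖ ^ 2 := by have := norm_pos_iff.2 hV0; positivity
  have hτ := one_le_norm_sq_of_mem_quadric hz
  rw [radialMetric_self]
  rcases le_or_gt 0 (G' (‖z‖ ^ 2)) with h0 | h0
  · positivity
  · have h1 := mul_le_mul_of_nonneg_left h (neg_nonneg.2 h0.le)
    have h2 := mul_pos hc hn
    refine pos_of_mul_pos_right (a := ‖z‖ ^ 2) ?_ (by positivity)
    nlinarith

variable {n : ℕ} {M : Set (CC (n + 2))} {m : ℕ} {U : Set (CC m)} {ψ : CC m → CC (n + 2)}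

theorem fderiv_mem_quadricTangent (hU : IsOpen U) (hψ : DifferentiableOn ℂ ψ U)
    (hM : ∀ y ∈ U, ψ y ∈ quadric n) {x : CC m} (hx : x ∈ U) (v : CC m) :
    fderiv ℂ ψ x v ∈ quadricTangent (ψ x) := by
  have hd := (hψ.differentiableAt (hU.mem_nhds hx)).hasFDerivAt
  have hc : ∀ i, HasFDerivAt (fun y => ψ y i)
      ((EuclideanSpace.proj i : CC (n + 2) →L[ℂ] ℂ).comp (fderiv ℂ ψ x)) x := fun i =>
    ((EuclideanSpace.proj i : CC (n + 2) →L[ℂ] ℂ).hasFDerivAt).comp x hd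
  have h1 := HasFDerivAt.fun_sum (u := Finset.univ) fun i _ => (hc i).pow 2
  have h2 : (fun y => ∑ i, ψ y i ^ 2) =ᶠ[𝓝 x] fun _ => 1 := by
    filter_upwards [hU.mem_nhds hx] with y hy using hM y hy
  have h3 := h1.unique ((hasFDerivAt_const (1 : ℂ) x).congr_of_eventuallyEq h2)
  have h4 := congrArg (fun L => L v) h3
  simp only [sum_apply, smul_apply, ContinuousLinearMap.comp_apply, smul_eq_mul] at h4
  change ∑ i, ψ x i * fderiv ℂ ψ x v i = 0
  have h5 : (2 : ℂ) * ∑ i, ψ x i * fderiv ℂ ψ x v i = 0 := by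
    refine Eq.trans ?_ h4
    rw [Finset.mul_sum]
    exact Finset.sum_congr rfl fun i _ => by simp; ring
  simpa using h5

end TangentVectors

/-! ### From the equation of a profile to a Kähler–Einstein metric. -/

section EinsteinProfile

/-- The data of a Kähler potential `F (‖z‖²)` on the tube of radius `R` in the quadric, with
`F' = G`, whose metric is Kähler-Einstein. -/
structure IsEinsteinProfile (n : ℕ) (Λ : ℝ) (R : EReal) (F G G' : ℝ → ℝ) (C : ℝ) : Prop where
  R_pos : 0 < R
  derivF : ∀ τ ∈ shell R, HasDerivWithinAt F (G τ) (shell R) τ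
  derivG : ∀ τ ∈ shell R, HasDerivWithinAt G (G' τ) (shell R) τ
  smooth : ContDiffOn ℝ ∞ F (shell R)
  pos : ∀ τ ∈ shell R, 0 < G τ
  C_pos : 0 < C
  ode : ∀ τ ∈ shell R,
    G τ ^ n * (τ * G τ + (τ ^ 2 - 1) * G' τ) = C * Real.exp (-Λ * F τ)

variable {n : ℕ} {Λ : ℝ} {R : EReal} {F G G' : ℝ → ℝ} {C : ℝ}

namespace IsEinsteinProfile

theorem potential_pos (h : IsEinsteinProfile n Λ R F G G' C) {τ : ℝ} (hτ : τ ∈ shell R) :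
    0 < τ * G τ + (τ ^ 2 - 1) * G' τ := by
  have h1 := h.ode τ hτ
  have h2 : 0 < G τ ^ n * (τ * G τ + (τ ^ 2 - 1) * G' τ) := by
    rw [h1]; exact mul_pos h.C_pos (Real.exp_pos _)
  exact pos_of_mul_pos_right h2 (pow_nonneg (h.pos τ hτ).le n)

end IsEinsteinProfile

variable {U : Set (CC (n + 1))} {ψ : CC (n + 1) → CC (n + 2)}

theorem StenzelTube.IsHolChart.mem_quadric (hψ : IsHolChart (n + 1) (tube n R) U ψ) {y : CC (n + 1)}
    (hy : y ∈ U) : ψ y ∈ quadric n := (mem_tube_iff.1 (hψ.mapsTo hy)).1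

theorem StenzelTube.IsHolChart.mem_shell (hψ : IsHolChart (n + 1) (tube n R) U ψ) {y : CC (n + 1)}
    (hy : y ∈ U) : ‖ψ y‖ ^ 2 ∈ shell R := (mem_tube_iff.1 (hψ.mapsTo hy)).2

theorem IsEinsteinProfile.pull_eq (h : IsEinsteinProfile n Λ R F G G' C)
    (hψ : IsHolChart (n + 1) (tube n R) U ψ) {x : CC (n + 1)} (hx : x ∈ U) (v w : CC (n + 1)) :
    pull (radialMetric (n + 2) G G') ψ x v w = levi (fun y => F (‖ψ y‖ ^ 2)) x v w :=
  pull_radialMetric hψ.isOpen hψ.holomorphic (fun _ hy => hψ.mem_shell hy) h.derivF h.derivG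
    hx v w

theorem IsEinsteinProfile.contDiffOn_potential (h : IsEinsteinProfile n Λ R F G G' C)
    (hψ : IsHolChart (n + 1) (tube n R) U ψ) :
    ContDiffOn ℝ ∞ (fun y => F (‖ψ y‖ ^ 2)) U :=
  h.smooth.comp (contDiffOn_norm_sq_comp hψ.isOpen hψ.holomorphic) fun _ hy => hψ.mem_shell hy

theorem contDiffOn_levi {m : ℕ} {U : Set (CC m)} {f : CC m → ℝ} (hU : IsOpen U)
    (hf : ContDiffOn ℝ ∞ f U) (v w : CC m) : ContDiffOn ℝ ∞ (fun x => levi f x v w) U := by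
  unfold levi
  have h := fun a b => (hf.fderiv_apply_of_isOpen hU a).fderiv_apply_of_isOpen hU b
  exact ((h _ _).add (h _ _)).div_const 2

/-- The Jacobian determinant of a chart of the quadric with respect to the holomorphic volume form
`(V₁, …, Vₙ₊₁) ↦ det (z, V₁, …, Vₙ₊₁)`. -/
noncomputable def chartDet (ψ : CC (n + 1) → CC (n + 2)) (x : CC (n + 1)) : ℂ :=
  (adjoinCol (ψ x).ofLp
    (Matrix.of fun i k => fderiv ℂ ψ x (EuclideanSpace.single k 1) i)).det

theorem differentiableOn_chartDet (hU : IsOpen U) (hψ : DifferentiableOn ℂ ψ U) :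
    DifferentiableOn ℂ (chartDet ψ) U := by
  have hc : ∀ {f : CC (n + 1) → CC (n + 2)}, DifferentiableOn ℂ f U → ∀ i,
      DifferentiableOn ℂ (fun y => f y i) U := fun {f} hf i =>
    (EuclideanSpace.proj i : CC (n + 2) →L[ℂ] ℂ).differentiable.comp_differentiableOn hf
  unfold chartDet
  simp only [Matrix.det_apply]
  refine DifferentiableOn.fun_sum fun σ _ => DifferentiableOn.const_smul ?_ _
  intro x hx
  refine (HasFDerivWithinAt.finsetProd (𝕜 := ℂ) fun j _ =>
    DifferentiableWithinAt.hasFDerivWithinAt ((?_ : DifferentiableOn ℂ _ U) x hx)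
      ).differentiableWithinAt
  refine Fin.cases ?_ (fun k => ?_) j
  · simpa [adjoinCol] using hc hψ _
  · simpa [adjoinCol] using hc (hψ.fderiv_apply_of_isOpen hU _) _

theorem fderiv_eq_sum_single {m N : ℕ} (L : CC m →L[ℂ] CC N) (v : CC m) (i : Fin N) :
    L v i = ∑ k, v k * L (EuclideanSpace.single k 1) i := by
  have : v = ∑ k, v k • EuclideanSpace.single k (1 : ℂ) := by
    ext j; simp [Finset.sum_apply, Pi.single_apply]
  conv_lhs => rw [this]
  simp [map_sum]

/-- A kernel vector is a relation `c₀ z + dψ(v) = 0`. The bilinear product with `z` kills the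
tangent vector and gives `c₀ = 0`; injectivity of `dψ` then gives `v = 0`. -/
theorem chartDet_ne_zero (hψ : IsHolChart (n + 1) (tube n R) U ψ) {x : CC (n + 1)} (hx : x ∈ U) :
    chartDet ψ x ≠ 0 := by
  intro h0
  obtain ⟨c, hc, hc0⟩ := Matrix.exists_mulVec_eq_zero_iff.2 h0
  have hq : ∑ i, ψ x i ^ 2 = 1 := hψ.mem_quadric hx
  set v : CC (n + 1) := WithLp.toLp 2 fun k => c k.succ with hv
  have hrow : ∀ i, c 0 * ψ x i + fderiv ℂ ψ x v i = 0 := by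
    intro i
    have := congrFun hc0 i
    rw [Matrix.mulVec, dotProduct, Fin.sum_univ_succ] at this
    rw [fderiv_eq_sum_single]
    simp only [adjoinCol, Matrix.of_apply, Fin.cons_zero, Fin.cons_succ, Pi.zero_apply] at this
    rw [← this, mul_comm]
    congr 1
    exact Finset.sum_congr rfl fun k _ => by rw [mul_comm]
  have htan : ∑ i, ψ x i * fderiv ℂ ψ x v i = 0 :=
    fderiv_mem_quadricTangent hψ.isOpen hψ.holomorphic (fun y hy => hψ.mem_quadric hy) hx v
  have hc00 : c 0 = 0 := by
    have h1 : ∑ i, ψ x i * (c 0 * ψ x i + fderiv ℂ ψ x v i) = 0 :=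
      Finset.sum_eq_zero fun i _ => by rw [hrow i, mul_zero]
    have h2 : ∀ i, ψ x i * (c 0 * ψ x i + fderiv ℂ ψ x v i)
        = c 0 * ψ x i ^ 2 + ψ x i * fderiv ℂ ψ x v i := fun i => by ring
    rw [Finset.sum_congr rfl fun i _ => h2 i, Finset.sum_add_distrib, ← Finset.mul_sum, hq,
      htan] at h1
    simpa using h1
  have hv0 : v = 0 := by
    refine (injective_iff_map_eq_zero (fderiv ℂ ψ x)).1 (hψ.immersion x hx) v ?_
    ext i
    simpa [hc00] using hrow i
  refine hc (funext fun j => Fin.cases hc00 (fun k => ?_) j)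
  have := congrArg (fun w : CC (n + 1) => w k) hv0
  simpa [hv] using this

theorem radialGram_apply {m : ℕ} (z : Fin (m + 1) → ℂ) (P : Matrix (Fin (m + 1)) (Fin m) ℂ)
    (α β : ℝ) (k j : Fin m) : radialGram z P α β k j
      = α * ∑ i, star (P i k) * P i j
        + β * ((∑ i, star (P i k) * z i) * ∑ i, star (z i) * P i j) := by
  have e : radialGram z P α β = (α : ℂ) • (P.conjTranspose * P)
      + (β : ℂ) • Matrix.vecMulVec (P.conjTranspose.mulVec z) (Matrix.vecMul (star z) P) := by
    rw [radialGram, Matrix.mul_add, Matrix.add_mul, Matrix.mul_smul, Matrix.mul_one,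
      Matrix.smul_mul, Matrix.mul_smul, Matrix.smul_mul, Matrix.mul_vecMulVec,
      Matrix.vecMulVec_mul]
  rw [e]
  simp [Matrix.mul_apply, Matrix.vecMulVec_apply, Matrix.mulVec, Matrix.vecMul, dotProduct]

/-- The transpose is due to conventions: `hermMatrix` is conjugate linear in the column index,
`radialGram` in the row index. -/
theorem hermMatrix_radialMetric (G G' : ℝ → ℝ) (ψ : CC (n + 1) → CC (n + 2)) (x : CC (n + 1)) :
    hermMatrix (radialMetric (n + 2) G G') ψ x = (radialGram (ψ x).ofLp
      (Matrix.of fun i k => fderiv ℂ ψ x (EuclideanSpace.single k 1) i)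
      (2 * G (‖ψ x‖ ^ 2)) (2 * G' (‖ψ x‖ ^ 2))).transpose := by
  ext j k
  rw [Matrix.transpose_apply, radialGram_apply]
  simp only [hermMatrix, pull, radialMetric_apply, map_smul, inner_smul_right, Matrix.of_apply]
  have e : ∀ V W : CC (n + 2), ∑ i, star (V i) * W i = inner ℂ V W := fun V W => by
    rw [PiLp.inner_apply]
    exact Finset.sum_congr rfl fun i _ => by simp [mul_comm]
  rw [e, e, e]
  set V := fderiv ℂ ψ x (EuclideanSpace.single j 1)
  set W := fderiv ℂ ψ x (EuclideanSpace.single k 1)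
  have e1 : inner ℂ W V = star (inner ℂ V W) := (inner_conj_symm W V).symm
  have e2 : inner ℂ W (ψ x) = star (inner ℂ (ψ x) W) := (inner_conj_symm W (ψ x)).symm
  rw [e1, e2]
  generalize inner ℂ V W = p
  generalize inner ℂ (ψ x) W = q
  apply Complex.ext <;> simp <;> exact Or.inl (by ring)

theorem det_hermMatrix_radialMetric (h : IsEinsteinProfile n Λ R F G G' C)
    (hψ : IsHolChart (n + 1) (tube n R) U ψ) {x : CC (n + 1)} (hx : x ∈ U) :
    (hermMatrix (radialMetric (n + 2) G G') ψ x).det.re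
      = ‖chartDet ψ x‖ ^ 2 * (2 ^ (n + 1) * (C * Real.exp (-Λ * F (‖ψ x‖ ^ 2)))) := by
  have hq : ∑ i, ψ x i ^ 2 = 1 := hψ.mem_quadric hx
  have hG := h.pos _ (hψ.mem_shell hx)
  have key := det_radialGram (m := n) (z := (ψ x).ofLp)
    (P := Matrix.of fun i k => fderiv ℂ ψ x (EuclideanSpace.single k 1) i)
    (by simpa [sq] using hq)
    (fun k => fderiv_mem_quadricTangent hψ.isOpen hψ.holomorphic
      (fun y hy => hψ.mem_quadric hy) hx (EuclideanSpace.single k 1))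
    (chartDet_ne_zero hψ hx) (τ := ‖ψ x‖ ^ 2)
    (by
      rw [EuclideanSpace.norm_sq_eq, Complex.ofReal_sum]
      exact Finset.sum_congr rfl fun i _ => by simp [Complex.conj_mul'])
    (α := 2 * G (‖ψ x‖ ^ 2)) (β := 2 * G' (‖ψ x‖ ^ 2)) (by positivity)
  rw [hermMatrix_radialMetric, Matrix.det_transpose, key, ← h.ode _ (hψ.mem_shell hx)]
  change (star (chartDet ψ x) * chartDet ψ x * _ * _).re = _
  set δ := chartDet ψ x
  set τ := ‖ψ x‖ ^ 2
  have h1 : star δ * δ = ((‖δ‖ ^ 2 : ℝ) : ℂ) := by simp [Complex.conj_mul']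
  rw [h1]
  norm_cast
  rw [mul_pow]
  push_cast
  ring

/-- The metric given by an Einstein profile is Kähler-Einstein. -/
theorem IsEinsteinProfile.isKahlerEinstein (h : IsEinsteinProfile n Λ R F G G' C) :
    IsKahlerEinstein (n + 1) (tube n R) Λ (radialMetric (n + 2) G G') := by
  have hev : ∀ {U ψ}, IsHolChart (n + 1) (tube n R) U ψ → ∀ {x}, x ∈ U → ∀ v w,
      (fun y => pull (radialMetric (n + 2) G G') ψ y v w) =ᶠ[𝓝 x]
        fun y => levi (fun y => F (‖ψ y‖ ^ 2)) y v w := by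
    intro U ψ hψ x hx v w
    filter_upwards [hψ.isOpen.mem_nhds hx] with y hy using h.pull_eq hψ hy v w
  refine ⟨⟨⟨?_, ?_, ?_⟩, ?_, ?_⟩, ?_⟩
  · intro U ψ hψ v w
    exact (contDiffOn_levi hψ.isOpen (h.contDiffOn_potential hψ) v w).congr fun x hx =>
      h.pull_eq hψ hx v w
  · intro U ψ hψ x hx v w
    have e1 : (inner ℂ (fderiv ℂ ψ x v) (fderiv ℂ ψ x w)).re
        = (inner ℂ (fderiv ℂ ψ x w) (fderiv ℂ ψ x v)).re := by
      rw [← inner_conj_symm]; rfl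
    rw [pull, pull, radialMetric_apply, radialMetric_apply, e1]
    ring
  · intro U ψ hψ x hx v hv
    refine radialMetric_pos (hψ.mem_quadric hx)
      (fderiv_mem_quadricTangent hψ.isOpen hψ.holomorphic (fun y hy => hψ.mem_quadric hy) hx v)
      (fun h0 => hv ?_) (h.pos _ (hψ.mem_shell hx)) (h.potential_pos (hψ.mem_shell hx))
    exact (injective_iff_map_eq_zero (fderiv ℂ ψ x)).1 (hψ.immersion x hx) v h0
  · intro U ψ hψ x hx v w
    simp only [pull, map_smul, radialMetric_I_smul]
  · intro U ψ hψ x hx v₁ v₂ v₃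
    rw [(hev hψ hx _ _).fderiv_eq, (hev hψ hx _ _).fderiv_eq, (hev hψ hx _ _).fderiv_eq]
    exact levi_closed hψ.isOpen hx (h.contDiffOn_potential hψ) v₁ v₂ v₃
  · intro U ψ hψ x hx v w
    have hδ := differentiableOn_chartDet hψ.isOpen hψ.holomorphic
    -- In `-log det` the Jacobian factor is pluriharmonic and the constants drop out, so only the
    -- Levi form of `ΛF` survives, which is `Λ` times the metric.
    have e : (fun y => -Real.log (hermMatrix (radialMetric (n + 2) G G') ψ y).det.re) =ᶠ[𝓝 x]
        fun y => (-1) * Real.log (‖chartDet ψ y‖ ^ 2)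
          + (Λ * F (‖ψ y‖ ^ 2) + -Real.log (2 ^ (n + 1) * C)) := by
      filter_upwards [hψ.isOpen.mem_nhds hx] with y hy
      have h1 : ‖chartDet ψ y‖ ^ 2 ≠ 0 :=
        pow_ne_zero 2 (norm_ne_zero_iff.2 (chartDet_ne_zero hψ hy))
      have h2 := h.C_pos
      rw [det_hermMatrix_radialMetric h hψ hy, Real.log_mul h1 (by positivity), ← mul_assoc,
        Real.log_mul (by positivity) (by positivity), Real.log_exp]
      ring
    have s1 : ContDiffOn ℝ ∞ (fun y => Real.log (‖chartDet ψ y‖ ^ 2)) U :=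
      ((contDiffOn_real_of_differentiableOn hψ.isOpen hδ).norm_sq ℝ).log fun y hy =>
        pow_ne_zero 2 (norm_ne_zero_iff.2 (chartDet_ne_zero hψ hy))
    have s2 := h.contDiffOn_potential hψ
    have s3 : ContDiffOn ℝ ∞ (fun y => Λ * F (‖ψ y‖ ^ 2)) U := contDiffOn_const.mul s2
    have s4 : ContDiffOn ℝ ∞ (fun _ : CC (n + 1) => -Real.log (2 ^ (n + 1) * C)) U :=
      contDiffOn_const
    rw [kahlerRicci, levi_congr e, levi_add hψ.isOpen hx (contDiffOn_const.mul s1) (s3.add s4),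
      levi_const_mul hψ.isOpen hx s1, levi_add hψ.isOpen hx s3 s4, levi_const,
      levi_const_mul hψ.isOpen hx s2,
      levi_log_normSq hψ.isOpen hδ (fun y hy => chartDet_ne_zero hψ hy) hx, h.pull_eq hψ hx]
    ring

end EinsteinProfile

/-! ### Charts of the quadric as graphs over coordinate hyperplanes. -/

section QuadricChart

variable {n : ℕ}

/-- Forgetting the `j`-th coordinate. -/
noncomputable def dropCoord (j : Fin (n + 2)) : CC (n + 2) →L[ℂ] CC (n + 1) :=
  LinearMap.toContinuousLinearMap
    { toFun := fun q => WithLp.toLp 2 fun k => q (j.succAbove k)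
      map_add' := fun _ _ => rfl
      map_smul' := fun _ _ => rfl }

@[simp] theorem dropCoord_apply (j : Fin (n + 2)) (q : CC (n + 2)) (k : Fin (n + 1)) :
    dropCoord j q k = q (j.succAbove k) := rfl

/-- The holomorphic function which gives the `j`-th coordinate of a point of the quadric near `z`
in terms of the other coordinates, divided by `z j`. -/
noncomputable def lastCoord (a : ℂ) (w : CC (n + 1)) : ℂ :=
  ((1 - ∑ k, w k ^ 2) / a ^ 2) ^ ((2 : ℕ) : ℂ)⁻¹

/-- The inverse of the chart of the quadric which forgets the `j`-th coordinate. -/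
noncomputable def graphChart (j : Fin (n + 2)) (a : ℂ) (w : CC (n + 1)) : CC (n + 2) :=
  WithLp.toLp 2 (j.insertNth (a * lastCoord a w) w.ofLp : Fin (n + 2) → ℂ)

theorem dropCoord_graphChart (j : Fin (n + 2)) (a : ℂ) (w : CC (n + 1)) :
    dropCoord j (graphChart j a w) = w := by
  ext k; simp [graphChart]

/-- The domain of `graphChart`. -/
def graphDomain (n : ℕ) (a : ℂ) : Set (CC (n + 1)) :=
  {w | (1 - ∑ k, w k ^ 2) / a ^ 2 ∈ Complex.slitPlane}

theorem isOpen_graphDomain (a : ℂ) : IsOpen (graphDomain n a) :=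
  Complex.isOpen_slitPlane.preimage (by fun_prop)

theorem graphChart_mem_quadric (j : Fin (n + 2)) {a : ℂ} (ha : a ≠ 0) (w : CC (n + 1)) :
    graphChart j a w ∈ quadric n := by
  change ∑ i, graphChart j a w i ^ 2 = 1
  rw [Fin.sum_univ_succAbove _ j]
  simp only [graphChart, Fin.insertNth_apply_same, Fin.insertNth_apply_succAbove]
  rw [mul_pow, lastCoord, Complex.cpow_nat_inv_pow _ two_ne_zero]
  field_simp
  ring

theorem differentiableOn_graphChart (j : Fin (n + 2)) (a : ℂ) :
    DifferentiableOn ℂ (graphChart j a) (graphDomain n a) := by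
  have h1 : DifferentiableOn ℂ (fun w : CC (n + 1) => a * lastCoord a w) (graphDomain n a) := by
    have h0 : Differentiable ℂ fun w : CC (n + 1) => (1 - ∑ k, w k ^ 2) / a ^ 2 := by fun_prop
    refine DifferentiableOn.const_mul (fun w hw => ?_) a
    have hw' : (1 - ∑ k, w k ^ 2) / a ^ 2 ∈ Complex.slitPlane := hw
    unfold lastCoord
    exact ((h0 w).differentiableWithinAt (s := graphDomain n a)).cpow_const hw'
  rw [differentiableOn_euclidean]
  intro i
  rcases Fin.eq_self_or_eq_succAbove j i with rfl | ⟨k, rfl⟩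
  · simpa [graphChart] using h1
  · simp only [graphChart, Fin.insertNth_apply_succAbove]
    fun_prop

theorem isHolChart_graphChart (j : Fin (n + 2)) {a : ℂ} (ha : a ≠ 0) :
    IsHolChart (n + 1) (quadric n) (graphDomain n a) (graphChart j a) where
  isOpen := isOpen_graphDomain a
  holomorphic := differentiableOn_graphChart j a
  mapsTo := fun w _ => graphChart_mem_quadric j ha w
  injOn := fun w _ w' _ h => by
    rw [← dropCoord_graphChart j a w, h, dropCoord_graphChart]
  immersion := fun w hw v v' h => by
    have hd := ((differentiableOn_graphChart j a).differentiableAt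
      ((isOpen_graphDomain a).mem_nhds hw)).hasFDerivAt
    have h1 := (dropCoord j).hasFDerivAt.comp w hd
    have h2 : (dropCoord j) ∘ graphChart j a = id := funext fun w => dropCoord_graphChart j a w
    rw [h2] at h1
    have h3 := h1.unique (hasFDerivAt_id w)
    have h4 : ∀ u, dropCoord j (fderiv ℂ (graphChart j a) w u) = u := fun u =>
      congrArg (fun L => L u) h3
    rw [← h4 v, h, h4]

/-- For `q` near `z` the quotient `q j / z j` is near `1`, hence in the right half-plane, where the
principal square root inverts squaring. -/
theorem eventually_graphChart_eq {z : CC (n + 2)} {j : Fin (n + 2)} (hj : z j ≠ 0) :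
    ∀ᶠ q in 𝓝 z, q ∈ quadric n →
      dropCoord j q ∈ graphDomain n (z j) ∧ graphChart j (z j) (dropCoord j q) = q := by
  have hc : Tendsto (fun q : CC (n + 2) => q j / z j) (𝓝 z) (𝓝 1) := by
    have : Continuous fun q : CC (n + 2) => q j / z j := by fun_prop
    simpa [hj] using this.tendsto z
  have h1 : ∀ᶠ q : CC (n + 2) in 𝓝 z, 0 < (q j / z j).re :=
    hc.eventually (Complex.continuous_re.continuousAt.eventually (lt_mem_nhds (by simp)))
  have h2 : ∀ᶠ q : CC (n + 2) in 𝓝 z, (q j / z j) ^ 2 ∈ Complex.slitPlane :=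
    (hc.pow 2).eventually (Complex.isOpen_slitPlane.mem_nhds (by simp))
  filter_upwards [h1, h2] with q hq1 hq2 hq
  have e : (1 - ∑ k, dropCoord j q k ^ 2) / z j ^ 2 = (q j / z j) ^ 2 := by
    have : ∑ i, q i ^ 2 = 1 := hq
    rw [Fin.sum_univ_succAbove _ j] at this
    rw [div_pow, ← this]
    simp
  refine ⟨by rw [graphDomain, Set.mem_ofPred_eq, e]; exact hq2, ?_⟩
  have h3 : lastCoord (z j) (dropCoord j q) = q j / z j := by
    have harg := Complex.abs_arg_lt_pi_div_two_iff.2 (Or.inl hq1)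
    rw [abs_lt] at harg
    rw [lastCoord, e]
    exact Complex.pow_cpow_nat_inv two_ne_zero (by exact_mod_cast (by linarith [harg.1]))
      (by exact_mod_cast harg.2.le)
  ext i
  rcases Fin.eq_self_or_eq_succAbove j i with rfl | ⟨k, rfl⟩
  · simp [graphChart, h3, mul_div_cancel₀ _ hj]
  · simp [graphChart]

theorem exists_coord_ne_zero {z : CC (n + 2)} (hz : z ∈ quadric n) : ∃ j, z j ≠ 0 := by
  by_contra! h
  have : ∑ i, z i ^ 2 = 1 := hz
  simp [h] at this

/-- Every tangent vector of the quadric is the image of a vector under the differential of a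
chart. -/
theorem exists_chart_fderiv_eq {z : CC (n + 2)} (hz : z ∈ quadric n) :
    ∃ (U : Set (CC (n + 1))) (ψ : CC (n + 1) → CC (n + 2)) (x : CC (n + 1)),
      IsHolChart (n + 1) (quadric n) U ψ ∧ x ∈ U ∧ ψ x = z ∧
        ∀ V ∈ quadricTangent z, ∃ v, fderiv ℂ ψ x v = V := by
  obtain ⟨j, hj⟩ := exists_coord_ne_zero hz
  obtain ⟨hU, hψ⟩ := (eventually_graphChart_eq hj).self_of_nhds hz
  have hch := isHolChart_graphChart j hj (n := n)
  refine ⟨_, graphChart j (z j), dropCoord j z, hch, hU, hψ, fun V hV => ⟨dropCoord j V, ?_⟩⟩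
  have hd := (hch.holomorphic.differentiableAt (hch.isOpen.mem_nhds hU)).hasFDerivAt
  have h1 := (dropCoord j).hasFDerivAt.comp _ hd
  have h2 : (dropCoord j) ∘ graphChart j (z j) = id :=
    funext fun w => dropCoord_graphChart j (z j) w
  rw [h2] at h1
  have h4 : dropCoord j (fderiv ℂ (graphChart j (z j)) (dropCoord j z) (dropCoord j V))
      = dropCoord j V := congrArg (fun L => L (dropCoord j V)) (h1.unique (hasFDerivAt_id _))
  set W := fderiv ℂ (graphChart j (z j)) (dropCoord j z) (dropCoord j V) with hW
  have hk : ∀ k, W (j.succAbove k) = V (j.succAbove k) := fun k =>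
    congrArg (fun w : CC (n + 1) => w k) h4
  have hT : ∑ i, z i * W i = 0 := by
    have := fderiv_mem_quadricTangent hch.isOpen hch.holomorphic
      (fun y _ => graphChart_mem_quadric j hj y) hU (dropCoord j V)
    rwa [hψ] at this
  have hV' : ∑ i, z i * V i = 0 := hV
  rw [Fin.sum_univ_succAbove _ j] at hT hV'
  simp only [hk] at hT
  -- The other coordinates of `W` and `V` agree, and tangency determines the `j`-th one because `z j
  -- ≠ 0`.
  have hjj : W j = V j := mul_left_cancel₀ hj (by rw [eq_neg_of_add_eq_zero_left hT,
    eq_neg_of_add_eq_zero_left hV'])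
  ext i
  rcases Fin.eq_self_or_eq_succAbove j i with rfl | ⟨k, rfl⟩
  · exact hjj
  · exact hk k

end QuadricChart

/-! ### Independence of the values on vectors not tangent to the quadric. -/

section Transfer

variable {n : ℕ}

/-- The metrics `g` and `g'` agree on the tangent vectors of `M`. -/
def EqOnTangent (M : Set (CC (n + 2))) (g g' : BilinField (n + 2)) : Prop :=
  ∀ z ∈ M, ∀ V ∈ quadricTangent z, ∀ W ∈ quadricTangent z, g z V W = g' z V W

theorem EqOnTangent.of_pull_eq {g g' : BilinField (n + 2)}
    (h : ∀ U ψ, IsHolChart (n + 1) (quadric n) U ψ → ∀ x ∈ U, ∀ v w,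
      pull g ψ x v w = pull g' ψ x v w) : EqOnTangent (quadric n) g g' := by
  intro z hz V hV W hW
  obtain ⟨U, ψ, x, hψ, hx, rfl, hsurj⟩ := exists_chart_fderiv_eq hz
  obtain ⟨v, rfl⟩ := hsurj V hV
  obtain ⟨w, rfl⟩ := hsurj W hW
  exact h U ψ hψ x hx v w

theorem IsKahlerEinstein.congr {N m : ℕ} {M : Set (CC N)} {Λ : ℝ} {g g' : BilinField N}
    (h : ∀ U ψ, IsHolChart m M U ψ → ∀ x ∈ U, ∀ v w, pull g' ψ x v w = pull g ψ x v w)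
    (hg : IsKahlerEinstein m M Λ g) : IsKahlerEinstein m M Λ g' := by
  obtain ⟨⟨⟨h1, h2, h3⟩, h4, h5⟩, h6⟩ := hg
  have hev : ∀ {U ψ}, IsHolChart m M U ψ → ∀ {x}, x ∈ U → ∀ v w,
      (fun y => pull g' ψ y v w) =ᶠ[𝓝 x] fun y => pull g ψ y v w := by
    intro U ψ hψ x hx v w
    filter_upwards [hψ.isOpen.mem_nhds hx] with y hy using h U ψ hψ y hy v w
  refine ⟨⟨⟨?_, ?_, ?_⟩, ?_, ?_⟩, ?_⟩
  · intro U ψ hψ v w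
    exact (h1 U ψ hψ v w).congr fun x hx => h U ψ hψ x hx v w
  · intro U ψ hψ x hx v w
    rw [h U ψ hψ x hx, h U ψ hψ x hx, h2 U ψ hψ x hx]
  · intro U ψ hψ x hx v hv
    rw [h U ψ hψ x hx]; exact h3 U ψ hψ x hx v hv
  · intro U ψ hψ x hx v w
    rw [h U ψ hψ x hx, h U ψ hψ x hx, h4 U ψ hψ x hx]
  · intro U ψ hψ x hx v₁ v₂ v₃
    rw [(hev hψ hx _ _).fderiv_eq, (hev hψ hx _ _).fderiv_eq, (hev hψ hx _ _).fderiv_eq]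
    exact h5 U ψ hψ x hx v₁ v₂ v₃
  · intro U ψ hψ x hx v w
    have e : (fun y => -Real.log (hermMatrix g' ψ y).det.re) =ᶠ[𝓝 x]
        fun y => -Real.log (hermMatrix g ψ y).det.re := by
      filter_upwards [hψ.isOpen.mem_nhds hx] with y hy
      have : hermMatrix g' ψ y = hermMatrix g ψ y := by
        ext j k; simp only [hermMatrix, h U ψ hψ y hy]
      rw [this]
    rw [kahlerRicci, levi_congr e, h U ψ hψ x hx]
    exact h6 U ψ hψ x hx v w

theorem derivWithin_mem_quadricTangent {γ : ℝ → CC (n + 2)}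
    (hγ : ContDiffOn ℝ 1 γ (Set.Icc 0 1)) (hq : ∀ t ∈ Set.Icc (0 : ℝ) 1, γ t ∈ quadric n)
    {t : ℝ} (ht : t ∈ Set.Icc (0 : ℝ) 1) :
    derivWithin γ (Set.Icc 0 1) t ∈ quadricTangent (γ t) := by
  have hu := uniqueDiffOn_Icc (zero_lt_one' ℝ) t ht
  have hd := (hγ.differentiableOn one_ne_zero t ht).hasDerivWithinAt
  have hc : ∀ i, HasDerivWithinAt (fun s => γ s i) (derivWithin γ (Set.Icc 0 1) t i)
      (Set.Icc 0 1) t := fun i =>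
    (((EuclideanSpace.proj i : CC (n + 2) →L[ℂ] ℂ).restrictScalars ℝ).hasFDerivAt).comp_hasDerivWithinAt t hd
  have h1 := HasDerivWithinAt.fun_sum (u := Finset.univ) fun i _ => (hc i).pow 2
  have h2 : HasDerivWithinAt (fun s => ∑ i, γ s i ^ 2) 0 (Set.Icc 0 1) t :=
    (hasDerivWithinAt_const t (Set.Icc 0 1) (1 : ℂ)).congr (fun s hs => hq s hs) (hq t ht)
  have h3 := hu.eq_deriv _ h1 h2
  have h4 : (2 : ℂ) * ∑ i, γ t i * derivWithin γ (Set.Icc 0 1) t i = 0 := by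
    refine Eq.trans ?_ h3
    rw [Finset.mul_sum]
    exact Finset.sum_congr rfl fun i _ => by simp; ring
  simpa [quadricTangent] using h4

/-- Path lengths evaluate the metric only on velocities, which are tangent to the quadric. -/
theorem IsCompleteMetric.congr {M : Set (CC (n + 2))} {g g' : BilinField (n + 2)}
    (hM : M ⊆ quadric n) (h : EqOnTangent M g' g) (hg : IsCompleteMetric M g) :
    IsCompleteMetric M g' := by
  have e : ∀ p q, riemDist M g' p q = riemDist M g p q := by
    intro p q
    unfold riemDist
    refine iInf_congr fun γ => iInf_congr fun hγ => ?_
    refine MeasureTheory.setLIntegral_congr_fun measurableSet_Icc fun t ht => ?_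
    have := derivWithin_mem_quadricTangent hγ.1 (fun s hs => hM (hγ.2.1 hs)) ht
    simp only [h _ (hγ.2.1 ht) _ this _ this]
  unfold IsCompleteMetric
  simp only [e]
  exact hg

end Transfer

/-! ### Triangle inequality and comparison estimates for the Riemannian distance. -/

section RiemannianDistance

variable {N : ℕ} {M : Set (CC N)} {g : BilinField N}

theorem riemDist_le_pathLength {γ : ℝ → CC N} (hγ : ContDiffOn ℝ 1 γ (Set.Icc 0 1))
    (hM : Set.MapsTo γ (Set.Icc 0 1) M) :
    riemDist M g (γ 0) (γ 1) ≤ pathLength g γ :=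
  iInf₂_le γ ⟨hγ, hM, rfl, rfl⟩

/-- Change of variables for a monotone parameter, which need not be injective. Only an inequality
results because the image of `s` may be a proper part of `[0,1]`. -/
theorem lintegral_reparam_le {γ : ℝ → CC N} {k k' : ℝ → ℝ}
    (hk : Monotone k) (hd : ∀ t, HasDerivAt k (k' t) t)
    (hm : ∀ t, k t ∈ Set.Icc (0 : ℝ) 1) {s : Set ℝ} (hs : MeasurableSet s) :
    ∫⁻ t in s, ENNReal.ofReal (Real.sqrt
      (g (γ (k t)) (k' t • derivWithin γ (Set.Icc 0 1) (k t))
        (k' t • derivWithin γ (Set.Icc 0 1) (k t)))) ≤ pathLength g γ := by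
  set u : ℝ → ℝ≥0∞ := fun t => ENNReal.ofReal (Real.sqrt
      (g (γ t) (derivWithin γ (Set.Icc 0 1) t) (derivWithin γ (Set.Icc 0 1) t))) with hu
  have hk0 : ∀ t, 0 ≤ k' t := fun t => by
    rw [← (hd t).deriv]; exact hk.deriv_nonneg
  have e : ∀ t, ENNReal.ofReal (Real.sqrt
      (g (γ (k t)) (k' t • derivWithin γ (Set.Icc 0 1) (k t))
        (k' t • derivWithin γ (Set.Icc 0 1) (k t)))) = ENNReal.ofReal (k' t) * u (k t) := by
    intro t
    rw [hu, ← ENNReal.ofReal_mul (hk0 t)]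
    congr 1
    simp only [map_smul, smul_apply, smul_eq_mul]
    rw [← mul_assoc, Real.sqrt_mul (mul_self_nonneg _), Real.sqrt_mul_self (hk0 t)]
  simp only [e]
  rw [← MeasureTheory.lintegral_image_eq_lintegral_deriv_mul_of_monotoneOn hs
    (fun t _ => (hd t).hasDerivWithinAt) (hk.monotoneOn s) u]
  refine MeasureTheory.lintegral_mono_set ?_
  rintro _ ⟨t, -, rfl⟩
  exact hm t

theorem hasDerivAt_reparam {γ : ℝ → CC N} {k k' : ℝ → ℝ} (hγ : ContDiffOn ℝ 1 γ (Set.Icc 0 1))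
    (hd : ∀ t, HasDerivAt k (k' t) t) (hm : ∀ t, k t ∈ Set.Icc (0 : ℝ) 1) (t : ℝ) :
    HasDerivAt (fun t => γ (k t)) (k' t • derivWithin γ (Set.Icc 0 1) (k t)) t := by
  have h1 := (hγ.differentiableOn one_ne_zero (k t) (hm t)).hasDerivWithinAt
  have h2 := HasDerivWithinAt.scomp (s := Set.univ) t h1 (hd t).hasDerivWithinAt
    fun t _ => hm t
  exact h2.hasDerivAt univ_mem

theorem contDiff_reparam {γ : ℝ → CC N} {k : ℝ → ℝ} (hγ : ContDiffOn ℝ 1 γ (Set.Icc 0 1))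
    (hk : ContDiff ℝ 1 k) (hm : ∀ t, k t ∈ Set.Icc (0 : ℝ) 1) :
    ContDiff ℝ 1 fun t => γ (k t) :=
  contDiffOn_univ.1 (hγ.comp hk.contDiffOn fun t _ => hm t)

/-- A plain concatenation may have a corner. Reparametrizing by smooth transitions makes both pieces
flat at the junction, so that `γ₁∘k₁ + γ₂∘k₂ - q` is `C¹`; on each half one of the two summands is
the constant `q`. -/
theorem riemDist_triangle (p q r : CC N) :
    riemDist M g p r ≤ riemDist M g p q + riemDist M g q r := by
  conv_rhs => unfold riemDist
  refine ENNReal.le_iInf₂_add_iInf₂ fun γ₁ h₁ γ₂ h₂ => ?_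
  obtain ⟨c₁, m₁, rfl, e₁⟩ := h₁
  obtain ⟨c₂, m₂, e₂, rfl⟩ := h₂
  let H := Real.smoothTransition
  have hH : ContDiff ℝ 1 H := Real.smoothTransition.contDiff (n := 1)
  have hHm : ∀ x, H x ∈ Set.Icc (0 : ℝ) 1 := fun x =>
    ⟨Real.smoothTransition.nonneg x, Real.smoothTransition.le_one x⟩
  have hHd : ∀ x, HasDerivAt H (deriv H x) x := fun x =>
    (hH.differentiable one_ne_zero x).hasDerivAt
  let k₁ : ℝ → ℝ := fun t => H (2 * t)
  let k₂ : ℝ → ℝ := fun t => H (2 * t - 1)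
  have d₁ : ∀ t, HasDerivAt k₁ (deriv H (2 * t) * 2) t := fun t =>
    (hHd (2 * t)).comp t (by simpa using (hasDerivAt_id t).const_mul 2)
  have d₂ : ∀ t, HasDerivAt k₂ (deriv H (2 * t - 1) * 2) t := fun t =>
    HasDerivAt.comp (h := fun t : ℝ => 2 * t - 1) (h₂ := H) t (hHd (2 * t - 1)) (by simpa using ((hasDerivAt_id t).const_mul 2).sub_const 1)
  have mono₁ : Monotone k₁ := fun a b h => Real.smoothTransition.monotone (by linarith)
  have mono₂ : Monotone k₂ := fun a b h => Real.smoothTransition.monotone (by linarith)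
  have one₁ : ∀ t, 1 / 2 ≤ t → γ₁ (k₁ t) = q := fun t ht => by
    rw [show k₁ t = 1 from Real.smoothTransition.one_of_one_le (by linarith), e₁]
  have zero₂ : ∀ t, t ≤ 1 / 2 → γ₂ (k₂ t) = q := fun t ht => by
    rw [show k₂ t = 0 from Real.smoothTransition.zero_of_nonpos (by linarith), e₂]
  let γ : ℝ → CC N := fun t => γ₁ (k₁ t) + γ₂ (k₂ t) - q
  have hl : ∀ t, t ≤ 1 / 2 → γ t = γ₁ (k₁ t) := fun t ht => by simp [γ, zero₂ t ht]
  have hr : ∀ t, 1 / 2 ≤ t → γ t = γ₂ (k₂ t) := fun t ht => by simp [γ, one₁ t ht]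
  have hγ : ContDiff ℝ 1 γ :=
    ((contDiff_reparam c₁ (hH.comp (by fun_prop)) fun t => hHm _).add
      (contDiff_reparam c₂ (hH.comp (by fun_prop)) fun t => hHm _)).sub contDiff_const
  have hmaps : Set.MapsTo γ (Set.Icc 0 1) M := fun t _ => by
    rcases le_total t (1 / 2) with h | h
    · rw [hl t h]; exact m₁ (hHm _)
    · rw [hr t h]; exact m₂ (hHm _)
  have hγ0 : γ 0 = γ₁ 0 := by
    rw [hl 0 (by norm_num)]; congr 1
    exact Real.smoothTransition.zero_of_nonpos (by simp)
  have hγ1 : γ 1 = γ₂ 1 := by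
    rw [hr 1 (by norm_num)]; congr 1
    exact Real.smoothTransition.one_of_one_le (by norm_num)
  have hdw : ∀ t ∈ Set.Icc (0 : ℝ) 1, derivWithin γ (Set.Icc 0 1) t = deriv γ t := fun t ht =>
    (hγ.differentiable one_ne_zero t).derivWithin (uniqueDiffOn_Icc (zero_lt_one' ℝ) t ht)
  have hdl : ∀ t ∈ Set.Ioo (0 : ℝ) (1 / 2), derivWithin γ (Set.Icc 0 1) t
      = (deriv H (2 * t) * 2) • derivWithin γ₁ (Set.Icc 0 1) (k₁ t) := fun t ht => by
    rw [hdw t ⟨ht.1.le, by linarith [ht.2]⟩]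
    refine ((hasDerivAt_reparam c₁ d₁ (fun t => hHm _) t).congr_of_eventuallyEq ?_).deriv
    filter_upwards [Iio_mem_nhds ht.2] with s hs using hl s (le_of_lt hs)
  have hdr : ∀ t ∈ Set.Ioo (1 / 2 : ℝ) 1, derivWithin γ (Set.Icc 0 1) t
      = (deriv H (2 * t - 1) * 2) • derivWithin γ₂ (Set.Icc 0 1) (k₂ t) := fun t ht => by
    rw [hdw t ⟨by linarith [ht.1], ht.2.le⟩]
    refine ((hasDerivAt_reparam c₂ d₂ (fun t => hHm _) t).congr_of_eventuallyEq ?_).deriv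
    filter_upwards [Ioi_mem_nhds ht.1] with s hs using hr s (le_of_lt hs)
  refine (hγ1 ▸ hγ0 ▸ riemDist_le_pathLength hγ.contDiffOn hmaps :
    riemDist M g (γ₁ 0) (γ₂ 1) ≤ pathLength g γ).trans ?_
  have hsplit : Set.Icc (0 : ℝ) 1 = Set.Icc 0 (1 / 2) ∪ Set.Icc (1 / 2) 1 :=
    (Set.Icc_union_Icc_eq_Icc (by norm_num) (by norm_num)).symm
  have hlen : pathLength g γ ≤
      (∫⁻ t in Set.Ioo (0 : ℝ) (1 / 2), ENNReal.ofReal (Real.sqrt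
        (g (γ t) (derivWithin γ (Set.Icc 0 1) t) (derivWithin γ (Set.Icc 0 1) t))))
      + ∫⁻ t in Set.Ioo (1 / 2 : ℝ) 1, ENNReal.ofReal (Real.sqrt
        (g (γ t) (derivWithin γ (Set.Icc 0 1) t) (derivWithin γ (Set.Icc 0 1) t))) := by
    unfold pathLength
    rw [MeasureTheory.restrict_Ioo_eq_restrict_Icc, MeasureTheory.restrict_Ioo_eq_restrict_Icc]
    refine le_trans (MeasureTheory.lintegral_mono_set hsplit.le) ?_
    exact MeasureTheory.lintegral_union_le _ _ _
  refine hlen.trans (add_le_add ?_ ?_)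
  · refine le_trans (le_of_eq ?_) (lintegral_reparam_le mono₁ d₁ (fun t => hHm _)
      (measurableSet_Ioo (a := (0 : ℝ)) (b := 1 / 2)))
    refine MeasureTheory.setLIntegral_congr_fun measurableSet_Ioo fun t ht => ?_
    simp only [hdl t ht, hl t ht.2.le]
  · refine le_trans (le_of_eq ?_) (lintegral_reparam_le mono₂ d₂ (fun t => hHm _)
      (measurableSet_Ioo (a := (1 / 2 : ℝ)) (b := 1)))
    refine MeasureTheory.setLIntegral_congr_fun measurableSet_Ioo fun t ht => ?_
    simp only [hdr t ht, hr t ht.1.le]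

/-- A function of `‖z‖²` whose gradient has norm at most one does not increase distances. -/
theorem abs_sub_le_riemDist {S : Set ℝ} {Θ θ : ℝ → ℝ}
    (hS : ∀ z ∈ M, ‖z‖ ^ 2 ∈ S) (hΘ : ∀ τ ∈ S, HasDerivWithinAt Θ (θ τ) S τ)
    (hθ : ContinuousOn θ S)
    (hg : ∀ γ : ℝ → CC N, ContDiffOn ℝ 1 γ (Set.Icc 0 1) → Set.MapsTo γ (Set.Icc 0 1) M →
      ∀ t ∈ Set.Icc (0 : ℝ) 1, (θ (‖γ t‖ ^ 2) *
        (2 * (inner ℂ (γ t) (derivWithin γ (Set.Icc 0 1) t)).re)) ^ 2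
          ≤ g (γ t) (derivWithin γ (Set.Icc 0 1) t) (derivWithin γ (Set.Icc 0 1) t))
    (p q : CC N) :
    ENNReal.ofReal |Θ (‖p‖ ^ 2) - Θ (‖q‖ ^ 2)| ≤ riemDist M g p q := by
  refine le_iInf₂ fun γ hγ => ?_
  obtain ⟨hc, hm, rfl, rfl⟩ := hγ
  have hS' : ∀ t ∈ Set.Icc (0 : ℝ) 1, ‖γ t‖ ^ 2 ∈ S := fun t ht => hS _ (hm ht)
  set D := derivWithin γ (Set.Icc 0 1) with hD
  let f : ℝ → ℝ := fun t => Θ (‖γ t‖ ^ 2)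
  let f' : ℝ → ℝ := fun t => θ (‖γ t‖ ^ 2) * (2 * (inner ℂ (γ t) (D t)).re)
  have hd : ∀ t ∈ Set.Icc (0 : ℝ) 1, HasDerivWithinAt f (f' t) (Set.Icc 0 1) t := by
    intro t ht
    have h1 := (hc.differentiableOn one_ne_zero t ht).hasDerivWithinAt.norm_sq
    rw [real_inner_eq_re] at h1
    exact (hΘ _ (hS' t ht)).comp t h1 hS'
  have hDc : ContinuousOn D (Set.Icc 0 1) :=
    hc.continuousOn_derivWithin (uniqueDiffOn_Icc (zero_lt_one' ℝ)) le_rfl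
  have hf'c : ContinuousOn f' (Set.Icc 0 1) := by
    have hγc := hc.continuousOn
    refine (hθ.comp (hγc.norm.pow 2) hS').mul (continuousOn_const.mul ?_)
    exact Complex.continuous_re.comp_continuousOn (ContinuousOn.inner (𝕜 := ℂ) hγc hDc)
  have hint : ∫ t in (0 : ℝ)..1, f' t = f 1 - f 0 := by
    refine intervalIntegral.integral_eq_sub_of_hasDeriv_right_of_le zero_le_one
      (fun t ht => (hd t ht).continuousWithinAt) (fun t ht => ?_)
      (hf'c.intervalIntegrable_of_Icc zero_le_one)
    exact ((hd t ⟨ht.1.le, ht.2.le⟩).hasDerivAt (Icc_mem_nhds ht.1 ht.2)).hasDerivWithinAt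
  have h1 : |f 0 - f 1| ≤ ∫ t in (0 : ℝ)..1, |f' t| := by
    rw [abs_sub_comm, ← hint]
    exact intervalIntegral.abs_integral_le_integral_abs zero_le_one
  refine (ENNReal.ofReal_le_ofReal h1).trans ?_
  rw [intervalIntegral.integral_of_le zero_le_one, ← MeasureTheory.integral_Icc_eq_integral_Ioc,
    MeasureTheory.ofReal_integral_eq_lintegral_ofReal (hf'c.abs.integrableOn_Icc)
      (Eventually.of_forall fun t => abs_nonneg _)]
  refine MeasureTheory.setLIntegral_mono' measurableSet_Icc fun t ht => ?_
  exact ENNReal.ofReal_le_ofReal (Real.abs_le_sqrt (hg γ hc hm t ht))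

/-- The competing path is the image of the straight segment from `x` to `y`. -/
theorem riemDist_le_of_chart {m : ℕ} {V : Set (CC m)} {ψ : CC m → CC N} (hV : IsOpen V)
    (hψ : DifferentiableOn ℂ ψ V) (hM : Set.MapsTo ψ V M) (hconv : Convex ℝ V) {K : ℝ}
    (hK : ∀ y ∈ V, ∀ v, g (ψ y) (fderiv ℂ ψ y v) (fderiv ℂ ψ y v) ≤ (K * ‖v‖) ^ 2)
    (hK0 : 0 ≤ K) {x y : CC m} (hx : x ∈ V) (hy : y ∈ V) :
    riemDist M g (ψ x) (ψ y) ≤ ENNReal.ofReal (K * ‖y - x‖) := by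
  let c : ℝ → CC m := fun t => x + t • (y - x)
  have hcV : ∀ t ∈ Set.Icc (0 : ℝ) 1, c t ∈ V := fun t ht =>
    hconv.add_smul_sub_mem hx hy ht
  let γ : ℝ → CC N := fun t => ψ (c t)
  have hγ : ContDiffOn ℝ 1 γ (Set.Icc 0 1) := by
    have h1 : ContDiffOn ℝ 1 ψ V :=
      (contDiffOn_infty.1 (contDiffOn_real_of_differentiableOn hV hψ) 1)
    have h2 : ContDiff ℝ 1 c := by fun_prop
    exact h1.comp h2.contDiffOn hcV
  have hd : ∀ t ∈ Set.Icc (0 : ℝ) 1,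
      derivWithin γ (Set.Icc 0 1) t = fderiv ℂ ψ (c t) (y - x) := fun t ht => by
    have h1 := hasFDerivAt_real (hψ.differentiableAt (hV.mem_nhds (hcV t ht)))
    have h2 : HasDerivAt c (y - x) t := by
      have h := ((hasDerivAt_id t).smul_const (y - x)).const_add x
      rw [one_smul] at h
      exact h
    exact (h1.comp_hasDerivAt t h2).hasDerivWithinAt.derivWithin
      (uniqueDiffOn_Icc (zero_lt_one' ℝ) t ht)
  have h0 : γ 0 = ψ x := by simp [γ, c]
  have h1 : γ 1 = ψ y := by simp [γ, c]
  rw [← h0, ← h1]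
  refine (riemDist_le_pathLength hγ fun t ht => hM (hcV t ht)).trans ?_
  calc pathLength g γ ≤ ∫⁻ _ in Set.Icc (0 : ℝ) 1, ENNReal.ofReal (K * ‖y - x‖) := by
        refine MeasureTheory.setLIntegral_mono' measurableSet_Icc fun t ht => ?_
        rw [hd t ht]
        refine ENNReal.ofReal_le_ofReal (Real.sqrt_le_iff.2 ⟨by positivity, ?_⟩)
        exact hK _ (hcV t ht) _
    _ = _ := by simp

end RiemannianDistance

/-! ### Completeness from an exhaustion function with bounded gradient. -/

section Completeness

variable {n : ℕ} {R : EReal}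

theorem eventually_mem_shell (hR : 0 < R) {τ₀ : ℝ} (h : τ₀ ∈ shell R) :
    ∀ᶠ τ in 𝓝 τ₀, 1 ≤ τ → τ ∈ shell R := by
  rcases shell_cases hR with e | ⟨T, -, e⟩
  · rw [e]; exact Eventually.of_forall fun τ h => h
  · rw [e] at h ⊢
    filter_upwards [Iio_mem_nhds h.2] with τ hτ h1 using ⟨h1, hτ⟩

/-- Euclidean convergence inside the tube implies convergence for `riemDist`: in a chart around `p`
the metric is bounded by a multiple of the Euclidean one. -/
theorem eventually_riemDist_lt {G G' : ℝ → ℝ} (hR : 0 < R) (hG : ContinuousOn G (shell R))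
    (hG' : ContinuousOn G' (shell R)) {p : CC (n + 2)} (hp : p ∈ tube n R) {ε : ℝ≥0∞}
    (hε : 0 < ε) :
    ∀ᶠ q in 𝓝 p, q ∈ tube n R →
      riemDist (tube n R) (radialMetric (n + 2) G G') q p < ε := by
  obtain ⟨hpq, hps⟩ := mem_tube_iff.1 hp
  obtain ⟨j, hj⟩ := exists_coord_ne_zero hpq
  set ψ := graphChart j (p j) with hψdef
  set x₀ := dropCoord j p with hx₀
  have hch := isHolChart_graphChart j hj (n := n)
  obtain ⟨hx₀U, hψx₀⟩ := (eventually_graphChart_eq hj).self_of_nhds hpq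
  set τ₀ := ‖p‖ ^ 2 with hτ₀
  have hUn := hch.isOpen.mem_nhds hx₀U
  have hψc : ContinuousAt ψ x₀ := (hch.holomorphic.differentiableAt hUn).continuousAt
  have hτc : Tendsto (fun y => ‖ψ y‖ ^ 2) (𝓝 x₀) (𝓝 τ₀) := by
    have h : Tendsto (fun y => ‖ψ y‖ ^ 2) (𝓝 x₀) (𝓝 (‖ψ x₀‖ ^ 2)) := hψc.norm.pow 2
    rwa [show ψ x₀ = p from hψx₀] at h
  have hsh : ∀ᶠ y in 𝓝 x₀, ‖ψ y‖ ^ 2 ∈ shell R := by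
    filter_upwards [hτc.eventually (eventually_mem_shell hR hps)] with y hy
    exact hy (one_le_norm_sq_of_mem_quadric (graphChart_mem_quadric j hj y))
  have hτc' : Tendsto (fun y => ‖ψ y‖ ^ 2) (𝓝 x₀) (𝓝[shell R] τ₀) :=
    tendsto_nhdsWithin_iff.2 ⟨hτc, hsh⟩
  have hGb : ∀ᶠ y in 𝓝 x₀, G (‖ψ y‖ ^ 2) < |G τ₀| + 1 :=
    ((hG τ₀ hps).tendsto.comp hτc').eventually
      (gt_mem_nhds (by linarith [le_abs_self (G τ₀)]))
  have hG'b : ∀ᶠ y in 𝓝 x₀, G' (‖ψ y‖ ^ 2) < |G' τ₀| + 1 :=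
    ((hG' τ₀ hps).tendsto.comp hτc').eventually
      (gt_mem_nhds (by linarith [le_abs_self (G' τ₀)]))
  have hτb : ∀ᶠ y in 𝓝 x₀, ‖ψ y‖ ^ 2 < τ₀ + 1 := hτc.eventually (gt_mem_nhds (by linarith))
  have hdb : ∀ᶠ y in 𝓝 x₀, ‖fderiv ℂ ψ y‖ < ‖fderiv ℂ ψ x₀‖ + 1 := by
    have h1 : ContDiffAt ℂ 1 ψ x₀ :=
      (contDiffOn_infty.1 (hch.holomorphic.contDiffOn_of_isOpen hch.isOpen) 1).contDiffAt hUn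
    have h2 : ContinuousAt (fderiv ℂ ψ) x₀ :=
      (h1.fderiv_right (m := 0) (by norm_num)).continuousAt
    exact h2.norm.eventually (gt_mem_nhds (by linarith))
  have hUe : ∀ᶠ y in 𝓝 x₀, y ∈ graphDomain n (p j) := hUn
  obtain ⟨r, hr, hball⟩ := Metric.eventually_nhds_iff_ball.1
    (hUe.and (hsh.and (hGb.and (hG'b.and (hτb.and hdb)))))
  -- An upper bound for `2G + 2G'‖z‖²`, hence for the metric relative to the ambient norm.
  set B : ℝ := 2 * (|G τ₀| + 1) + 2 * (|G' τ₀| + 1) * (τ₀ + 1) with hB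
  have hτ₀0 : 0 ≤ τ₀ := by positivity
  have hB0 : 0 ≤ B := by positivity
  set K := Real.sqrt B * (‖fderiv ℂ ψ x₀‖ + 1) with hK
  have hbound : ∀ y ∈ Metric.ball x₀ r, ∀ v, radialMetric (n + 2) G G' (ψ y) (fderiv ℂ ψ y v)
      (fderiv ℂ ψ y v) ≤ (K * ‖v‖) ^ 2 := by
    intro y hy v
    obtain ⟨-, -, h1, h2, h3, h4⟩ := hball y hy
    set W := fderiv ℂ ψ y v with hW
    have hWn : ‖W‖ ≤ (‖fderiv ℂ ψ x₀‖ + 1) * ‖v‖ :=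
      ((fderiv ℂ ψ y).le_opNorm v).trans (mul_le_mul_of_nonneg_right h4.le (norm_nonneg v))
    have hin : ‖inner ℂ (ψ y) W‖ ^ 2 ≤ (τ₀ + 1) * ‖W‖ ^ 2 := by
      calc ‖inner ℂ (ψ y) W‖ ^ 2 ≤ (‖ψ y‖ * ‖W‖) ^ 2 :=
            pow_le_pow_left₀ (norm_nonneg _) (norm_inner_le_norm _ _) 2
        _ = ‖ψ y‖ ^ 2 * ‖W‖ ^ 2 := mul_pow _ _ _
        _ ≤ _ := mul_le_mul_of_nonneg_right h3.le (by positivity)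
    rw [radialMetric_self]
    calc 2 * G (‖ψ y‖ ^ 2) * ‖W‖ ^ 2 + 2 * G' (‖ψ y‖ ^ 2) * ‖inner ℂ (ψ y) W‖ ^ 2
        ≤ 2 * (|G τ₀| + 1) * ‖W‖ ^ 2 + 2 * (|G' τ₀| + 1) * ‖inner ℂ (ψ y) W‖ ^ 2 := by gcongr
      _ ≤ 2 * (|G τ₀| + 1) * ‖W‖ ^ 2 + 2 * (|G' τ₀| + 1) * ((τ₀ + 1) * ‖W‖ ^ 2) := by gcongr
      _ = B * ‖W‖ ^ 2 := by rw [hB]; ring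
      _ ≤ B * ((‖fderiv ℂ ψ x₀‖ + 1) * ‖v‖) ^ 2 := by gcongr
      _ = (K * ‖v‖) ^ 2 := by rw [hK, mul_pow, mul_pow, mul_pow, Real.sq_sqrt hB0]; ring
  have hmaps : Set.MapsTo ψ (Metric.ball x₀ r) (tube n R) := fun y hy =>
    mem_tube_iff.2 ⟨graphChart_mem_quadric j hj y, (hball y hy).2.1⟩
  have hmain : ∀ y ∈ Metric.ball x₀ r,
      riemDist (tube n R) (radialMetric (n + 2) G G') (ψ y) (ψ x₀)
        ≤ ENNReal.ofReal (K * ‖x₀ - y‖) := fun y hy =>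
    riemDist_le_of_chart Metric.isOpen_ball
      (hch.holomorphic.mono fun y hy => (hball y hy).1) hmaps (convex_ball x₀ r) hbound
      (by positivity) hy (Metric.mem_ball_self hr)
  have hdc : Tendsto (fun q => dropCoord j q) (𝓝 p) (𝓝 x₀) := (dropCoord j).continuous.tendsto p
  have hsmall : Tendsto (fun q => ENNReal.ofReal (K * ‖x₀ - dropCoord j q‖)) (𝓝 p) (𝓝 0) := by
    have h1 : Tendsto (fun q => K * ‖x₀ - dropCoord j q‖) (𝓝 p) (𝓝 (K * ‖x₀ - x₀‖)) :=
      ((hdc.const_sub x₀).norm).const_mul K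
    simpa using ENNReal.tendsto_ofReal h1
  filter_upwards [eventually_graphChart_eq hj, hdc.eventually (Metric.ball_mem_nhds x₀ hr),
    hsmall.eventually (gt_mem_nhds hε)] with q h1 h2 h3 hq
  have h4 := hmain _ h2
  rw [show ψ (dropCoord j q) = q from (h1 (mem_tube_iff.1 hq).1).2,
    show ψ x₀ = p from hψx₀] at h4
  exact h4.trans_lt h3

/-- Along a Cauchy sequence `Θ` is eventually bounded, so the tail lies in a set `τ ≤ τ₁` that is
compact in the ambient space and contained in the tube. A Euclidean subsequential limit is a limit
for `riemDist` by `hconv`, and the Cauchy property extends this to the whole sequence. -/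
theorem isCompleteMetric_of_exhaustion {g : BilinField (n + 2)} {Θ : ℝ → ℝ}
    (hlow : ∀ p ∈ tube n R, ∀ q ∈ tube n R,
      ENNReal.ofReal |Θ (‖p‖ ^ 2) - Θ (‖q‖ ^ 2)| ≤ riemDist (tube n R) g p q)
    (hprop : ∀ B, ∃ τ₁ ∈ shell R, ∀ τ ∈ shell R, Θ τ ≤ B → τ ≤ τ₁)
    (hconv : ∀ p ∈ tube n R, ∀ ε : ℝ≥0∞, 0 < ε → ∀ᶠ q in 𝓝 p, q ∈ tube n R →
      riemDist (tube n R) g q p < ε)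
    (hord : (shell R).OrdConnected) (h1 : 1 ∈ shell R) :
    IsCompleteMetric (tube n R) g := by
  intro s hs hcau
  obtain ⟨k₀, hk₀⟩ := hcau 1 one_pos
  obtain ⟨τ₁, hτ₁, hτ₁b⟩ := hprop (Θ (‖s k₀‖ ^ 2) + 1)
  have hbd : ∀ k ≥ k₀, ‖s k‖ ^ 2 ≤ τ₁ := by
    intro k hk
    refine hτ₁b _ (mem_tube_iff.1 (hs k)).2 ?_
    have h2 := (hlow _ (hs k) _ (hs k₀)).trans_lt (hk₀ k hk k₀ le_rfl)
    rw [← ENNReal.ofReal_one, ENNReal.ofReal_lt_ofReal_iff one_pos] at h2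
    linarith [le_abs_self (Θ (‖s k‖ ^ 2) - Θ (‖s k₀‖ ^ 2))]
  have hcl : IsClosed (quadric n) := isClosed_eq (by fun_prop) continuous_const
  have hcomp : IsCompact (quadric n ∩ {z | ‖z‖ ^ 2 ≤ τ₁}) := by
    refine Metric.isCompact_of_isClosed_isBounded
      (hcl.inter (isClosed_le (by fun_prop) continuous_const)) ?_
    refine (Metric.isBounded_closedBall (x := (0 : CC (n + 2))) (r := Real.sqrt τ₁)).subset ?_
    rintro z ⟨-, hz⟩
    simpa using Real.le_sqrt_of_sq_le hz
  obtain ⟨p, ⟨hpq, hpτ⟩, φ, hφ, hlim⟩ := hcomp.tendsto_subseq (x := fun k => s (k + k₀))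
    fun k => ⟨(mem_tube_iff.1 (hs _)).1, hbd _ (by omega)⟩
  have hp : p ∈ tube n R := mem_tube_iff.2 ⟨hpq, hord.out h1 hτ₁
    ⟨one_le_norm_sq_of_mem_quadric hpq, hpτ⟩⟩
  refine ⟨p, hp, ENNReal.tendsto_nhds_zero.2 fun ε hε => ?_⟩
  have hε2 : 0 < ε / 2 := ENNReal.half_pos hε.ne'
  obtain ⟨k₁, hk₁⟩ := hcau (ε / 2) hε2
  obtain ⟨i, hi, hik⟩ := ((hlim.eventually (hconv p hp _ hε2)).and
    (hφ.tendsto_atTop.eventually_ge_atTop k₁)).exists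
  filter_upwards [eventually_ge_atTop k₁] with k hk
  calc riemDist (tube n R) g (s k) p
      ≤ riemDist (tube n R) g (s k) (s (φ i + k₀)) + riemDist (tube n R) g (s (φ i + k₀)) p :=
        riemDist_triangle _ _ _
    _ ≤ ε / 2 + ε / 2 := add_le_add (hk₁ k hk _ (by omega)).le (hi (hs _)).le
    _ = ε := ENNReal.add_halves ε

variable {Λ : ℝ} {F G G' : ℝ → ℝ} {C : ℝ}

theorem IsEinsteinProfile.continuousOn_G (h : IsEinsteinProfile n Λ R F G G' C) :
    ContinuousOn G (shell R) := fun τ hτ => (h.derivG τ hτ).continuousWithinAt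

theorem IsEinsteinProfile.contDiffOn_G (h : IsEinsteinProfile n Λ R F G G' C) :
    ContDiffOn ℝ ∞ G (shell R) := by
  have hu := uniqueDiffOn_shell h.R_pos
  exact (h.smooth.derivWithin (m := ∞) hu (by simp)).congr fun τ hτ =>
    ((h.derivF τ hτ).derivWithin (hu τ hτ)).symm

theorem IsEinsteinProfile.continuousOn_G' (h : IsEinsteinProfile n Λ R F G G' C) :
    ContinuousOn G' (shell R) := by
  have hu := uniqueDiffOn_shell h.R_pos
  exact (h.contDiffOn_G.derivWithin (m := ∞) hu (by simp)).continuousOn.congr fun τ hτ =>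
    ((h.derivG τ hτ).derivWithin (hu τ hτ)).symm

/-- The metric of an Einstein profile is complete if there is a proper function of `‖z‖²` with
bounded gradient. -/
theorem IsEinsteinProfile.isCompleteMetric (h : IsEinsteinProfile n Λ R F G G' C) {Θ θ : ℝ → ℝ}
    (hΘ : ∀ τ ∈ shell R, HasDerivWithinAt Θ (θ τ) (shell R) τ)
    (hθ : ContinuousOn θ (shell R))
    (hle : ∀ τ ∈ shell R,
      2 * (θ τ ^ 2 * (τ ^ 2 - 1)) ≤ τ * G τ + (τ ^ 2 - 1) * G' τ)
    (hprop : ∀ B, ∃ τ₁ ∈ shell R, ∀ τ ∈ shell R, Θ τ ≤ B → τ ≤ τ₁) :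
    IsCompleteMetric (tube n R) (radialMetric (n + 2) G G') := by
  refine isCompleteMetric_of_exhaustion (Θ := Θ) (fun p _ q _ => ?_) hprop
    (fun p hp ε hε => eventually_riemDist_lt h.R_pos h.continuousOn_G h.continuousOn_G' hp hε)
    (ordConnected_shell h.R_pos) (one_mem_shell h.R_pos)
  refine abs_sub_le_riemDist (fun z hz => (mem_tube_iff.1 hz).2) hΘ hθ ?_ p q
  intro γ hγ hm t ht
  obtain ⟨hq, hs⟩ := mem_tube_iff.1 (hm ht)
  have hV := derivWithin_mem_quadricTangent hγ (fun s hs => (mem_tube_iff.1 (hm hs)).1) ht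
  set z := γ t
  set V := derivWithin γ (Set.Icc 0 1) t
  set τ := ‖z‖ ^ 2
  have h1 := radialMetric_lower_bound (G' := G') hq hV (h.pos _ hs)
  have h2 := norm_inner_sq_mul_le hq hV
  have h3 := hle τ hs
  have hre : (inner ℂ z V).re ^ 2 ≤ ‖inner ℂ z V‖ ^ 2 := by
    rw [← sq_abs]
    exact pow_le_pow_left₀ (abs_nonneg _) (Complex.abs_re_le_norm _) 2
  have hτ1 : 1 ≤ τ := hs.1
  -- On the zero section one cannot divide by `τ² - 1`, but there the Cauchy–Schwarz bound makes
  -- `⟨z, V⟩` vanish.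
  rcases hτ1.eq_or_lt with h0 | h0
  · have h4 : (inner ℂ z V).re ^ 2 ≤ 0 := by
      refine hre.trans ?_
      rw [show ‖z‖ ^ 2 = 1 from h0.symm] at h2
      linarith
    have h5 : (inner ℂ z V).re = 0 := by
      simpa using le_antisymm h4 (sq_nonneg _)
    rw [h5]
    simp only [mul_zero]
    rcases eq_or_ne V 0 with hV0 | hV0
    · simp [hV0]
    · rw [zero_pow two_ne_zero]
      exact (radialMetric_pos hq hV hV0 (h.pos _ hs) (h.potential_pos hs)).le
  · have h6 : 0 < τ ^ 2 - 1 := by nlinarith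
    refine le_of_mul_le_mul_left ?_ h6
    calc (τ ^ 2 - 1) * (θ τ * (2 * (inner ℂ z V).re)) ^ 2
        = 2 * (2 * (θ τ ^ 2 * (τ ^ 2 - 1))) * (inner ℂ z V).re ^ 2 := by ring
      _ ≤ 2 * (τ * G τ + (τ ^ 2 - 1) * G' τ) * ‖inner ℂ z V‖ ^ 2 := by
          refine mul_le_mul (by linarith) hre (sq_nonneg _) ?_
          linarith [h.potential_pos hs]
      _ ≤ _ := h1

end Completeness

/-! ### The singular equation `(n+1)I + 2(τ-1)I' = q` at `τ = 1`. -/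

section ParametricIntegral

/-- The integral `∫₀¹ xʲ q (1 + (τ - 1) x²) dx`. -/
noncomputable def paramInt (j : ℕ) (q : ℝ → ℝ) (τ : ℝ) : ℝ :=
  ∫ x in (0 : ℝ)..1, x ^ j * q (1 + (τ - 1) * x ^ 2)

theorem continuous_paramInt {q : ℝ → ℝ} (hq : Continuous q) (j : ℕ) :
    Continuous (paramInt j q) := by
  unfold paramInt
  exact intervalIntegral.continuous_parametric_intervalIntegral_of_continuous'
    (by fun_prop) 0 1

/-- Each derivative in `τ` brings out a factor `x²`, so the family indexed by `j` is closed under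
differentiation, with no loss at `τ = 1`. -/
theorem hasDerivAt_paramInt {q q' : ℝ → ℝ} (hq : ∀ τ, HasDerivAt q (q' τ) τ) (hq' : Continuous q')
    (j : ℕ) (τ : ℝ) : HasDerivAt (paramInt j q) (paramInt (j + 2) q' τ) τ := by
  have hqc : Continuous q := continuous_iff_continuousAt.2 fun τ => (hq τ).continuousAt
  obtain ⟨B, hB⟩ := (isCompact_Icc (a := -(|τ| + 2) - 1) (b := |τ| + 3)).exists_bound_of_continuousOn
    hq'.continuousOn
  have key := intervalIntegral.hasDerivAt_integral_of_dominated_loc_of_deriv_le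
    (F := fun τ x => x ^ j * q (1 + (τ - 1) * x ^ 2))
    (F' := fun τ x => x ^ (j + 2) * q' (1 + (τ - 1) * x ^ 2))
    (x₀ := τ) (s := Metric.ball τ 1) (bound := fun _ => B) (a := 0) (b := 1)
    (μ := MeasureTheory.volume) (Metric.ball_mem_nhds τ one_pos)
    (Eventually.of_forall fun σ => (by fun_prop : Continuous fun x : ℝ =>
      x ^ j * q (1 + (σ - 1) * x ^ 2)).aestronglyMeasurable)
    ((by fun_prop : Continuous fun x : ℝ => x ^ j * q (1 + (τ - 1) * x ^ 2)).intervalIntegrable _ _)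
    (by fun_prop : Continuous fun x : ℝ =>
      x ^ (j + 2) * q' (1 + (τ - 1) * x ^ 2)).aestronglyMeasurable
    (Eventually.of_forall fun x hx σ hσ => by
      rw [Set.uIoc_of_le zero_le_one] at hx
      have h1 : |x ^ (j + 2)| ≤ 1 := by
        rw [abs_of_nonneg (pow_nonneg hx.1.le _)]; exact pow_le_one₀ hx.1.le hx.2
      have hx2 : 0 ≤ x ^ 2 ∧ x ^ 2 ≤ 1 := ⟨sq_nonneg x, pow_le_one₀ hx.1.le hx.2⟩
      rw [Metric.mem_ball, Real.dist_eq, abs_lt] at hσ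
      have hσ1 : |σ - 1| ≤ |τ| + 2 := by
        rw [abs_le]
        constructor <;> linarith [neg_abs_le τ, le_abs_self τ]
      have h3 : |(σ - 1) * x ^ 2| ≤ |τ| + 2 := by
        rw [abs_mul, abs_of_nonneg hx2.1]
        nlinarith [abs_nonneg (σ - 1), abs_nonneg τ]
      rw [abs_le] at h3
      have h2 := hB (1 + (σ - 1) * x ^ 2) ⟨by linarith, by linarith⟩
      rw [Real.norm_eq_abs] at h2
      rw [norm_mul, Real.norm_eq_abs, Real.norm_eq_abs]
      nlinarith [abs_nonneg (q' (1 + (σ - 1) * x ^ 2)), abs_nonneg (x ^ (j + 2))])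
    intervalIntegrable_const
    (Eventually.of_forall fun x _ σ _ => by
      have h1 : HasDerivAt (fun σ : ℝ => 1 + (σ - 1) * x ^ 2) (x ^ 2) σ := by
        simpa using (((hasDerivAt_id σ).sub_const 1).mul_const (x ^ 2)).const_add 1
      have h2 := ((hq (1 + (σ - 1) * x ^ 2)).comp σ h1).const_mul (x ^ j)
      have h3 : HasDerivAt (fun σ : ℝ => x ^ j * q (1 + (σ - 1) * x ^ 2))
        (x ^ j * (q' (1 + (σ - 1) * x ^ 2) * x ^ 2)) σ := h2
      exact h3.congr_deriv (by ring))
  exact key.2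

variable {R : EReal}

theorem exists_gt_mem_shell (hR : 0 < R) {τ : ℝ} (hτ : τ ∈ shell R) : ∃ τ₁ ∈ shell R, τ < τ₁ := by
  rcases shell_cases hR with e | ⟨T, -, e⟩
  · rw [e] at hτ ⊢
    exact ⟨τ + 1, le_trans hτ (by linarith : τ ≤ τ + 1), by linarith⟩
  · rw [e] at hτ ⊢
    exact ⟨(τ + T) / 2, ⟨by linarith [hτ.1, hτ.2], by linarith [hτ.2]⟩, by linarith [hτ.2]⟩

theorem one_add_mul_sq_mem_Icc {τ τ₁ x : ℝ} (hτ : τ ∈ Set.Icc 1 τ₁) (hx : x ∈ Set.uIcc (0 : ℝ) 1) :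
    1 + (τ - 1) * x ^ 2 ∈ Set.Icc 1 τ₁ := by
  rw [Set.uIcc_of_le zero_le_one] at hx
  have hx2 : 0 ≤ x ^ 2 ∧ x ^ 2 ≤ 1 := ⟨sq_nonneg x, pow_le_one₀ hx.1 hx.2⟩
  constructor <;> nlinarith [hτ.1, hτ.2]

theorem paramInt_congr {q q₁ : ℝ → ℝ} {τ₁ : ℝ} (h : Set.EqOn q q₁ (Set.Icc 1 τ₁)) (j : ℕ) :
    Set.EqOn (paramInt j q) (paramInt j q₁) (Set.Icc 1 τ₁) := fun τ hτ =>
  intervalIntegral.integral_congr fun x hx => by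
    simp only [h (one_add_mul_sq_mem_Icc hτ hx)]

theorem Icc_mem_nhdsWithin_shell {τ τ₁ : ℝ} (h : τ < τ₁) :
    Set.Icc 1 τ₁ ∈ 𝓝[shell R] τ := by
  refine mem_nhdsWithin_iff_eventually.2 ?_
  filter_upwards [Iio_mem_nhds h] with σ hσ hσ' using ⟨hσ'.1, le_of_lt hσ⟩

theorem Icc_subset_shell (hR : 0 < R) {τ₁ : ℝ} (h : τ₁ ∈ shell R) : Set.Icc 1 τ₁ ⊆ shell R :=
  (ordConnected_shell hR).out (one_mem_shell hR) h

theorem exists_continuous_extension {q : ℝ → ℝ} {τ₁ : ℝ} (h1 : 1 ≤ τ₁)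
    (hq : ContinuousOn q (Set.Icc 1 τ₁)) : ∃ q₁ : ℝ → ℝ, Continuous q₁ ∧
      Set.EqOn q q₁ (Set.Icc 1 τ₁) :=
  ⟨Set.IccExtend h1 ((Set.Icc 1 τ₁).domRestrict q), hq.domRestrict.Icc_extend', fun τ hτ => by
    rw [Set.IccExtend_of_mem h1 _ hτ]; rfl⟩

/-- For `τ ≤ τ₁` the integral sees `q` only on `[1, τ₁]`, so `q` may be replaced by a continuous
extension to `ℝ`. -/
theorem continuousOn_paramInt (hR : 0 < R) {q : ℝ → ℝ} (hq : ContinuousOn q (shell R)) (j : ℕ) :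
    ContinuousOn (paramInt j q) (shell R) := by
  intro τ hτ
  obtain ⟨τ₁, hτ₁, hlt⟩ := exists_gt_mem_shell hR hτ
  obtain ⟨q₁, hc, he⟩ := exists_continuous_extension hτ₁.1 (hq.mono (Icc_subset_shell hR hτ₁))
  refine ((continuous_paramInt hc j).continuousWithinAt (s := shell R)).congr_of_eventuallyEq ?_
    (paramInt_congr he j ⟨hτ.1, hlt.le⟩)
  filter_upwards [Icc_mem_nhdsWithin_shell (R := R) hlt] with σ hσ using paramInt_congr he j hσ

theorem hasDerivWithinAt_paramInt (hR : 0 < R) {q q' : ℝ → ℝ}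
    (hq : ∀ τ ∈ shell R, HasDerivWithinAt q (q' τ) (shell R) τ)
    (hq' : ContinuousOn q' (shell R)) (j : ℕ) {τ : ℝ} (hτ : τ ∈ shell R) :
    HasDerivWithinAt (paramInt j q) (paramInt (j + 2) q' τ) (shell R) τ := by
  obtain ⟨τ₁, hτ₁, hlt⟩ := exists_gt_mem_shell hR hτ
  have hsub := Icc_subset_shell hR hτ₁
  obtain ⟨p, hp, he⟩ := exists_continuous_extension hτ₁.1 (hq'.mono hsub)
  -- Integrating an extension of `q'` extends `q` as a `C¹` function.
  let q₁ : ℝ → ℝ := fun τ => q 1 + ∫ x in (1 : ℝ)..τ, p x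
  have hq₁ : ∀ τ, HasDerivAt q₁ (p τ) τ := fun τ =>
    (intervalIntegral.integral_hasDerivAt_right (hp.intervalIntegrable _ _)
      hp.stronglyMeasurable.stronglyMeasurableAtFilter hp.continuousAt).const_add _
  have heq : Set.EqOn q q₁ (Set.Icc 1 τ₁) := by
    intro σ hσ
    refine eq_of_derivWithin_eq (f := q) (g := q₁) (a := 1) (b := τ₁) ?_ ?_ ?_ ?_ σ hσ
    · exact fun x hx => ((hq x (hsub hx)).mono hsub).differentiableWithinAt
    · exact fun x hx => (hq₁ x).differentiableAt.differentiableWithinAt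
    · intro x hx
      have hu := uniqueDiffOn_Icc (hτ.1.trans_lt hlt) x ⟨hx.1, hx.2.le⟩
      rw [((hq x (hsub ⟨hx.1, hx.2.le⟩)).mono hsub).derivWithin hu,
        (hq₁ x).hasDerivWithinAt.derivWithin hu]
      exact he ⟨hx.1, hx.2.le⟩
    · simp [q₁]
  rw [paramInt_congr he (j + 2) ⟨hτ.1, hlt.le⟩]
  refine (hasDerivAt_paramInt hq₁ hp j τ).hasDerivWithinAt.congr_of_eventuallyEq ?_
    (paramInt_congr heq j ⟨hτ.1, hlt.le⟩)
  filter_upwards [Icc_mem_nhdsWithin_shell (R := R) hlt] with σ hσ using paramInt_congr heq j hσ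

theorem contDiffOn_paramInt (hR : 0 < R) {q : ℝ → ℝ} {k : ℕ} (hq : ContDiffOn ℝ k q (shell R))
    (j : ℕ) : ContDiffOn ℝ k (paramInt j q) (shell R) := by
  have hu := uniqueDiffOn_shell hR
  induction k generalizing q j with
  | zero => exact contDiffOn_zero.2 (continuousOn_paramInt hR hq.continuousOn j)
  | succ k ih =>
    have h := (contDiffOn_succ_iff_derivWithin (n := (k : WithTop ℕ∞)) hu).1 (by exact_mod_cast hq)
    have hd : ∀ τ ∈ shell R, HasDerivWithinAt q (derivWithin q (shell R) τ) (shell R) τ :=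
      fun τ hτ => (h.1 τ hτ).hasDerivWithinAt
    have hd' := fun τ hτ => hasDerivWithinAt_paramInt hR hd h.2.2.continuousOn j (τ := τ) hτ
    have := (contDiffOn_succ_iff_derivWithin (n := (k : WithTop ℕ∞)) (f := paramInt j q) hu).2
      ⟨fun τ hτ => (hd' τ hτ).differentiableWithinAt, by simp,
        (ih h.2.2 (j + 2)).congr fun τ hτ => (hd' τ hτ).derivWithin (hu τ hτ)⟩
    exact_mod_cast this

/-- `paramInt n q` solves `(n + 1) I + 2 (τ - 1) I' = q`. -/
theorem paramInt_eq (hR : 0 < R) {q q' : ℝ → ℝ}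
    (hq : ∀ τ ∈ shell R, HasDerivWithinAt q (q' τ) (shell R) τ)
    (hq' : ContinuousOn q' (shell R)) (j : ℕ) {τ : ℝ} (hτ : τ ∈ shell R) :
    (j + 1) * paramInt j q τ + 2 * (τ - 1) * paramInt (j + 2) q' τ = q τ := by
  have hsub := Icc_subset_shell hR hτ
  have hmem : ∀ x ∈ Set.uIcc (0 : ℝ) 1, 1 + (τ - 1) * x ^ 2 ∈ shell R := fun x hx =>
    hsub (one_add_mul_sq_mem_Icc ⟨hτ.1, le_rfl⟩ hx)
  have hcont : ContinuousOn (fun x : ℝ => 1 + (τ - 1) * x ^ 2) (Set.uIcc 0 1) := by fun_prop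
  have hqc : ContinuousOn q (shell R) := fun τ hτ => (hq τ hτ).continuousWithinAt
  have c1 : ContinuousOn (fun x : ℝ => x ^ j * q (1 + (τ - 1) * x ^ 2)) (Set.uIcc 0 1) :=
    (by fun_prop : ContinuousOn (fun x : ℝ => x ^ j) _).mul (hqc.comp hcont hmem)
  have c2 : ContinuousOn (fun x : ℝ => x ^ (j + 2) * q' (1 + (τ - 1) * x ^ 2)) (Set.uIcc 0 1) :=
    (by fun_prop : ContinuousOn (fun x : ℝ => x ^ (j + 2)) _).mul (hq'.comp hcont hmem)
  -- The identity is the fundamental theorem of calculus on `[0,1]` for `x^(j+1) q(1+(τ-1)x²)`.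
  have hd : ∀ x ∈ Set.uIcc (0 : ℝ) 1, HasDerivWithinAt
      (fun x : ℝ => x ^ (j + 1) * q (1 + (τ - 1) * x ^ 2))
      ((j + 1) * (x ^ j * q (1 + (τ - 1) * x ^ 2))
        + 2 * (τ - 1) * (x ^ (j + 2) * q' (1 + (τ - 1) * x ^ 2))) (Set.uIcc 0 1) x := by
    intro x hx
    have h1 : HasDerivWithinAt (fun x : ℝ => 1 + (τ - 1) * x ^ 2) ((τ - 1) * (2 * x))
        (Set.uIcc 0 1) x := by
      simpa using ((((hasDerivAt_id x).pow 2).const_mul (τ - 1)).const_add 1).hasDerivWithinAt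
    have h2 := (hq _ (hmem x hx)).comp x h1 hmem
    have h3 : HasDerivWithinAt (fun x : ℝ => x ^ (j + 1)) ((j + 1) * x ^ j) (Set.uIcc 0 1) x := by
      simpa using (hasDerivAt_pow (j + 1) x).hasDerivWithinAt
    exact (h3.mul h2).congr_deriv (by simp only [Function.comp]; ring)
  have key := intervalIntegral.integral_eq_sub_of_hasDeriv_right (a := 0) (b := 1)
    (fun x hx => (hd x hx).continuousWithinAt)
    (fun x hx => by
      have hx' : x ∈ Set.Ioo (0 : ℝ) 1 := by simpa using hx
      have := (hd x (by rw [Set.uIcc_of_le zero_le_one]; exact ⟨hx'.1.le, hx'.2.le⟩))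
      rw [Set.uIcc_of_le zero_le_one] at this
      exact (this.hasDerivAt (Icc_mem_nhds hx'.1 hx'.2)).hasDerivWithinAt)
    ((c1.const_smul ((j : ℝ) + 1)).intervalIntegrable.add
      (c2.const_smul (2 * (τ - 1))).intervalIntegrable)
  rw [intervalIntegral.integral_add (c1.const_smul ((j : ℝ) + 1)).intervalIntegrable
      (c2.const_smul (2 * (τ - 1))).intervalIntegrable] at key
  simpa [paramInt, intervalIntegral.integral_const_mul] using key

theorem paramInt_pos (hR : 0 < R) {q : ℝ → ℝ} (hq : ContinuousOn q (shell R))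
    (hpos : ∀ τ ∈ shell R, 0 < q τ) (j : ℕ) {τ : ℝ} (hτ : τ ∈ shell R) : 0 < paramInt j q τ := by
  have hsub := Icc_subset_shell hR hτ
  have hmem : ∀ x ∈ Set.uIcc (0 : ℝ) 1, 1 + (τ - 1) * x ^ 2 ∈ shell R := fun x hx =>
    hsub (one_add_mul_sq_mem_Icc ⟨hτ.1, le_rfl⟩ hx)
  have c1 : ContinuousOn (fun x : ℝ => x ^ j * q (1 + (τ - 1) * x ^ 2)) (Set.uIcc 0 1) :=
    (by fun_prop : ContinuousOn (fun x : ℝ => x ^ j) _).mul (hq.comp (by fun_prop) hmem)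
  refine intervalIntegral.intervalIntegral_pos_of_pos_on c1.intervalIntegrable (fun x hx => ?_)
    zero_lt_one
  exact mul_pos (pow_pos hx.1 j) (hpos _ (hmem x (by
    rw [Set.uIcc_of_le zero_le_one]; exact ⟨hx.1.le, hx.2.le⟩)))

/-- The equation `(n + 1) J + 2 (τ - 1) J' = q` has only one solution which is continuous up to
`τ = 1`. -/
theorem eq_of_singular_ode (hR : 0 < R) {J I J' I' q : ℝ → ℝ} {n : ℕ}
    (hJ : ContinuousOn J (shell R)) (hI : ContinuousOn I (shell R))
    (hJ' : ∀ τ ∈ shell R, 1 < τ → HasDerivAt J (J' τ) τ)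
    (hI' : ∀ τ ∈ shell R, 1 < τ → HasDerivAt I (I' τ) τ)
    (eJ : ∀ τ ∈ shell R, 1 < τ → (n + 1) * J τ + 2 * (τ - 1) * J' τ = q τ)
    (eI : ∀ τ ∈ shell R, 1 < τ → (n + 1) * I τ + 2 * (τ - 1) * I' τ = q τ) :
    Set.EqOn J I (shell R) := by
  have hgt : ∀ τ ∈ shell R, 1 < τ → J τ = I τ := by
    intro τ hτ h1
    have hsub := Icc_subset_shell hR hτ
    -- The integrating factor for the difference is `(τ-1)^((n+1)/2)`; squaring avoids the
    -- half-integral power. `W` is constant and vanishes at `1`.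
    let W : ℝ → ℝ := fun τ => (τ - 1) ^ (n + 1) * (J τ - I τ) ^ 2
    have hc : ContinuousOn W (Set.Icc 1 τ) :=
      (by fun_prop : ContinuousOn (fun τ : ℝ => (τ - 1) ^ (n + 1)) _).mul
        (((hJ.mono hsub).sub (hI.mono hsub)).pow 2)
    have hW : W τ = W 1 := by
      have hd : ∀ x ∈ Set.Ioo 1 τ, HasDerivAt W 0 x := by
        intro x hx
        have hx' := hsub ⟨hx.1.le, hx.2.le⟩
        have h3 : HasDerivAt (fun τ : ℝ => (τ - 1) ^ (n + 1)) ((n + 1) * (x - 1) ^ n) x := by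
          simpa using ((hasDerivAt_id x).sub_const 1).fun_pow (n + 1)
        refine (h3.mul (((hJ' x hx' hx.1).sub (hI' x hx' hx.1)).pow 2)).congr_deriv ?_
        simp only [Pi.sub_apply, Pi.pow_apply]
        push_cast
        linear_combination (x - 1) ^ n * (J x - I x) * (eJ x hx' hx.1 - eI x hx' hx.1)
      obtain ⟨x, hx, e⟩ := exists_hasDerivAt_eq_slope W (fun _ => 0) h1 hc hd
      have h4 : τ - 1 ≠ 0 := by linarith
      rcases div_eq_zero_iff.1 e.symm with h | h
      · linarith
      · exact absurd h h4
    have : (τ - 1) ^ (n + 1) * (J τ - I τ) ^ 2 = 0 := by simpa [W] using hW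
    have h2 : (τ - 1) ^ (n + 1) ≠ 0 := pow_ne_zero _ (by linarith)
    have h3 := (mul_eq_zero.1 this).resolve_left h2
    linarith [pow_eq_zero_iff (two_ne_zero) |>.1 h3]
  intro τ hτ
  rcases hτ.1.eq_or_lt with h | h
  · subst h
    obtain ⟨τ₁, hτ₁, hlt⟩ := exists_gt_mem_shell hR hτ
    have hc : ContinuousOn (fun τ => J τ - I τ) (Set.Icc 1 τ₁) :=
      (hJ.sub hI).mono (Icc_subset_shell hR hτ₁)
    have hz : Set.EqOn (fun τ => J τ - I τ) (fun _ => 0) (Set.Ioc 1 τ₁) := fun σ hσ =>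
      sub_eq_zero.2 (hgt σ (Icc_subset_shell hR hτ₁ ⟨hσ.1.le, hσ.2⟩) hσ.1)
    have := hz.of_subset_closure hc continuousOn_const Set.Ioc_subset_Icc_self
      (closure_Ioc hlt.ne).superset ⟨le_rfl, hlt.le⟩
    exact sub_eq_zero.1 this
  · exact hgt τ hτ h

end ParametricIntegral

/-! ### Profiles in integral form and their regularity. -/

section IntegralProfile

/-- `cosh (s / 2)` as a function of `τ = cosh s`. -/
noncomputable def halfCosh (τ : ℝ) : ℝ := √((τ + 1) / 2)

theorem halfCosh_pos {τ : ℝ} (h : 1 ≤ τ) : 0 < halfCosh τ := Real.sqrt_pos.2 (by linarith)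

theorem halfCosh_sq {τ : ℝ} (h : 1 ≤ τ) : halfCosh τ ^ 2 = (τ + 1) / 2 :=
  Real.sq_sqrt (by linarith)

theorem hasDerivAt_halfCosh {τ : ℝ} (h : 1 ≤ τ) : HasDerivAt halfCosh (1 / (4 * halfCosh τ)) τ := by
  have h1 : HasDerivAt (fun τ : ℝ => (τ + 1) / 2) (1 / 2) τ :=
    ((hasDerivAt_id τ).add_const 1).div_const 2
  have h2 := h1.sqrt (by linarith)
  refine h2.congr_deriv ?_
  unfold halfCosh
  rw [div_div]; ring

variable {n : ℕ} {Λ C : ℝ} {R : EReal} {F G : ℝ → ℝ}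

theorem contDiffOn_halfCosh (k : WithTop ℕ∞) : ContDiffOn ℝ k halfCosh (shell R) := by
  refine ContDiffOn.sqrt (by fun_prop) fun τ hτ => ?_
  have := hτ.1
  positivity

/-- The right hand side of the singular equation satisfied by `(halfCosh * G) ^ (n + 1)`. -/
noncomputable def profileDensity (n : ℕ) (Λ C : ℝ) (F : ℝ → ℝ) (τ : ℝ) : ℝ :=
  C * Real.exp (-Λ * F τ) * halfCosh τ ^ n / halfCosh τ

theorem ContDiffOn.profileDensity {k : WithTop ℕ∞} (hF : ContDiffOn ℝ k F (shell R)) :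
    ContDiffOn ℝ k (profileDensity n Λ C F) (shell R) := by
  have hh := contDiffOn_halfCosh (R := R) k
  exact ((contDiffOn_const.mul (contDiffOn_const.mul hF).exp).mul (hh.pow n)).div hh
    fun τ hτ => (halfCosh_pos hτ.1).ne'

theorem profileDensity_pos (hC : 0 < C) {τ : ℝ} (h : 1 ≤ τ) : 0 < profileDensity n Λ C F τ := by
  have := halfCosh_pos h
  unfold profileDensity
  positivity

/-- Bootstrap: if `F` is `C^k`, so are the density and its integral; the integral is positive, so
its `(n+1)`-st root is `C^k` and hence so is `G = F'`. Thus `F` is `C^(k+1)`. -/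
theorem contDiffOn_of_integral (hR : 0 < R)
    (hF : ∀ τ ∈ shell R, HasDerivWithinAt F (G τ) (shell R) τ)
    (hpos : ∀ τ ∈ shell R, 0 < G τ) (hC : 0 < C)
    (he : ∀ τ ∈ shell R, (halfCosh τ * G τ) ^ (n + 1)
      = (n + 1) * paramInt n (profileDensity n Λ C F) τ) :
    ContDiffOn ℝ ∞ F (shell R) := by
  have hu := uniqueDiffOn_shell hR
  refine contDiffOn_infty.2 fun k => ?_
  induction k with
  | zero => exact contDiffOn_zero.2 fun τ hτ => (hF τ hτ).continuousWithinAt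
  | succ k ih =>
    have hI := contDiffOn_paramInt hR (ih.profileDensity (n := n) (Λ := Λ) (C := C)) n
    have hG : ContDiffOn ℝ k G (shell R) := by
      have h1 : ContDiffOn ℝ k (fun τ => (((n : ℝ) + 1) * paramInt n (profileDensity n Λ C F) τ) ^
          (((n + 1 : ℕ) : ℝ)⁻¹) / halfCosh τ) (shell R) := by
        refine ((contDiffOn_const.mul hI).rpow_const_of_ne fun τ hτ => ?_).div
          (contDiffOn_halfCosh _) fun τ hτ => (halfCosh_pos hτ.1).ne'
        exact (mul_pos (by positivity) (paramInt_pos hR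
          (ih.profileDensity (n := n) (Λ := Λ) (C := C)).continuousOn
          (fun τ hτ => profileDensity_pos hC hτ.1) n hτ)).ne'
      refine h1.congr fun τ hτ => ?_
      have h2 := halfCosh_pos hτ.1
      rw [← he τ hτ, Real.pow_rpow_inv_natCast (mul_pos h2 (hpos τ hτ)).le n.succ_ne_zero,
        mul_div_cancel_left₀ _ h2.ne']
    have := (contDiffOn_succ_iff_derivWithin (n := (k : WithTop ℕ∞)) (f := F) hu).2
      ⟨fun τ hτ => (hF τ hτ).differentiableWithinAt, by simp,
        hG.congr fun τ hτ => (hF τ hτ).derivWithin (hu τ hτ)⟩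
    exact_mod_cast this

/-- Differentiating the integral formula and inserting `paramInt_eq` eliminates both integrals and
leaves the differential equation, also at `τ = 1`. -/
theorem isEinsteinProfile_of_integral (hR : 0 < R)
    (hF : ∀ τ ∈ shell R, HasDerivWithinAt F (G τ) (shell R) τ)
    (hpos : ∀ τ ∈ shell R, 0 < G τ) (hC : 0 < C)
    (he : ∀ τ ∈ shell R, (halfCosh τ * G τ) ^ (n + 1)
      = (n + 1) * paramInt n (profileDensity n Λ C F) τ) :
    IsEinsteinProfile n Λ R F G (derivWithin G (shell R)) C := by
  have hu := uniqueDiffOn_shell hR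
  have hsm := contDiffOn_of_integral hR hF hpos hC he
  have hG1 : ContDiffOn ℝ 1 G (shell R) := by
    have h2 : ContDiffOn ℝ (1 + 1) F (shell R) := hsm.of_le (by norm_cast)
    exact ((contDiffOn_succ_iff_derivWithin hu).1 h2).2.2.congr fun τ hτ =>
      ((hF τ hτ).derivWithin (hu τ hτ)).symm
  have hG : ∀ τ ∈ shell R, HasDerivWithinAt G (derivWithin G (shell R) τ) (shell R) τ :=
    fun τ hτ => (hG1.differentiableOn one_ne_zero τ hτ).hasDerivWithinAt
  refine ⟨hR, hF, hG, hsm, hpos, hC, fun τ hτ => ?_⟩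
  have hq : ContDiffOn ℝ (0 + 1) (profileDensity n Λ C F) (shell R) :=
    (hsm.of_le (by norm_cast)).profileDensity
  have hq' := (contDiffOn_succ_iff_derivWithin hu).1 hq
  have hqd := fun σ hσ => (hq'.1 σ hσ).hasDerivWithinAt
  have e1 := paramInt_eq hR hqd hq'.2.2.continuousOn n hτ
  have hI := (hasDerivWithinAt_paramInt hR hqd hq'.2.2.continuousOn n hτ).const_mul ((n : ℝ) + 1)
  have hh := halfCosh_pos hτ.1
  have hP := (((hasDerivAt_halfCosh hτ.1).hasDerivWithinAt (s := shell R)).mul (hG τ hτ)).fun_pow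
    (n + 1)
  have e2 := (hu τ hτ).eq_deriv _ (hP.congr (fun σ hσ => (he σ hσ).symm) (he τ hτ).symm) hI
  have e3 := he τ hτ
  have e4 := halfCosh_sq hτ.1
  simp only [Pi.mul_apply, Nat.add_sub_cancel] at e2
  push_cast at e2
  unfold profileDensity at e1 e2 e3
  generalize paramInt n _ τ = I at e1 e3
  generalize paramInt (n + 2) _ τ = I' at e1 e2
  generalize derivWithin G (shell R) τ = D at *
  generalize halfCosh τ = h at *
  generalize Real.exp _ = E at *
  have hn : (n : ℝ) + 1 ≠ 0 := by positivity
  have e5 : I' = (h * G τ) ^ n * (1 / (4 * h) * G τ + h * D) := by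
    apply mul_left_cancel₀ hn
    linear_combination -e2
  have hk : h ^ n ≠ 0 := pow_ne_zero _ hh.ne'
  have e6 : (h * G τ) ^ (n + 1) + 2 * (τ - 1) * ((h * G τ) ^ n * (1 / (4 * h) * G τ + h * D))
      = C * E * h ^ n / h := by
    rw [e3, ← e5, e1]
  rw [mul_pow, mul_pow, pow_succ, pow_succ] at e6
  have e7 : h ^ n * (G τ ^ n * (h ^ 2 * G τ + (τ - 1) / 2 * G τ + 2 * (τ - 1) * h ^ 2 * D))
      = h ^ n * (C * E) := by
    field_simp at e6
    linear_combination h ^ n * e6 / 4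
  have e8 := mul_left_cancel₀ hk e7
  -- With `h² = (τ+1)/2` one has `h² + (τ-1)/2 = τ` and `2(τ-1)h² = τ² - 1`.
  rw [e4] at e8
  linear_combination e8

end IntegralProfile

/-! ### Profiles in the variable `s = 2r`, and the bound on `G` if `Λ = 0`. -/

section ProfileBounds

variable {n : ℕ} {Λ C : ℝ} {R : EReal} {F G G' : ℝ → ℝ}

theorem cosh_mem_shell_top (s : ℝ) : Real.cosh s ∈ shell ⊤ := by
  rw [shell_top]; exact Real.one_le_cosh s

namespace IsEinsteinProfile

theorem hasDerivWithinAt_comp_cosh (h : IsEinsteinProfile n Λ R F G G' C) {S : Set ℝ}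
    (hS : Set.MapsTo Real.cosh S (shell R)) {s : ℝ} (hs : s ∈ S) :
    HasDerivWithinAt (fun s => F (Real.cosh s)) (G (Real.cosh s) * Real.sinh s) S s :=
  (h.derivF _ (hS hs)).comp s (Real.hasDerivAt_cosh s).hasDerivWithinAt hS

/-- The equation of the profile in terms of `f (s) = F (cosh s)`. -/
theorem hasDerivWithinAt_deriv_pow (h : IsEinsteinProfile n Λ R F G G' C) {S : Set ℝ}
    (hS : Set.MapsTo Real.cosh S (shell R)) {s : ℝ} (hs : s ∈ S) :
    HasDerivWithinAt (fun s => (G (Real.cosh s) * Real.sinh s) ^ (n + 1))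
      ((n + 1) * (C * Real.exp (-Λ * F (Real.cosh s))) * Real.sinh s ^ n) S s := by
  have h1 : HasDerivWithinAt (fun s => G (Real.cosh s)) (G' (Real.cosh s) * Real.sinh s) S s :=
    (h.derivG _ (hS hs)).comp s (Real.hasDerivAt_cosh s).hasDerivWithinAt hS
  refine ((h1.mul (Real.hasDerivAt_sinh s).hasDerivWithinAt).fun_pow (n + 1)).congr_deriv ?_
  rw [← h.ode _ (hS hs)]
  have := Real.cosh_sq_sub_sinh_sq s
  simp only [Pi.mul_apply, Nat.add_sub_cancel]
  push_cast
  rw [mul_pow]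
  linear_combination (-((n : ℝ) + 1) * G (Real.cosh s) ^ n * Real.sinh s ^ n * G' (Real.cosh s))
    * this

/-- If the Einstein constant vanishes then `G` is bounded. -/
theorem pow_le (h : IsEinsteinProfile n 0 R F G G' C) {τ : ℝ} (hτ : τ ∈ shell R) :
    G τ ^ (n + 1) ≤ C := by
  have hgt : ∀ τ ∈ shell R, 1 < τ → G τ ^ (n + 1) ≤ C := by
    intro τ hτ h1
    have hs := Real.arcosh_pos h1
    have hcs := Real.cosh_arcosh h1.le
    set s := Real.arcosh τ
    rw [← hcs]
    have hS : Set.MapsTo Real.cosh (Set.Icc 0 s) (shell R) := fun x hx =>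
      Icc_subset_shell h.R_pos hτ ⟨Real.one_le_cosh x, by
        rw [← hcs, Real.cosh_le_cosh, abs_of_nonneg hx.1, abs_of_pos hs]; exact hx.2⟩
    -- Compared with `C sinh^(n+1)`, the power `(G sinh)^(n+1)` has the same value at `0` and a
    -- smaller derivative, since `sinhⁿ ≤ sinhⁿ cosh`.
    have hd : ∀ x ∈ Set.Icc 0 s, HasDerivWithinAt (fun s => C * Real.sinh s ^ (n + 1)
        - (G (Real.cosh s) * Real.sinh s) ^ (n + 1))
        ((n + 1) * C * Real.sinh x ^ n * (Real.cosh x - 1)) (Set.Icc 0 s) x := fun x hx => by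
      refine ((((Real.hasDerivAt_sinh x).fun_pow (n + 1)).const_mul C).hasDerivWithinAt.sub
        (h.hasDerivWithinAt_deriv_pow hS hx)).congr_deriv ?_
      simp only [Nat.add_sub_cancel, neg_zero, zero_mul, Real.exp_zero]
      push_cast
      ring
    have hmono : MonotoneOn (fun s => C * Real.sinh s ^ (n + 1)
        - (G (Real.cosh s) * Real.sinh s) ^ (n + 1)) (Set.Icc 0 s) := by
      refine monotoneOn_of_hasDerivWithinAt_nonneg (convex_Icc 0 s)
        (fun x hx => (hd x hx).continuousWithinAt)
        (fun x hx => (hd x (interior_subset hx)).mono interior_subset) fun x hx => ?_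
      have h1 := Real.sinh_nonneg_iff.2 (interior_subset hx).1
      have h2 := Real.one_le_cosh x
      have := h.C_pos
      have : 0 ≤ Real.cosh x - 1 := by linarith
      positivity
    have h0 := hmono ⟨le_rfl, hs.le⟩ ⟨hs.le, le_rfl⟩ hs.le
    simp only [Real.sinh_zero, mul_zero, ne_eq, Nat.add_eq_zero_iff, one_ne_zero, and_false,
      not_false_eq_true, zero_pow, sub_self, sub_nonneg, mul_pow] at h0
    exact le_of_mul_le_mul_right h0 (pow_pos (Real.sinh_pos_iff.2 hs) _)
  rcases hτ.1.eq_or_lt with e | hlt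
  · subst e
    obtain ⟨τ₁, hτ₁, hlt⟩ := exists_gt_mem_shell h.R_pos hτ
    have hsub := Icc_subset_shell h.R_pos hτ₁
    have hc : ContinuousOn (fun τ => G τ ^ (n + 1)) (Set.Icc 1 τ₁) :=
      (h.continuousOn_G.mono hsub).pow _
    refine (isClosed_Iic (a := C)).closure_subset (?_ : G 1 ^ (n + 1) ∈ closure (Set.Iic C))
    have := (hc 1 ⟨le_rfl, hlt.le⟩).mono (Set.Ioc_subset_Icc_self)
    refine this.mem_closure (by rw [closure_Ioc hlt.ne]; exact ⟨le_rfl, hlt.le⟩) ?_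
    exact fun σ hσ => hgt σ (hsub ⟨hσ.1.le, hσ.2⟩) hσ.1
  · exact hgt τ hτ hlt

theorem le_one_add (h : IsEinsteinProfile n 0 R F G G' C) {τ : ℝ} (hτ : τ ∈ shell R) :
    G τ ≤ 1 + C := by
  rcases le_total (G τ) 1 with h1 | h1
  · linarith [h.C_pos]
  · have : G τ ≤ G τ ^ (n + 1) := le_self_pow₀ h1 n.succ_ne_zero
    linarith [h.pow_le hτ]

end IsEinsteinProfile

end ProfileBounds

/-! ### Solutions of Stenzel's equation are profiles with `Λ = 0`. -/

section StenzelFunction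

variable {n : ℕ} {k C : ℝ} {f F G G' : ℝ → ℝ}

/-- A profile with vanishing Einstein constant defines a complete metric on the quadric. -/
theorem IsEinsteinProfile.isCompleteMetric_of_zero (h : IsEinsteinProfile n 0 ⊤ F G G' C) :
    IsCompleteMetric (tube n ⊤) (radialMetric (n + 2) G G') := by
  have hC := h.C_pos
  -- Since `G ≤ M` and `Gⁿ (τG + (τ²-1)G') = M^(n+1)`, the bracket is at least `M`. The constant
  -- `√(M/2)` is then what keeps the gradient of `√(M/2) log τ` at most one.
  set M : ℝ := C ^ (((n + 1 : ℕ) : ℝ)⁻¹) with hM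
  have hM0 : 0 < M := Real.rpow_pos_of_pos hC _
  have hMC : M ^ (n + 1) = C := Real.rpow_inv_natCast_pow hC.le n.succ_ne_zero
  have hμ : 0 < √(M / 2) := Real.sqrt_pos.2 (by linarith)
  have hle : ∀ τ ∈ shell ⊤, M ≤ τ * G τ + (τ ^ 2 - 1) * G' τ := by
    intro τ hτ
    have hG := h.pos τ hτ
    have h1 : G τ ≤ M := by
      have := h.pow_le hτ
      rw [← hMC] at this
      exact le_of_pow_le_pow_left₀ n.succ_ne_zero hM0.le this
    have h2 : G τ ^ n ≤ M ^ n := pow_le_pow_left₀ hG.le h1 n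
    have h3 := h.ode τ hτ
    rw [neg_zero, zero_mul, Real.exp_zero, mul_one, ← hMC, pow_succ M] at h3
    have h4 : 0 < G τ ^ n := pow_pos hG n
    refine le_of_mul_le_mul_left ?_ h4
    rw [h3]
    exact mul_le_mul_of_nonneg_right h2 hM0.le
  refine h.isCompleteMetric (Θ := fun τ => √(M / 2) * Real.log τ) (θ := fun τ => √(M / 2) * τ⁻¹)
    (fun τ hτ => ?_) ?_ (fun τ hτ => ?_) fun b => ?_
  · exact ((Real.hasDerivAt_log (by linarith [hτ.1])).const_mul _).hasDerivWithinAt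
  · exact continuousOn_const.mul (continuousOn_inv₀.mono fun τ hτ => by
      have := hτ.1
      exact (by positivity : τ ≠ 0))
  · refine le_trans ?_ (hle τ hτ)
    have h1 := hτ.1
    rw [mul_pow, Real.sq_sqrt (by linarith), inv_pow]
    have : (τ ^ 2)⁻¹ * (τ ^ 2 - 1) ≤ 1 := by
      rw [inv_mul_le_iff₀ (by positivity)]; linarith
    nlinarith
  · refine ⟨max 1 (Real.exp (b / √(M / 2))), by rw [shell_top]; exact Set.mem_Ici.2 (le_max_left _ _),
      fun τ hτ hb => le_max_of_le_right ?_⟩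
    rw [← Real.log_le_iff_le_exp (by linarith [hτ.1]), le_div_iff₀ hμ]
    linarith

theorem IsEinsteinProfile.isStenzelFunction (h : IsEinsteinProfile n 0 ⊤ F G G' C) :
    IsStenzelFunction n C fun s => F (Real.cosh s) := by
  refine ⟨fun s => G (Real.cosh s) * Real.sinh s, by simp, fun s hs =>
    mul_pos (h.pos _ (cosh_mem_shell_top s)) (Real.sinh_pos_iff.2 hs), fun s hs =>
    ⟨h.hasDerivWithinAt_comp_cosh (S := Set.Ici 0) (fun x _ => cosh_mem_shell_top x) hs, ?_⟩⟩
  simpa using h.hasDerivWithinAt_deriv_pow (S := Set.Ici 0) (fun x _ => cosh_mem_shell_top x) hs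

theorem two_mul_radius (z : CC (n + 2)) : 2 * radius z = Real.arcosh (‖z‖ ^ 2) := by
  unfold radius; ring

theorem eq_comp_norm_sq (hf : ∀ s, 0 ≤ s → F (Real.cosh s) = f s) {z : CC (n + 2)}
    (hz : z ∈ quadric n) : f (2 * radius z) = F (‖z‖ ^ 2) := by
  have h1 := one_le_norm_sq_of_mem_quadric hz
  rw [two_mul_radius, ← hf _ (Real.arcosh_nonneg h1), Real.cosh_arcosh h1]

theorem IsEinsteinProfile.hasKahlerPotential (h : IsEinsteinProfile n 0 ⊤ F G G' C)
    (hf : ∀ s, 0 ≤ s → F (Real.cosh s) = f s) :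
    HasKahlerPotential (n + 1) (quadric n) (radialMetric (n + 2) G G')
      fun z => f (2 * radius z) := by
  intro U ψ hψ
  have heq : Set.EqOn ((fun z => f (2 * radius z)) ∘ ψ) (fun y => F (‖ψ y‖ ^ 2)) U :=
    fun y hy => eq_comp_norm_sq hf (hψ.mapsTo hy)
  rw [← tube_top] at hψ
  refine ⟨(h.contDiffOn_potential hψ).congr heq, fun x hx v w => ?_⟩
  rw [h.pull_eq hψ hx]
  exact (levi_congr (heq.eventuallyEq_of_mem (hψ.isOpen.mem_nhds hx)) v w).symm

theorem IsEinsteinProfile.isStenzelMetric (h : IsEinsteinProfile n 0 ⊤ F G G' C)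
    (hf : ∀ s, 0 ≤ s → F (Real.cosh s) = f s) :
    IsStenzelMetric n f (radialMetric (n + 2) G G') := by
  have := h.isKahlerEinstein.1.riemannian
  rw [tube_top] at this
  exact ⟨this, h.hasKahlerPotential hf⟩

/-- If `k ≤ 0`, the power `f'^(n+1)` would be nonincreasing from `0`, against `f' > 0`. -/
theorem StenzelTube.IsStenzelFunction.pos (hf : IsStenzelFunction n k f) : 0 < k := by
  obtain ⟨f', h0, hpos, hd⟩ := hf
  by_contra! hk
  have hanti : AntitoneOn (fun x => f' x ^ (n + 1)) (Set.Ici 0) := by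
    refine antitoneOn_of_hasDerivWithinAt_nonpos (convex_Ici 0)
      (fun s hs => (hd s hs).2.continuousWithinAt)
      (fun s hs => (hd s (interior_subset hs)).2.mono interior_subset) fun s hs => ?_
    have h1 := Real.sinh_nonneg_iff.2 (interior_subset hs : s ∈ Set.Ici (0 : ℝ))
    have h2 : ((n : ℝ) + 1) * k ≤ 0 := mul_nonpos_of_nonneg_of_nonpos (by positivity) hk
    exact mul_nonpos_of_nonpos_of_nonneg h2 (by positivity)
  have h1 := hanti (Set.mem_Ici.2 le_rfl) (Set.mem_Ici.2 zero_le_one) zero_le_one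
  simp only [h0, ne_eq, Nat.add_eq_zero_iff, one_ne_zero, and_false, not_false_eq_true,
    zero_pow] at h1
  exact absurd h1 (not_le.2 (pow_pos (hpos 1 one_pos) _))

/-- For `Λ = 0` the density does not involve `F`, so the integral formula defines `G` explicitly and
`F` is a primitive of it. -/
theorem exists_isEinsteinProfile_zero (hk : 0 < k) (y : ℝ) :
    ∃ F G G', IsEinsteinProfile n 0 ⊤ F G G' k ∧ F 1 = y := by
  have hq : ∀ F, profileDensity n 0 k F = profileDensity n 0 k 0 := fun F => by
    funext τ; simp [profileDensity]
  have hq0 : ContDiffOn ℝ 0 (profileDensity n 0 k 0) (shell ⊤) :=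
    ContDiffOn.profileDensity contDiffOn_const
  let G : ℝ → ℝ := fun τ => (((n : ℝ) + 1) * paramInt n (profileDensity n 0 k 0) τ) ^
    (((n + 1 : ℕ) : ℝ)⁻¹) / halfCosh τ
  have hI : ∀ τ ∈ shell ⊤, 0 < ((n : ℝ) + 1) * paramInt n (profileDensity n 0 k 0) τ :=
    fun τ hτ => mul_pos (by positivity) (paramInt_pos EReal.zero_lt_top hq0.continuousOn
      (fun τ hτ => profileDensity_pos hk hτ.1) n hτ)
  have hG : ContinuousOn G (shell ⊤) :=
    ((continuousOn_const.mul (continuousOn_paramInt EReal.zero_lt_top hq0.continuousOn n)).rpow_const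
      fun τ hτ => Or.inl (hI τ hτ).ne').div (contDiffOn_halfCosh 0).continuousOn
        fun τ hτ => (halfCosh_pos hτ.1).ne'
  -- Extending `G` by the constant `G 1` below `1` makes its primitive differentiable on all of `ℝ`.
  have hGc : Continuous fun x => G (max x 1) :=
    hG.comp_continuous (by fun_prop) fun x => by rw [shell_top]; exact le_max_right x 1
  refine ⟨fun τ => y + ∫ x in (1 : ℝ)..τ, G (max x 1), G, _, isEinsteinProfile_of_integral
    EReal.zero_lt_top (fun τ hτ => ?_) (fun τ hτ => ?_) hk (fun τ hτ => ?_), by simp⟩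
  · have := ((intervalIntegral.integral_hasDerivAt_right (hGc.intervalIntegrable 1 τ)
      hGc.stronglyMeasurable.stronglyMeasurableAtFilter hGc.continuousAt).const_add
        y).hasDerivWithinAt (s := shell ⊤)
    simpa [max_eq_left hτ.1] using this
  · exact div_pos (Real.rpow_pos_of_pos (hI τ hτ) _) (halfCosh_pos hτ.1)
  · rw [hq]
    simp only [G]
    rw [mul_div_cancel₀ _ (halfCosh_pos hτ.1).ne', Real.rpow_inv_natCast_pow (hI τ hτ).le
      n.succ_ne_zero]

/-- Every solution of Stenzel's equation comes from a profile. -/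
theorem StenzelTube.IsStenzelFunction.exists_profile (hf : IsStenzelFunction n k f) :
    ∃ F G G', IsEinsteinProfile n 0 ⊤ F G G' k ∧ ∀ s, 0 ≤ s → F (Real.cosh s) = f s := by
  obtain ⟨F, G, G', h, h1⟩ := exists_isEinsteinProfile_zero (n := n) hf.pos (f 0)
  obtain ⟨f', h0, hpos, hd⟩ := hf
  refine ⟨F, G, G', h, fun s hs => ?_⟩
  have eqd : ∀ {u v w : ℝ → ℝ}, (∀ s, 0 ≤ s → HasDerivWithinAt u (w s) (Set.Ici 0) s) →
      (∀ s, 0 ≤ s → HasDerivWithinAt v (w s) (Set.Ici 0) s) → u 0 = v 0 →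
      ∀ s, 0 ≤ s → u s = v s := by
    intro u v w hu hv h0 s hs
    rcases hs.eq_or_lt with rfl | hs'
    · exact h0
    have hsub : Set.Icc 0 s ⊆ Set.Ici 0 := Set.Icc_subset_Ici_self
    refine eq_of_derivWithin_eq (a := 0) (b := s)
      (fun x hx => ((hu x hx.1).mono hsub).differentiableWithinAt)
      (fun x hx => ((hv x hx.1).mono hsub).differentiableWithinAt) (fun x hx => ?_) h0 s
      ⟨hs, le_rfl⟩
    have hx' := uniqueDiffOn_Icc hs' x ⟨hx.1, hx.2.le⟩
    rw [((hu x hx.1).mono hsub).derivWithin hx', ((hv x hx.1).mono hsub).derivWithin hx']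
  -- The equation prescribes only the derivative of `f'^(n+1)`; the sign condition on `f'` then
  -- selects the root.
  have hpow : ∀ s, 0 ≤ s → (G (Real.cosh s) * Real.sinh s) ^ (n + 1) = f' s ^ (n + 1) :=
    eqd (fun s hs => h.hasDerivWithinAt_deriv_pow (S := Set.Ici 0) (fun x _ => cosh_mem_shell_top x) hs)
      (fun s hs => by simpa using (hd s hs).2) (by simp [h0])
  have hf' : ∀ s, 0 ≤ s → f' s = G (Real.cosh s) * Real.sinh s := by
    intro s hs
    have h2 : 0 ≤ f' s := by
      rcases hs.eq_or_lt with rfl | hs'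
      · exact h0.ge
      · exact (hpos s hs').le
    exact (pow_left_inj₀ h2 (mul_nonneg (h.pos _ (cosh_mem_shell_top s)).le
      (Real.sinh_nonneg_iff.2 hs)) n.succ_ne_zero).1 (hpow s hs).symm
  refine eqd (fun s hs => h.hasDerivWithinAt_comp_cosh (S := Set.Ici 0) (fun x _ => cosh_mem_shell_top x) hs)
    (fun s hs => ?_) (by simpa using h1) s hs
  rw [← hf' s hs]
  exact (hd s hs).1

/-- A metric on the quadric with the potential of a profile is the metric of that profile. -/
theorem StenzelTube.IsStenzelMetric.pull_eq {g : BilinField (n + 2)} (hg : IsStenzelMetric n f g)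
    (h : IsEinsteinProfile n 0 ⊤ F G G' C) (hf : ∀ s, 0 ≤ s → F (Real.cosh s) = f s)
    (U : Set (CC (n + 1))) (ψ : CC (n + 1) → CC (n + 2)) (hψ : IsHolChart (n + 1) (quadric n) U ψ)
    (x : CC (n + 1)) (hx : x ∈ U) (v w : CC (n + 1)) :
    pull g ψ x v w = pull (radialMetric (n + 2) G G') ψ x v w := by
  rw [(hg.2 U ψ hψ).2 x hx, (h.hasKahlerPotential hf U ψ hψ).2 x hx]

end StenzelFunction

/-! ### The action of `SO(n+2)` preserves the bilinear and the Hermitian form. -/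

section OrthogonalAction

variable {n : ℕ}

theorem act_add (A : Matrix (Fin (n + 2)) (Fin (n + 2)) ℝ) (v w : CC (n + 2)) :
    act A (v + w) = act A v + act A w := by
  ext i; simp [act, Matrix.mulVec_add]

theorem act_smul (A : Matrix (Fin (n + 2)) (Fin (n + 2)) ℝ) (x : ℂ) (v : CC (n + 2)) :
    act A (x • v) = x • act A v := by
  ext i; simp [act, Matrix.mulVec_smul]

theorem act_real_smul (A : Matrix (Fin (n + 2)) (Fin (n + 2)) ℝ) (x : ℝ) (v : CC (n + 2)) :
    act A (x • v) = x • act A v := by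
  have h : ∀ w : CC (n + 2), x • w = (x : ℂ) • w := fun w => by ext i; simp
  rw [h, h, act_smul]

theorem act_mul (A P : Matrix (Fin (n + 2)) (Fin (n + 2)) ℝ) (v : CC (n + 2)) :
    act (A * P) v = act A (act P v) := by
  ext i
  have : (A * P).map Complex.ofReal = A.map Complex.ofReal * P.map Complex.ofReal :=
    Matrix.map_mul (f := Complex.ofRealHom)
  simp [act, this, Matrix.mulVec_mulVec]

theorem map_transpose_mul_map {A : Matrix (Fin (n + 2)) (Fin (n + 2)) ℝ}
    (hA : A ∈ Matrix.specialOrthogonalGroup (Fin (n + 2)) ℝ) :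
    (A.map Complex.ofReal).transpose * A.map Complex.ofReal = 1 := by
  have h := (Matrix.mem_orthogonalGroup_iff' _ _).1 (Matrix.mem_specialOrthogonalGroup_iff.1 hA).1
  have h2 := congrArg (fun P : Matrix (Fin (n + 2)) (Fin (n + 2)) ℝ => P.map Complex.ofRealHom) h
  simp only [Matrix.map_mul] at h2
  rw [Matrix.map_one _ (map_zero _) (map_one _)] at h2
  exact h2

theorem sum_act_mul_act {A : Matrix (Fin (n + 2)) (Fin (n + 2)) ℝ}
    (hA : A ∈ Matrix.specialOrthogonalGroup (Fin (n + 2)) ℝ) (v w : CC (n + 2)) :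
    ∑ i, act A v i * act A w i = ∑ i, v i * w i := by
  change (A.map Complex.ofReal).mulVec v.ofLp ⬝ᵥ (A.map Complex.ofReal).mulVec w.ofLp
    = v.ofLp ⬝ᵥ w.ofLp
  rw [Matrix.dotProduct_mulVec, Matrix.vecMul_mulVec, map_transpose_mul_map hA, Matrix.vecMul_one]

theorem inner_act_act {A : Matrix (Fin (n + 2)) (Fin (n + 2)) ℝ}
    (hA : A ∈ Matrix.specialOrthogonalGroup (Fin (n + 2)) ℝ) (v w : CC (n + 2)) :
    inner ℂ (act A v) (act A w) = inner ℂ v w := by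
  have hs : ∀ i, star (act A v i) = act A (WithLp.toLp 2 (star v.ofLp)) i := fun i => by
    simp [act, Matrix.mulVec, dotProduct]
  have h := sum_act_mul_act hA (WithLp.toLp 2 (star v.ofLp)) w
  rw [PiLp.inner_apply, PiLp.inner_apply]
  simp only [RCLike.inner_apply]
  calc _ = ∑ i, act A (WithLp.toLp 2 (star v.ofLp)) i * act A w i :=
        Finset.sum_congr rfl fun i _ => by rw [← hs, mul_comm]; rfl
    _ = _ := by rw [h]; exact Finset.sum_congr rfl fun i _ => by rw [mul_comm]; rfl

theorem norm_sq_act {A : Matrix (Fin (n + 2)) (Fin (n + 2)) ℝ}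
    (hA : A ∈ Matrix.specialOrthogonalGroup (Fin (n + 2)) ℝ) (v : CC (n + 2)) :
    ‖act A v‖ ^ 2 = ‖v‖ ^ 2 := by
  have h := inner_act_act hA v v
  rw [inner_self_eq_norm_sq_to_K, inner_self_eq_norm_sq_to_K] at h
  exact_mod_cast h

end OrthogonalAction

/-! ### The metric and the complex structure in the invariant frame. -/

section Frame

variable {n : ℕ}

theorem sum_univ_frame {M : Type*} [AddCommMonoid M] (f : Fin (n + 2) → M) :
    ∑ i, f i = ∑ i : Fin n, f (Fin.castAdd 2 i) + f (idx₁ n) + f (idx₂ n) := by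
  rw [Fin.sum_univ_castSucc, Fin.sum_univ_castSucc]; rfl

theorem castAdd_ne_idx₁ (i : Fin n) : Fin.castAdd 2 i ≠ idx₁ n := by
  intro h; have := congrArg Fin.val h; simp [idx₁] at this; omega

theorem castAdd_ne_idx₂ (i : Fin n) : Fin.castAdd 2 i ≠ idx₂ n := by
  intro h; have := congrArg Fin.val h; simp [idx₂] at this; omega

theorem idx₁_ne_idx₂ : idx₁ n ≠ idx₂ n := by
  intro h; have := congrArg Fin.val h; simp [idx₁, idx₂] at this

theorem B_X (P : Matrix (Fin (n + 2)) (Fin (n + 2)) ℝ) (i j : Fin (n + 2)) :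
    B P (X i j) = (P i j - P j i) / 2 := by
  simp only [B, X, Matrix.mul_sub, Matrix.trace_sub, Matrix.trace_mul_single]
  simp
  ring

theorem B_sum_smul {ι : Type*} (s : Finset ι) (P : Matrix (Fin (n + 2)) (Fin (n + 2)) ℝ)
    (x : ι → ℝ) (Q : ι → Matrix (Fin (n + 2)) (Fin (n + 2)) ℝ) :
    B P (∑ i ∈ s, x i • Q i) = ∑ i ∈ s, x i * B P (Q i) := by
  simp only [B, Matrix.trace_sum, Matrix.mul_smul, Matrix.trace_smul,
    Finset.mul_sum, smul_eq_mul]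
  exact Finset.sum_congr rfl fun i _ => by ring

theorem p₁_apply (ξ : Fin n → ℝ) (i : Fin n) : p₁ ξ (Fin.castAdd 2 i) (idx₁ n) = ξ i ∧
    p₁ ξ (idx₁ n) (Fin.castAdd 2 i) = -ξ i := by
  constructor <;>
  simp [p₁, X, Matrix.sum_apply, Matrix.single_apply, (castAdd_ne_idx₁ _).symm, castAdd_ne_idx₁]

theorem p₂_apply (ξ : Fin n → ℝ) (i : Fin n) : p₂ ξ (Fin.castAdd 2 i) (idx₂ n) = ξ i ∧
    p₂ ξ (idx₂ n) (Fin.castAdd 2 i) = -ξ i := by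
  constructor <;>
  simp [p₂, X, Matrix.sum_apply, Matrix.single_apply, (castAdd_ne_idx₂ _).symm, castAdd_ne_idx₂]

theorem B_p₁ (ξ ξ' : Fin n → ℝ) : B (p₁ ξ) (p₁ ξ') = ∑ i, ξ i * ξ' i := by
  conv_lhs => rw [p₁.eq_def ξ']
  rw [B_sum_smul]
  refine Finset.sum_congr rfl fun i _ => ?_
  rw [B_X, (p₁_apply ξ i).1, (p₁_apply ξ i).2]; ring

theorem B_p₂ (ξ ξ' : Fin n → ℝ) : B (p₂ ξ) (p₂ ξ') = ∑ i, ξ i * ξ' i := by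
  conv_lhs => rw [p₂.eq_def ξ']
  rw [B_sum_smul]
  refine Finset.sum_congr rfl fun i _ => ?_
  rw [B_X, (p₂_apply ξ i).1, (p₂_apply ξ i).2]; ring

theorem B_p₃ (θ θ' : ℝ) : B (p₃ n θ) (p₃ n θ') = θ * θ' := by
  have := B_sum_smul ({()} : Finset Unit) (p₃ n θ) (fun _ => θ') fun _ => X (idx₁ n) (idx₂ n)
  simp only [Finset.sum_singleton] at this
  conv_lhs => rw [p₃.eq_def n θ']
  rw [this, B_X]
  simp [p₃, X, idx₁_ne_idx₂, idx₁_ne_idx₂.symm]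
  ring

theorem act_X_apply (i j : Fin (n + 2)) (v : CC (n + 2)) (k : Fin (n + 2)) :
    act (X i j) v k = (if k = i then v j else 0) - if k = j then v i else 0 := by
  simp only [act, X, Matrix.mulVec, dotProduct, Matrix.map_apply, Matrix.sub_apply,
    Matrix.single_apply, Complex.ofReal_sub, sub_mul, Finset.sum_sub_distrib]
  congr 1
  · by_cases h : k = i
    · subst h; simp [apply_ite]
    · simp [h, Ne.symm h]
  · by_cases h : k = j
    · subst h; simp [apply_ite]
    · simp [h, Ne.symm h]

theorem act_sum_smul_apply {ι : Type*} (s : Finset ι) (x : ι → ℝ)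
    (Q : ι → Matrix (Fin (n + 2)) (Fin (n + 2)) ℝ) (v : CC (n + 2)) (k : Fin (n + 2)) :
    act (∑ i ∈ s, x i • Q i) v k = ∑ i ∈ s, x i * act (Q i) v k := by
  simp only [act, Matrix.mulVec, dotProduct, Matrix.map_apply, Matrix.sum_apply, Matrix.smul_apply,
    Complex.ofReal_sum, Finset.sum_mul, Finset.mul_sum, smul_eq_mul, Complex.ofReal_mul]
  rw [Finset.sum_comm]
  exact Finset.sum_congr rfl fun i _ => Finset.sum_congr rfl fun j _ => by ring

theorem act_matrix_add (P Q : Matrix (Fin (n + 2)) (Fin (n + 2)) ℝ) (v : CC (n + 2)) :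
    act (P + Q) v = act P v + act Q v := by
  ext k
  simp [act, Matrix.mulVec, dotProduct, add_mul, Finset.sum_add_distrib]

theorem act_p₃_apply (θ : ℝ) (v : CC (n + 2)) (k : Fin (n + 2)) :
    act (p₃ n θ) v k = θ * act (X (idx₁ n) (idx₂ n)) v k := by
  have := act_sum_smul_apply ({()} : Finset Unit) (fun _ => θ) (fun _ => X (idx₁ n) (idx₂ n)) v k
  simpa [p₃] using this

theorem basePoint_apply (r : ℝ) : (∀ i : Fin n, basePoint n r (Fin.castAdd 2 i) = 0) ∧
    basePoint n r (idx₁ n) = Complex.I * Real.sinh r ∧ basePoint n r (idx₂ n) = Real.cosh r := by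
  refine ⟨fun i => ?_, ?_, ?_⟩ <;>
  simp [basePoint, castAdd_ne_idx₁, castAdd_ne_idx₂, idx₁_ne_idx₂, idx₁_ne_idx₂.symm]

/-- The derivative of `basePoint n r` with respect to `r`. -/
noncomputable def baseTangent (n : ℕ) (r : ℝ) : CC (n + 2) :=
  EuclideanSpace.single (idx₂ n) (Real.sinh r : ℂ)
    + EuclideanSpace.single (idx₁ n) (Complex.I * (Real.cosh r : ℂ))

theorem baseTangent_apply (r : ℝ) : (∀ i : Fin n, baseTangent n r (Fin.castAdd 2 i) = 0) ∧
    baseTangent n r (idx₁ n) = Complex.I * Real.cosh r ∧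
    baseTangent n r (idx₂ n) = Real.sinh r := by
  refine ⟨fun i => ?_, ?_, ?_⟩ <;>
  simp [baseTangent, castAdd_ne_idx₁, castAdd_ne_idx₂, idx₁_ne_idx₂, idx₁_ne_idx₂.symm]

theorem hasDerivAt_act_basePoint (A : Matrix (Fin (n + 2)) (Fin (n + 2)) ℝ) {r : ℝ → ℝ} {r' u : ℝ}
    (hr : HasDerivAt r r' u) :
    HasDerivAt (fun u => act A (basePoint n (r u))) (r' • act A (baseTangent n (r u))) u := by
  have e : ∀ x y : ℝ, EuclideanSpace.single (idx₂ n) (x : ℂ)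
      + EuclideanSpace.single (idx₁ n) (Complex.I * (y : ℂ))
      = x • EuclideanSpace.single (idx₂ n) (1 : ℂ)
        + y • EuclideanSpace.single (idx₁ n) Complex.I := fun x y => by
    ext i; simp [mul_comm]
  have e2 : ∀ x y : ℝ, act A (EuclideanSpace.single (idx₂ n) (x : ℂ)
      + EuclideanSpace.single (idx₁ n) (Complex.I * (y : ℂ)))
      = x • act A (EuclideanSpace.single (idx₂ n) (1 : ℂ))
        + y • act A (EuclideanSpace.single (idx₁ n) Complex.I) := fun x y => by
    rw [e, act_add, act_real_smul, act_real_smul]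
  unfold basePoint baseTangent
  simp only [e2]
  refine ((hr.cosh.smul_const _).add (hr.sinh.smul_const _)).congr_deriv ?_
  rw [smul_add, smul_smul, smul_smul, mul_comm r', mul_comm r']

/-- The tangent vector at `basePoint n r` with components `s` in the radial direction and
`p₁ ξ + p₂ ζ + p₃ θ` along the orbit. -/
noncomputable def frameVector (r s : ℝ) (ξ ζ : Fin n → ℝ) (θ : ℝ) : CC (n + 2) :=
  s • baseTangent n r + act (p₁ ξ + p₂ ζ + p₃ n θ) (basePoint n r)

theorem frameVector_apply (r s : ℝ) (ξ ζ : Fin n → ℝ) (θ : ℝ) :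
    (∀ i, frameVector r s ξ ζ θ (Fin.castAdd 2 i)
      = (Real.cosh r * ζ i : ℝ) + (Real.sinh r * ξ i : ℝ) * Complex.I) ∧
    frameVector r s ξ ζ θ (idx₁ n)
      = (Real.cosh r * θ : ℝ) + (Real.cosh r * s : ℝ) * Complex.I ∧
    frameVector r s ξ ζ θ (idx₂ n)
      = (Real.sinh r * s : ℝ) + (-(Real.sinh r * θ) : ℝ) * Complex.I := by
  obtain ⟨a1, a2, a3⟩ := basePoint_apply (n := n) r
  obtain ⟨b1, b2, b3⟩ := baseTangent_apply (n := n) r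
  have h1 : ∀ k, act (p₁ ξ) (basePoint n r) k = ∑ i, ξ i * act (X (Fin.castAdd 2 i) (idx₁ n))
    (basePoint n r) k := fun k => act_sum_smul_apply _ _ _ _ k
  have h2 : ∀ k, act (p₂ ζ) (basePoint n r) k = ∑ i, ζ i * act (X (Fin.castAdd 2 i) (idx₂ n))
    (basePoint n r) k := fun k => act_sum_smul_apply _ _ _ _ k
  refine ⟨fun i => ?_, ?_, ?_⟩ <;>
  simp only [frameVector, act_matrix_add, PiLp.add_apply, PiLp.smul_apply, h1, h2, act_p₃_apply,
    act_X_apply, a1, a2, a3, b1, b2, b3, castAdd_ne_idx₁, castAdd_ne_idx₂, idx₁_ne_idx₂,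
    idx₁_ne_idx₂.symm, (castAdd_ne_idx₁ _).symm, (castAdd_ne_idx₂ _).symm, if_true, if_false,
    (Fin.castAdd_injective n 2).eq_iff] <;>
  simp <;> ring

/-- The factor `ab` of `dr/du` cancels against `∂/∂t = (abc)⁻¹ ∂/∂u` and leaves `σ/c`. This is also
true for `c = 0`, where both quotients are zero by convention. -/
theorem pushFrame_eq {a b c r : ℝ → ℝ} {u : ℝ} (hr : HasDerivAt r (a u * b u) u)
    (ha : a u ≠ 0) (hb : b u ≠ 0) (A : Matrix (Fin (n + 2)) (Fin (n + 2)) ℝ)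
    (V : FrameVec n) :
    pushFrame a b c r u A V = act A (frameVector (r u) (V.σ / c u) V.ξ V.ζ V.θ) := by
  rw [pushFrame, (hasDerivAt_act_basePoint A hr).deriv, frameVector, act_add, act_mul,
    act_real_smul, smul_smul]
  congr 2
  rcases eq_or_ne (c u) 0 with h | h
  · simp [h]
  · field_simp

theorem ext_frame {v w : CC (n + 2)} (h : ∀ i : Fin n, v (Fin.castAdd 2 i) = w (Fin.castAdd 2 i))
    (h1 : v (idx₁ n) = w (idx₁ n)) (h2 : v (idx₂ n) = w (idx₂ n)) : v = w := by
  ext k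
  refine Fin.lastCases h2 (fun k => ?_) k
  exact Fin.lastCases h1 (fun k => h k) k

/-- Multiplication by `i` exchanges the real parts `cosh r · ζ` with the imaginary parts `sinh r ·
ξ`, up to sign. It therefore acts on `(ξ, ζ)` by the ratio `tanh r`, which has to be `a/b`. -/
theorem smul_I_frameVector {a b r s : ℝ} (hab : a * Real.cosh r = b * Real.sinh r) (ha : a ≠ 0)
    (hb : b ≠ 0) (ξ ζ : Fin n → ℝ) (θ : ℝ) :
    frameVector r θ (fun i => b / a * ζ i) (fun i => -(a / b) * ξ i) (-s)
      = Complex.I • frameVector r s ξ ζ θ := by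
  obtain ⟨a1, a2, a3⟩ := frameVector_apply r θ (fun i => b / a * ζ i) (fun i => -(a / b) * ξ i) (-s)
  obtain ⟨b1, b2, b3⟩ := frameVector_apply r s ξ ζ θ
  have h1 : Real.sinh r * (b / a) = Real.cosh r := by field_simp; linarith
  have h2 : Real.cosh r * (a / b) = Real.sinh r := by field_simp; linarith
  refine ext_frame (fun i => ?_) ?_ ?_
  · rw [PiLp.smul_apply, a1, b1, ← mul_assoc, ← mul_assoc, h1, mul_neg, h2]
    apply Complex.ext <;> simp [-Complex.ofReal_sinh, -Complex.ofReal_cosh]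
  · rw [PiLp.smul_apply, a2, b2]
    apply Complex.ext <;> simp [-Complex.ofReal_sinh, -Complex.ofReal_cosh]
  · rw [PiLp.smul_apply, a3, b3]
    apply Complex.ext <;> simp [-Complex.ofReal_sinh, -Complex.ofReal_cosh]

theorem inner_basePoint_frameVector (r s : ℝ) (ξ ζ : Fin n → ℝ) (θ : ℝ) :
    inner ℂ (basePoint n r) (frameVector r s ξ ζ θ)
      = ((Real.sinh (2 * r) * s : ℝ) : ℂ) + ((-(Real.sinh (2 * r) * θ) : ℝ) : ℂ) * Complex.I := by
  obtain ⟨b1, b2, b3⟩ := frameVector_apply r s ξ ζ θ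
  obtain ⟨a1, a2, a3⟩ := basePoint_apply (n := n) r
  rw [PiLp.inner_apply, sum_univ_frame]
  simp only [a1, a2, a3, b1, b2, b3, RCLike.inner_apply, Real.sinh_two_mul]
  apply Complex.ext <;> simp [-Complex.ofReal_sinh, -Complex.ofReal_cosh] <;> ring

theorem re_inner_frameVector (r s s' : ℝ) (ξ ζ ξ' ζ' : Fin n → ℝ) (θ θ' : ℝ) :
    (inner ℂ (frameVector r s ξ ζ θ) (frameVector r s' ξ' ζ' θ')).re
      = Real.sinh r ^ 2 * ∑ i, ξ i * ξ' i + Real.cosh r ^ 2 * ∑ i, ζ i * ζ' i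
        + Real.cosh (2 * r) * (s * s' + θ * θ') := by
  obtain ⟨b1, b2, b3⟩ := frameVector_apply r s ξ ζ θ
  obtain ⟨a1, a2, a3⟩ := frameVector_apply r s' ξ' ζ' θ'
  rw [PiLp.inner_apply, sum_univ_frame, Finset.mul_sum, Finset.mul_sum, ← Finset.sum_add_distrib]
  simp only [a1, a2, a3, b1, b2, b3, RCLike.inner_apply, Real.cosh_two_mul, Complex.add_re,
    Complex.re_sum]
  rw [add_assoc]
  congr 1
  · refine Finset.sum_congr rfl fun i _ => ?_
    simp [-Complex.ofReal_sinh, -Complex.ofReal_cosh]; ring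
  · simp [-Complex.ofReal_sinh, -Complex.ofReal_cosh]; ring

theorem frameVector_mem_quadricTangent (r s : ℝ) (ξ ζ : Fin n → ℝ) (θ : ℝ) :
    frameVector r s ξ ζ θ ∈ quadricTangent (basePoint n r) := by
  obtain ⟨b1, b2, b3⟩ := frameVector_apply r s ξ ζ θ
  obtain ⟨a1, a2, a3⟩ := basePoint_apply (n := n) r
  change ∑ i, _ = 0
  rw [sum_univ_frame]
  simp only [a1, a2, a3, b1, b2, b3]
  apply Complex.ext <;> simp [-Complex.ofReal_sinh, -Complex.ofReal_cosh] <;> ring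

theorem basePoint_mem_quadric (r : ℝ) : basePoint n r ∈ quadric n := by
  obtain ⟨a1, a2, a3⟩ := basePoint_apply (n := n) r
  change ∑ i, _ = 1
  rw [sum_univ_frame]
  simp only [a1, a2, a3, mul_pow, Complex.I_sq]
  have := Real.cosh_sq r
  rw [← Complex.ofReal_pow, ← Complex.ofReal_pow, this]
  simp

theorem norm_sq_basePoint (r : ℝ) : ‖basePoint n r‖ ^ 2 = Real.cosh (2 * r) := by
  obtain ⟨a1, a2, a3⟩ := basePoint_apply (n := n) r
  rw [EuclideanSpace.norm_sq_eq, sum_univ_frame, a2, a3, Real.cosh_two_mul]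
  simp [a1, -Complex.ofReal_sinh, -Complex.ofReal_cosh]
  ring

theorem cosh_two_mul_mem_shell {R : EReal} {r : ℝ} (h : ((|r| : ℝ) : EReal) < R) :
    Real.cosh (2 * r) ∈ shell R := by
  refine ⟨Real.one_le_cosh _, ?_⟩
  rw [← Real.cosh_abs, Real.arcosh_cosh (abs_nonneg _), abs_mul, abs_two,
    mul_div_cancel_left₀ _ two_ne_zero]
  exact h

/-- By invariance it suffices to evaluate the metric at `basePoint`. There `⟨z, V⟩` has only `σ` and
`θ` components, of size `sinh 2r`, so `G'` enters `c²` alone, while `a²` and `b²` come from the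
ambient Hermitian form. -/
theorem realizes_of_profile {η R : EReal} {a b c r G G' : ℝ → ℝ} {g : BilinField (n + 2)}
    (hne : ∀ u : ℝ, (u : EReal) < η → a u ≠ 0 ∧ b u ≠ 0 ∧ c u ≠ 0)
    (hr : ∀ u : ℝ, (u : EReal) < η → HasDerivAt r (a u * b u) u)
    (hr0 : Tendsto r atBot (𝓝 0))
    (hbij : Set.BijOn (fun u => |r u|) {u : ℝ | (u : EReal) < η}
      {s : ℝ | 0 < s ∧ (s : EReal) < R})
    (ha : ∀ u : ℝ, (u : EReal) < η → a u ^ 2 = 2 * G (Real.cosh (2 * r u)) * Real.sinh (r u) ^ 2)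
    (hb : ∀ u : ℝ, (u : EReal) < η → b u ^ 2 = 2 * G (Real.cosh (2 * r u)) * Real.cosh (r u) ^ 2)
    (hc : ∀ u : ℝ, (u : EReal) < η → c u ^ 2 = 2 * (Real.cosh (2 * r u) * G (Real.cosh (2 * r u))
      + (Real.cosh (2 * r u) ^ 2 - 1) * G' (Real.cosh (2 * r u))))
    (hab : ∀ u : ℝ, (u : EReal) < η → a u * Real.cosh (r u) = b u * Real.sinh (r u))
    (hg : EqOnTangent (tube n R) g (radialMetric (n + 2) G G')) :
    Realizes n η a b c r R g where
  ne_zero := hne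
  deriv_r := hr
  tendsto_r := hr0
  bijOn := hbij
  metric u hu A hA V W := by
    obtain ⟨hau, hbu, hcu⟩ := hne u hu
    rw [pushFrame_eq (hr u hu) hau hbu, pushFrame_eq (hr u hu) hau hbu]
    have hz : act A (basePoint n (r u)) ∈ tube n R := by
      refine mem_tube_iff.2 ⟨?_, ?_⟩
      · have := sum_act_mul_act hA (basePoint n (r u)) (basePoint n (r u))
        have h2 : ∑ i, basePoint n (r u) i ^ 2 = 1 := basePoint_mem_quadric (r u)
        simp only [sq] at h2
        change ∑ i, act A (basePoint n (r u)) i ^ 2 = 1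
        simp only [sq]
        rw [this, h2]
      · rw [norm_sq_act hA, norm_sq_basePoint]
        exact cosh_two_mul_mem_shell (hbij.mapsTo hu).2
    have ht : ∀ V : FrameVec n, act A (frameVector (r u) (V.σ / c u) V.ξ V.ζ V.θ)
        ∈ quadricTangent (act A (basePoint n (r u))) := fun V => by
      change ∑ i, _ = 0
      rw [sum_act_mul_act hA]
      exact frameVector_mem_quadricTangent _ _ _ _ _
    rw [hg _ hz _ (ht V) _ (ht W), radialMetric_apply, norm_sq_act hA, inner_act_act hA,
      inner_act_act hA, inner_act_act hA, inner_basePoint_frameVector,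
      inner_basePoint_frameVector, re_inner_frameVector, norm_sq_basePoint, cohomMetric, B_p₁,
      B_p₂, B_p₃, ha u hu, hb u hu]
    have e1 : V.σ * W.σ = c u ^ 2 * (V.σ / c u * (W.σ / c u)) := by field_simp
    have e2 := Real.cosh_sq (2 * r u)
    rw [e1, hc u hu, e2]
    simp [-Complex.ofReal_sinh, -Complex.ofReal_cosh]
    ring
  complexStructure u hu A _ V := by
    obtain ⟨hau, hbu, hcu⟩ := hne u hu
    rw [pushFrame_eq (hr u hu) hau hbu, pushFrame_eq (hr u hu) hau hbu, ← act_smul,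
      ← smul_I_frameVector (hab u hu) hau hbu]
    simp only [cohomJ]
    congr 2
    · field_simp
    · field_simp

end Frame

/-! ### Monotone functions and linear equations on `(-∞, η)`. -/

section HalfLine

/-- The interval `(-∞, η)` in `ℝ`. -/
def below (η : EReal) : Set ℝ := {u : ℝ | (u : EReal) < η}

variable {η : EReal}

theorem isOpen_below : IsOpen (below η) :=
  isOpen_Iio.preimage continuous_coe_real_ereal

theorem mem_below_of_le {u v : ℝ} (hv : v ∈ below η) (h : u ≤ v) : u ∈ below η :=
  (EReal.coe_le_coe_iff.2 h).trans_lt hv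

theorem ordConnected_below : (below η).OrdConnected :=
  ⟨fun _ _ _ hy _ hz => mem_below_of_le hy hz.2⟩

theorem convex_below : Convex ℝ (below η) := ordConnected_below.convex

theorem below_nonempty (h : ⊥ < η) : (below η).Nonempty := by
  induction η with
  | bot => exact absurd h (lt_irrefl _)
  | coe x => exact ⟨x - 1, EReal.coe_lt_coe_iff.2 (by linarith)⟩
  | top => exact ⟨0, EReal.coe_lt_top 0⟩

theorem exists_gt_mem_below {u : ℝ} (hu : u ∈ below η) : ∃ v ∈ below η, u < v := by
  obtain ⟨v, h1, h2⟩ := EReal.lt_iff_exists_real_btwn.1 hu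
  exact ⟨v, h2, EReal.coe_lt_coe_iff.1 h1⟩

theorem eventually_mem_below (h : ⊥ < η) : ∀ᶠ u in atBot, u ∈ below η := by
  obtain ⟨v, hv⟩ := below_nonempty h
  filter_upwards [eventually_le_atBot v] with u hu using mem_below_of_le hv hu

theorem monotoneOn_below {f f' : ℝ → ℝ} (hf : ∀ u ∈ below η, HasDerivAt f (f' u) u)
    (h : ∀ u ∈ below η, 0 ≤ f' u) : MonotoneOn f (below η) :=
  monotoneOn_of_hasDerivWithinAt_nonneg convex_below
    (fun u hu => (hf u hu).continuousAt.continuousWithinAt)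
    (fun u hu => (hf u (interior_subset hu)).hasDerivWithinAt) fun u hu => h u (interior_subset hu)

theorem le_of_tendsto_atBot {f f' : ℝ → ℝ} {y : ℝ}
    (hf : ∀ u ∈ below η, HasDerivAt f (f' u) u)
    (h : ∀ u ∈ below η, 0 ≤ f' u) (hy : Tendsto f atBot (𝓝 y)) {u : ℝ} (hu : u ∈ below η) :
    y ≤ f u := by
  refine le_of_tendsto hy ?_
  filter_upwards [eventually_le_atBot u] with v hv
  exact monotoneOn_below hf h (mem_below_of_le hu hv) hu hv

theorem eq_of_hasDerivAt_zero {f : ℝ → ℝ} (hf : ∀ u ∈ below η, HasDerivAt f 0 u) {u v : ℝ}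
    (hu : u ∈ below η) (hv : v ∈ below η) : f u = f v :=
  isOpen_below.is_const_of_deriv_eq_zero ordConnected_below.isPreconnected
    (fun w hw => (hf w hw).differentiableAt.differentiableWithinAt)
    (fun w hw => (hf w hw).deriv) hu hv

/-- A solution of a homogeneous linear equation is a multiple of an exponential. -/
theorem eq_mul_exp_of_linear {y q : ℝ → ℝ} (hq : ContinuousOn q (below η))
    (hy : ∀ u ∈ below η, HasDerivAt y (y u * q u) u) {u₀ u : ℝ} (hu₀ : u₀ ∈ below η)
    (hu : u ∈ below η) : ∃ E, 0 < E ∧ y u = y u₀ * E := by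
  have hI : ∀ v ∈ below η, HasDerivAt (fun v => ∫ x in u₀..v, q x) (q v) v := fun v hv =>
    intervalIntegral.integral_hasDerivAt_right
      (hq.mono (ordConnected_below.uIcc_subset hu₀ hv)).intervalIntegrable
      (hq.stronglyMeasurableAtFilter isOpen_below v hv)
      (hq.continuousAt (isOpen_below.mem_nhds hv))
  have h := eq_of_hasDerivAt_zero (f := fun v => y v * Real.exp (-∫ x in u₀..v, q x))
    (fun v hv => ((hy v hv).mul (hI v hv).neg.exp).congr_deriv (by ring)) hu hu₀
  simp only [intervalIntegral.integral_same, neg_zero, Real.exp_zero, mul_one] at h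
  refine ⟨Real.exp (∫ x in u₀..u, q x), Real.exp_pos _, ?_⟩
  rw [← h, mul_assoc, ← Real.exp_add, neg_add_cancel, Real.exp_zero, mul_one]

theorem ne_zero_of_linear {y q : ℝ → ℝ} {K : ℝ} (hη : ⊥ < η) (hq : ContinuousOn q (below η))
    (hy : ∀ u ∈ below η, HasDerivAt y (y u * q u) u) (hK : K ≠ 0) (hl : Tendsto y atBot (𝓝 K))
    {u : ℝ} (hu : u ∈ below η) : y u ≠ 0 := by
  obtain ⟨u₀, h1, h2⟩ := ((hl.eventually_ne hK).and (eventually_mem_below hη)).exists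
  obtain ⟨E, hE, e⟩ := eq_mul_exp_of_linear hq hy h2 hu
  rw [e]
  exact mul_ne_zero h1 hE.ne'

theorem pos_of_linear {y q : ℝ → ℝ} {K : ℝ} (hη : ⊥ < η) (hq : ContinuousOn q (below η))
    (hy : ∀ u ∈ below η, HasDerivAt y (y u * q u) u) (hK : 0 < K) (hl : Tendsto y atBot (𝓝 K))
    {u : ℝ} (hu : u ∈ below η) : 0 < y u := by
  obtain ⟨u₀, h1, h2⟩ := ((hl.eventually_const_lt hK).and (eventually_mem_below hη)).exists
  obtain ⟨E, hE, e⟩ := eq_mul_exp_of_linear hq hy h2 hu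
  rw [e]
  exact mul_pos h1 hE

end HalfLine

/-! ### Differentiable inverses on an open interval. -/

section Inverse

theorem image_mem_nhds_of_deriv_pos {f f' : ℝ → ℝ} {I : Set ℝ} (hI : IsOpen I)
    (hf : ∀ x ∈ I, HasDerivAt f (f' x) x) (hmono : StrictMonoOn f I) {x : ℝ} (hx : x ∈ I) :
    f '' I ∈ 𝓝 (f x) := by
  obtain ⟨ε, hε, hball⟩ := Metric.isOpen_iff.1 hI x hx
  have hsub : Set.Icc (x - ε / 2) (x + ε / 2) ⊆ I := fun y hy => hball (by
    rw [Metric.mem_ball, Real.dist_eq, abs_lt]; constructor <;> linarith [hy.1, hy.2])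
  have h1 := hmono (hsub ⟨le_rfl, by linarith⟩) hx (by linarith : x - ε / 2 < x)
  have h2 := hmono hx (hsub ⟨by linarith, le_rfl⟩) (by linarith : x < x + ε / 2)
  refine mem_of_superset (Icc_mem_nhds h1 h2) ?_
  refine (intermediate_value_Icc (by linarith) fun y hy =>
    (hf y (hsub hy)).continuousAt.continuousWithinAt).trans (Set.image_mono hsub)

/-- The inverse of a function with positive derivative on an open interval. -/
theorem exists_inverse_of_deriv_pos {f f' : ℝ → ℝ} {I : Set ℝ} (hI : IsOpen I)
    (hI' : Convex ℝ I) (hf : ∀ x ∈ I, HasDerivAt f (f' x) x) (hpos : ∀ x ∈ I, 0 < f' x) :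
    StrictMonoOn f I ∧ ∃ g : ℝ → ℝ, (∀ x ∈ I, g (f x) = x) ∧
      ∀ x ∈ I, HasDerivAt g (f' x)⁻¹ (f x) := by
  have hmono : StrictMonoOn f I := strictMonoOn_of_hasDerivWithinAt_pos hI'
    (fun x hx => (hf x hx).continuousAt.continuousWithinAt)
    (fun x hx => (hf x (interior_subset hx)).hasDerivWithinAt)
    fun x hx => hpos x (interior_subset hx)
  refine ⟨hmono, Function.invFunOn f I, ?_⟩
  have hinv : ∀ x ∈ I, Function.invFunOn f I (f x) = x := fun x hx =>
    hmono.injOn (Function.invFunOn_mem ⟨x, hx, rfl⟩) hx (Function.invFunOn_eq ⟨x, hx, rfl⟩)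
  refine ⟨hinv, fun x hx => ?_⟩
  have himg := image_mem_nhds_of_deriv_pos hI hf hmono hx
  have hg : StrictMonoOn (Function.invFunOn f I) (f '' I) := by
    rintro _ ⟨y, hy, rfl⟩ _ ⟨z, hz, rfl⟩ h
    rw [hinv y hy, hinv z hz]
    exact (hmono.lt_iff_lt hy hz).1 h
  have hc : ContinuousAt (Function.invFunOn f I) (f x) := by
    refine hg.continuousAt_of_image_mem_nhds himg ?_
    rw [hinv x hx]
    refine mem_of_superset (hI.mem_nhds hx) fun y hy => ⟨f y, ⟨y, hy, rfl⟩, hinv y hy⟩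
  have hd : HasDerivAt f (f' x) (Function.invFunOn f I (f x)) := by rw [hinv x hx]; exact hf x hx
  refine HasDerivAt.of_local_left_inverse hc hd (hpos x hx).ne' ?_
  filter_upwards [himg] with y hy
  obtain ⟨z, hz, rfl⟩ := hy
  rw [hinv z hz]

end Inverse

/-! ### Prolongation of bounded solutions. -/

section Continuation

theorem exists_tendsto_of_deriv_bounded {f f' : ℝ → ℝ} {u₀ e M : ℝ} (h : u₀ < e)
    (hf : ∀ u ∈ Set.Ico u₀ e, HasDerivAt f (f' u) u) (hM : ∀ u ∈ Set.Ico u₀ e, |f' u| ≤ M) :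
    ∃ y, Tendsto f (𝓝[<] e) (𝓝 y) := by
  have hM0 : 0 ≤ M := (abs_nonneg _).trans (hM u₀ ⟨le_rfl, h⟩)
  have hL : LipschitzOnWith ⟨M, hM0⟩ f (Set.Ico u₀ e) :=
    (convex_Ico u₀ e).lipschitzOnWith_of_nnnorm_hasDerivWithin_le
      (fun u hu => (hf u hu).hasDerivWithinAt) fun u hu => hM u hu
  obtain ⟨g, hg, he⟩ := hL.extend_real
  refine ⟨g e, ((hg.continuous.tendsto e).mono_left nhdsWithin_le_nhds).congr' ?_⟩
  filter_upwards [Ico_mem_nhdsLT h] with u hu using (he hu).symm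

/-- The left derivative at `e` is the limit of the derivatives of `f`, the right one is that of `g`.
-/
theorem hasDerivAt_glue {f g f' : ℝ → ℝ} {e p u₀ : ℝ} {v : ℝ} (h : u₀ < e)
    (hf : ∀ u ∈ Set.Ico u₀ e, HasDerivAt f (f' u) u)
    (hl : Tendsto f (𝓝[<] e) (𝓝 p)) (hl' : Tendsto f' (𝓝[<] e) (𝓝 v)) (hg : HasDerivAt g v e)
    (hge : g e = p) : HasDerivAt (fun u => if u < e then f u else g u) v e := by
  have hlt : ∀ u < e, (fun u => if u < e then f u else g u) =ᶠ[𝓝 u] f := fun u hu => by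
    filter_upwards [Iio_mem_nhds hu] with w hw using if_pos hw
  have hd : ∀ u ∈ Set.Ioo u₀ e, HasDerivAt (fun u => if u < e then f u else g u) (f' u) u :=
    fun u hu => (hf u ⟨hu.1.le, hu.2⟩).congr_of_eventuallyEq (hlt u hu.2)
  have h1 : HasDerivWithinAt (fun u => if u < e then f u else g u) v (Set.Iic e) e := by
    refine hasDerivWithinAt_Iic_of_tendsto_deriv (s := Set.Ioo u₀ e)
      (fun u hu => (hd u hu).differentiableAt.differentiableWithinAt) ?_ (Ioo_mem_nhdsLT h) ?_
    · have : Tendsto f (𝓝[Set.Ioo u₀ e] e) (𝓝 (if e < e then f e else g e)) := by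
        rw [if_neg (lt_irrefl e), hge]
        exact hl.mono_left (nhdsWithin_mono e fun u hu => hu.2)
      refine this.congr' ?_
      filter_upwards [self_mem_nhdsWithin] with u hu using (if_pos hu.2).symm
    · refine hl'.congr' ?_
      filter_upwards [Ioo_mem_nhdsLT h] with u hu using (hd u hu).deriv.symm
  have h2 : HasDerivWithinAt (fun u => if u < e then f u else g u) v (Set.Ici e) e := by
    refine hg.hasDerivWithinAt.congr (fun u hu => ?_) ?_
    · rw [if_neg (not_lt.2 hu)]
    · rw [if_neg (lt_irrefl e)]
  have := h1.union h2
  rwa [Set.Iic_union_Ici, hasDerivWithinAt_univ] at this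

/-- The right hand side of the system. -/
noncomputable def systemField (n : ℕ) (Λ : ℝ) (p : ℝ × ℝ × ℝ) : ℝ × ℝ × ℝ :=
  (1 / 2 * p.1 * (p.2.1 ^ 2 + p.2.2 ^ 2 - p.1 ^ 2),
    1 / 2 * p.2.1 * (p.2.2 ^ 2 + p.1 ^ 2 - p.2.1 ^ 2),
    1 / 2 * n * p.2.2 * (p.1 ^ 2 + p.2.1 ^ 2 - p.2.2 ^ 2 - 2 * Λ / n * p.1 ^ 2 * p.2.1 ^ 2))

theorem contDiff_systemField (n : ℕ) (Λ : ℝ) : ContDiff ℝ 1 (systemField n Λ) := by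
  unfold systemField
  fun_prop

/-- A solution on a maximal interval which ends at a finite time is unbounded. -/
theorem StenzelTube.IsUnstableCurve.not_bounded {n : ℕ} {Λ K L e u₀ M : ℝ} {a b c : ℝ → ℝ}
    (h : IsUnstableCurve n Λ K L (e : EReal) a b c) (hu₀ : u₀ < e)
    (hM : ∀ u ∈ Set.Ico u₀ e, |a u| ≤ M ∧ |b u| ≤ M ∧ |c u| ≤ M) : False := by
  have hsol : ∀ u < e, HasDerivAt (fun u => (a u, b u, c u)) (systemField n Λ (a u, b u, c u)) u :=
    fun u hu => by
      obtain ⟨h1, h2, h3⟩ := h.solution u (EReal.coe_lt_coe_iff.2 hu)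
      exact h1.prodMk (h2.prodMk h3)
  have hcont := (contDiff_systemField n Λ).continuous
  obtain ⟨B, hB⟩ := ((isCompact_closedBall (0 : ℝ × ℝ × ℝ) M).image hcont).isBounded.exists_norm_le
  have hbd : ∀ u ∈ Set.Ico u₀ e, ‖systemField n Λ (a u, b u, c u)‖ ≤ B := fun u hu =>
    hB _ ⟨_, by
      obtain ⟨h1, h2, h3⟩ := hM u hu
      simpa [Prod.norm_def] using ⟨h1, h2, h3⟩, rfl⟩
  have hsol' := fun u (hu : u < e) => h.solution u (EReal.coe_lt_coe_iff.2 hu)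
  -- A bounded solution has bounded derivative, hence a limit at `e`. The local existence theorem
  -- restarts the flow from this limit, and the glued solution contradicts maximality.
  obtain ⟨pa, ha⟩ := exists_tendsto_of_deriv_bounded hu₀ (fun u hu => (hsol' u hu.2).1)
    fun u hu => (norm_fst_le (systemField n Λ (a u, b u, c u))).trans (hbd u hu)
  obtain ⟨pb, hb⟩ := exists_tendsto_of_deriv_bounded hu₀ (fun u hu => (hsol' u hu.2).2.1)
    fun u hu => ((norm_fst_le _).trans (norm_snd_le (systemField n Λ (a u, b u, c u)))).trans
      (hbd u hu)
  obtain ⟨pc, hc⟩ := exists_tendsto_of_deriv_bounded hu₀ (fun u hu => (hsol' u hu.2).2.2)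
    fun u hu => ((norm_snd_le _).trans (norm_snd_le (systemField n Λ (a u, b u, c u)))).trans
      (hbd u hu)
  obtain ⟨α, hα0, ε, hε, hα⟩ :=
    (contDiff_systemField n Λ).contDiffAt.exists_forall_mem_closedBall_exists_eq_forall_mem_Ioo_hasDerivAt₀
      (x₀ := (pa, pb, pc)) e
  have hp := ha.prodMk_nhds (hb.prodMk_nhds hc)
  have hv := (hcont.tendsto (pa, pb, pc)).comp hp
  have hv1 : Tendsto (fun u => systemField n Λ (a u, b u, c u)) (𝓝[<] e)
    (𝓝 (systemField n Λ (pa, pb, pc))) := hv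
  have hαe := hα e ⟨by linarith, by linarith⟩
  rw [hα0] at hαe
  have hα1 : ∀ u ∈ Set.Ioo (e - ε) (e + ε),
      HasDerivAt (fun u => (α u).1) (systemField n Λ (α u)).1 u := fun u hu =>
    ((ContinuousLinearMap.fst ℝ ℝ (ℝ × ℝ)).hasFDerivAt.comp_hasDerivAt u (hα u hu))
  have hα2 : ∀ u ∈ Set.Ioo (e - ε) (e + ε),
      HasDerivAt (fun u => (α u).2) (systemField n Λ (α u)).2 u := fun u hu =>
    ((ContinuousLinearMap.snd ℝ ℝ (ℝ × ℝ)).hasFDerivAt.comp_hasDerivAt u (hα u hu))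
  have hα21 : ∀ u ∈ Set.Ioo (e - ε) (e + ε),
      HasDerivAt (fun u => (α u).2.1) (systemField n Λ (α u)).2.1 u := fun u hu =>
    ((ContinuousLinearMap.fst ℝ ℝ ℝ).hasFDerivAt.comp_hasDerivAt u (hα2 u hu))
  have hα22 : ∀ u ∈ Set.Ioo (e - ε) (e + ε),
      HasDerivAt (fun u => (α u).2.2) (systemField n Λ (α u)).2.2 u := fun u hu =>
    ((ContinuousLinearMap.snd ℝ ℝ ℝ).hasFDerivAt.comp_hasDerivAt u (hα2 u hu))
  have hmem : e ∈ Set.Ioo (e - ε) (e + ε) := ⟨by linarith, by linarith⟩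
  have hext : IsSolution n Λ ((e + ε : ℝ) : EReal) (fun u => if u < e then a u else (α u).1)
      (fun u => if u < e then b u else (α u).2.1) (fun u => if u < e then c u else (α u).2.2) := by
    intro u hu
    have hu' := EReal.coe_lt_coe_iff.1 hu
    rcases lt_trichotomy u e with hlt | heq | hgt
    · have hev : ∀ f g : ℝ → ℝ, (fun u => if u < e then f u else g u) =ᶠ[𝓝 u] f := fun f g => by
        filter_upwards [Iio_mem_nhds hlt] with w hw using if_pos hw
      obtain ⟨h1, h2, h3⟩ := hsol' u hlt
      simp only [if_pos hlt]
      exact ⟨h1.congr_of_eventuallyEq (hev _ _), h2.congr_of_eventuallyEq (hev _ _),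
        h3.congr_of_eventuallyEq (hev _ _)⟩
    · subst heq
      have e1 := hα1 u hmem
      have e2 := hα21 u hmem
      have e3 := hα22 u hmem
      simp only [lt_irrefl, if_false]
      rw [hα0] at e1 e2 e3 ⊢
      exact ⟨hasDerivAt_glue hu₀ (fun v hv => (hsol' v hv.2).1) ha hv1.fst_nhds e1 (by rw [hα0]),
        hasDerivAt_glue hu₀ (fun v hv => (hsol' v hv.2).2.1) hb hv1.snd_nhds.fst_nhds e2
          (by rw [hα0]),
        hasDerivAt_glue hu₀ (fun v hv => (hsol' v hv.2).2.2) hc hv1.snd_nhds.snd_nhds e3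
          (by rw [hα0])⟩
    · have hev : ∀ f g : ℝ → ℝ, (fun u => if u < e then f u else g u) =ᶠ[𝓝 u] g := fun f g => by
        filter_upwards [Ioi_mem_nhds hgt] with w hw using if_neg (not_lt.2 (le_of_lt hw))
      have hu2 : u ∈ Set.Ioo (e - ε) (e + ε) := ⟨by linarith, hu'⟩
      simp only [if_neg (not_lt.2 hgt.le)]
      exact ⟨(hα1 u hu2).congr_of_eventuallyEq (hev _ _),
        (hα21 u hu2).congr_of_eventuallyEq (hev _ _), (hα22 u hu2).congr_of_eventuallyEq (hev _ _)⟩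
  have := h.maximal _ _ _ _ (EReal.coe_le_coe_iff.2 (by linarith)) hext fun u hu => by
    simp [EReal.coe_lt_coe_iff.1 hu]
  have := EReal.coe_eq_coe_iff.1 this
  linarith

end Continuation

/-! ### Signs along an unstable curve and the coordinates `r`, `τ`. -/

section CurveData

/-- The properties of the unstable curves from which their metrics are constructed. -/
structure IsPosCurve (n : ℕ) (Λ K : ℝ) (η : EReal) (a b c : ℝ → ℝ) : Prop where
  n_pos : 1 ≤ n
  K_ne : K ≠ 0
  bot_lt : ⊥ < η
  solution : IsSolution n Λ η a b c
  tendsto_a : Tendsto a atBot (𝓝 0)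
  tendsto_b : Tendsto b atBot (𝓝 K)
  tendsto_sq_c : Tendsto (fun u => c u ^ 2) atBot (𝓝 (K ^ 2))
  ne_zero : ∀ u ∈ below η, a u ≠ 0 ∧ b u ≠ 0 ∧ c u ≠ 0
  gap_pos : ∀ u ∈ below η, 0 < b u ^ 2 - a u ^ 2

variable {n : ℕ} {Λ K L : ℝ} {η : EReal} {a b c : ℝ → ℝ}

namespace StenzelTube.IsSolution

theorem hasDerivAt_sq_a (h : IsSolution n Λ η a b c) {u : ℝ} (hu : u ∈ below η) :
    HasDerivAt (fun u => a u ^ 2) (a u ^ 2 * (b u ^ 2 + c u ^ 2 - a u ^ 2)) u :=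
  ((h u hu).1.fun_pow 2).congr_deriv (by push_cast; ring)

theorem hasDerivAt_sq_b (h : IsSolution n Λ η a b c) {u : ℝ} (hu : u ∈ below η) :
    HasDerivAt (fun u => b u ^ 2) (b u ^ 2 * (c u ^ 2 + a u ^ 2 - b u ^ 2)) u :=
  ((h u hu).2.1.fun_pow 2).congr_deriv (by push_cast; ring)

theorem hasDerivAt_sq_c (h : IsSolution n Λ η a b c) (hn : 1 ≤ n) {u : ℝ} (hu : u ∈ below η) :
    HasDerivAt (fun u => c u ^ 2)
      (c u ^ 2 * (n * (a u ^ 2 + b u ^ 2 - c u ^ 2) - 2 * Λ * (a u ^ 2 * b u ^ 2))) u := by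
  have : (n : ℝ) ≠ 0 := by positivity
  exact ((h u hu).2.2.fun_pow 2).congr_deriv (by push_cast; field_simp)

theorem hasDerivAt_gap (h : IsSolution n Λ η a b c) {u : ℝ} (hu : u ∈ below η) :
    HasDerivAt (fun u => b u ^ 2 - a u ^ 2)
      ((b u ^ 2 - a u ^ 2) * (c u ^ 2 - a u ^ 2 - b u ^ 2)) u :=
  ((h.hasDerivAt_sq_b hu).sub (h.hasDerivAt_sq_a hu)).congr_deriv (by ring)

theorem continuousOn (h : IsSolution n Λ η a b c) :
    ContinuousOn a (below η) ∧ ContinuousOn b (below η) ∧ ContinuousOn c (below η) :=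
  ⟨fun u hu => (h u hu).1.continuousAt.continuousWithinAt,
    fun u hu => (h u hu).2.1.continuousAt.continuousWithinAt,
    fun u hu => (h u hu).2.2.continuousAt.continuousWithinAt⟩

end StenzelTube.IsSolution

theorem eq_of_tendsto_of_hasDerivAt_zero {f : ℝ → ℝ} {y : ℝ} (hη : ⊥ < η)
    (hf : ∀ u ∈ below η, HasDerivAt f 0 u) (hy : Tendsto f atBot (𝓝 y)) {u : ℝ}
    (hu : u ∈ below η) : f u = y := by
  refine tendsto_nhds_unique (Tendsto.congr' ?_ tendsto_const_nhds) hy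
  filter_upwards [eventually_mem_below hη] with v hv using eq_of_hasDerivAt_zero hf hu hv

/-- If `a` vanishes once, it vanishes identically, being a solution of a linear equation. Then
`-(c²-b²)²` is nondecreasing with limit `0` at `-∞`, so `c² = b²` and the curve would be constant.
-/
theorem StenzelTube.IsUnstableCurve.a_ne_zero (h : IsUnstableCurve n Λ K L η a b c)
    (hn : 1 ≤ n) (hL : L ^ 2 = K ^ 2) {u : ℝ} (hu : u ∈ below η) : a u ≠ 0 := by
  obtain ⟨ca, cb, cc⟩ := h.solution.continuousOn
  intro h0
  have ha : ∀ v ∈ below η, a v = 0 := fun v hv => by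
    obtain ⟨E, -, e⟩ := eq_mul_exp_of_linear (y := a)
      (q := fun u => 1 / 2 * (b u ^ 2 + c u ^ 2 - a u ^ 2)) (by fun_prop)
      (fun u hu => (h.solution u hu).1.congr_deriv (by ring)) hu hv
    rw [e, h0, zero_mul]
  have hd : ∀ v ∈ below η, HasDerivAt (fun v => -(c v ^ 2 - b v ^ 2) ^ 2)
      (2 * (n * c v ^ 2 + b v ^ 2) * (c v ^ 2 - b v ^ 2) ^ 2) v := fun v hv => by
    refine ((((h.solution.hasDerivAt_sq_c hn hv).sub
      (h.solution.hasDerivAt_sq_b hv)).fun_pow 2).neg).congr_deriv ?_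
    rw [ha v hv]
    push_cast
    simp only [Pi.sub_apply]
    ring
  have hlim : Tendsto (fun v => -(c v ^ 2 - b v ^ 2) ^ 2) atBot (𝓝 0) := by
    have := (((h.tendsto_c.pow 2).sub (h.tendsto_b.pow 2)).pow 2).neg
    rwa [hL, sub_self, zero_pow two_ne_zero, neg_zero] at this
  have heq : ∀ v ∈ below η, c v ^ 2 - b v ^ 2 = 0 := fun v hv => by
    have := le_of_tendsto_atBot hd (fun v _ => by positivity) hlim hv
    nlinarith [sq_nonneg (c v ^ 2 - b v ^ 2)]
  refine h.nonconstant fun v hv => ⟨ha v hv, ?_, ?_⟩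
  · refine eq_of_tendsto_of_hasDerivAt_zero h.bot_lt (fun w hw => ?_) h.tendsto_b hv
    refine (h.solution w hw).2.1.congr_deriv ?_
    rw [ha w hw]
    linear_combination 1 / 2 * b w * heq w hw
  · refine eq_of_tendsto_of_hasDerivAt_zero h.bot_lt (fun w hw => ?_) h.tendsto_c hv
    refine (h.solution w hw).2.2.congr_deriv ?_
    rw [ha w hw]
    linear_combination -1 / 2 * n * c w * heq w hw

/-- Each of `b`, `c` and `b² - a²` solves a homogeneous linear equation with continuous coefficient
and has a nonzero limit at `-∞`, so none of them can vanish. -/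
theorem StenzelTube.IsUnstableCurve.isPosCurve (h : IsUnstableCurve n Λ K L η a b c)
    (hn : 1 ≤ n) (hK : K ≠ 0) (hL : L = K ∨ L = -K) : IsPosCurve n Λ K η a b c := by
  obtain ⟨ca, cb, cc⟩ := h.solution.continuousOn
  have hL2 : L ^ 2 = K ^ 2 := sq_eq_sq_iff_eq_or_eq_neg.2 hL
  have hL0 : L ≠ 0 := fun h0 => hK (by simpa [h0] using hL2.symm)
  refine ⟨hn, hK, h.bot_lt, h.solution, h.tendsto_a, h.tendsto_b, hL2 ▸ h.tendsto_c.pow 2,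
    fun u hu => ⟨h.a_ne_zero hn hL2 hu, ?_, ?_⟩, fun u hu => ?_⟩
  · exact ne_zero_of_linear (q := fun u => 1 / 2 * (c u ^ 2 + a u ^ 2 - b u ^ 2)) h.bot_lt
      (by fun_prop) (fun u hu => (h.solution u hu).2.1.congr_deriv (by ring)) hK h.tendsto_b hu
  · exact ne_zero_of_linear (q := fun u => 1 / 2 * n *
      (a u ^ 2 + b u ^ 2 - c u ^ 2 - 2 * Λ / n * a u ^ 2 * b u ^ 2)) h.bot_lt
      (by fun_prop) (fun u hu => (h.solution u hu).2.2.congr_deriv (by ring)) hL0 h.tendsto_c hu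
  · refine pos_of_linear (y := fun u => b u ^ 2 - a u ^ 2)
      (q := fun u => c u ^ 2 - a u ^ 2 - b u ^ 2) h.bot_lt
      (by fun_prop) (fun u hu => h.solution.hasDerivAt_gap hu) (by positivity : 0 < K ^ 2) ?_ hu
    simpa using (h.tendsto_b.pow 2).sub (h.tendsto_a.pow 2)

/-- `cosh (2 r)` along a curve. -/
noncomputable def curveTau (a b : ℝ → ℝ) (u : ℝ) : ℝ :=
  (a u ^ 2 + b u ^ 2) / (b u ^ 2 - a u ^ 2)

/-- The function `r` with `dr = ab du` along a curve. -/
noncomputable def curveRad (a b : ℝ → ℝ) (u : ℝ) : ℝ :=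
  1 / 2 * Real.log ((b u + a u) / (b u - a u))

/-- The radius of the tube covered by a curve. -/
noncomputable def curveRadius (η : EReal) (a b : ℝ → ℝ) : EReal :=
  ⨆ u ∈ below η, ((|curveRad a b u| : ℝ) : EReal)

namespace IsPosCurve

theorem sub_ne_zero (h : IsPosCurve n Λ K η a b c) {u : ℝ} (hu : u ∈ below η) :
    b u - a u ≠ 0 := fun e => by
  have := h.gap_pos u hu
  rw [sq_sub_sq, e, mul_zero] at this
  exact lt_irrefl _ this

theorem add_ne_zero (h : IsPosCurve n Λ K η a b c) {u : ℝ} (hu : u ∈ below η) :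
    b u + a u ≠ 0 := fun e => by
  have := h.gap_pos u hu
  rw [sq_sub_sq, e, zero_mul] at this
  exact lt_irrefl _ this

theorem div_pos (h : IsPosCurve n Λ K η a b c) {u : ℝ} (hu : u ∈ below η) :
    0 < (b u + a u) / (b u - a u) := by
  have h1 := h.gap_pos u hu
  have h2 := h.sub_ne_zero hu
  rw [show (b u + a u) / (b u - a u) = (b u ^ 2 - a u ^ 2) / (b u - a u) ^ 2 by
    field_simp; ring]
  positivity

theorem exp_two_mul_rad (h : IsPosCurve n Λ K η a b c) {u : ℝ} (hu : u ∈ below η) :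
    Real.exp (2 * curveRad a b u) = (b u + a u) / (b u - a u) := by
  rw [curveRad, ← mul_assoc, show (2 : ℝ) * (1 / 2) = 1 by norm_num, one_mul,
    Real.exp_log (h.div_pos hu)]

theorem cosh_two_mul_rad (h : IsPosCurve n Λ K η a b c) {u : ℝ} (hu : u ∈ below η) :
    Real.cosh (2 * curveRad a b u) = curveTau a b u := by
  have h1 := h.sub_ne_zero hu
  have h2 := h.add_ne_zero hu
  have h3 := (h.gap_pos u hu).ne'
  rw [Real.cosh_eq, Real.exp_neg, h.exp_two_mul_rad hu, curveTau]
  have h4 : b u ^ 2 - a u ^ 2 = (b u + a u) * (b u - a u) := sq_sub_sq _ _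
  rw [h4]
  field_simp
  ring

theorem a_mul_cosh (h : IsPosCurve n Λ K η a b c) {u : ℝ} (hu : u ∈ below η) :
    a u * Real.cosh (curveRad a b u) = b u * Real.sinh (curveRad a b u) := by
  have h1 := h.exp_two_mul_rad hu
  have h2 := h.sub_ne_zero hu
  rw [two_mul, Real.exp_add, eq_div_iff h2] at h1
  have h3 : Real.exp (curveRad a b u) * Real.exp (-curveRad a b u) = 1 := by
    rw [← Real.exp_add, add_neg_cancel, Real.exp_zero]
  rw [Real.cosh_eq, Real.sinh_eq]
  have h4 := (Real.exp_pos (curveRad a b u)).ne'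
  apply mul_left_cancel₀ h4
  linear_combination -h1 / 2 + (a u + b u) / 2 * h3

theorem hasDerivAt_rad (h : IsPosCurve n Λ K η a b c) {u : ℝ} (hu : u ∈ below η) :
    HasDerivAt (curveRad a b) (a u * b u) u := by
  have h1 := h.sub_ne_zero hu
  have h2 := h.add_ne_zero hu
  obtain ⟨da, db, -⟩ := h.solution u hu
  refine ((((db.add da).div (db.sub da) h1).log (h.div_pos hu).ne').const_mul (1 / 2)).congr_deriv
    ?_
  simp only [Pi.add_apply, Pi.sub_apply, Pi.div_apply]
  field_simp
  ring

theorem tendsto_rad (h : IsPosCurve n Λ K η a b c) : Tendsto (curveRad a b) atBot (𝓝 0) := by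
  have h1 := ((h.tendsto_b.add h.tendsto_a).div (h.tendsto_b.sub h.tendsto_a)
    (by simpa using h.K_ne)).log (by simp [h.K_ne])
  have h2 : Tendsto (curveRad a b) atBot _ := h1.const_mul (1 / 2)
  simpa [h.K_ne] using h2

theorem tendsto_tau (h : IsPosCurve n Λ K η a b c) : Tendsto (curveTau a b) atBot (𝓝 1) := by
  have : Tendsto (curveTau a b) atBot _ := ((h.tendsto_a.pow 2).add (h.tendsto_b.pow 2)).div
    ((h.tendsto_b.pow 2).sub (h.tendsto_a.pow 2)) (by simpa using h.K_ne)
  simpa [h.K_ne] using this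

theorem hasDerivAt_tau (h : IsPosCurve n Λ K η a b c) {u : ℝ} (hu : u ∈ below η) :
    HasDerivAt (curveTau a b) (4 * (a u ^ 2 * b u ^ 2) / (b u ^ 2 - a u ^ 2)) u := by
  have h3 := (h.gap_pos u hu).ne'
  refine (((h.solution.hasDerivAt_sq_a hu).add (h.solution.hasDerivAt_sq_b hu)).div
    (h.solution.hasDerivAt_gap hu) h3).congr_deriv ?_
  simp only [Pi.add_apply]
  field_simp
  ring

theorem deriv_tau_pos (h : IsPosCurve n Λ K η a b c) {u : ℝ} (hu : u ∈ below η) :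
    0 < 4 * (a u ^ 2 * b u ^ 2) / (b u ^ 2 - a u ^ 2) := by
  obtain ⟨h1, h2, -⟩ := h.ne_zero u hu
  have := h.gap_pos u hu
  positivity

theorem one_lt_tau (h : IsPosCurve n Λ K η a b c) {u : ℝ} (hu : u ∈ below η) :
    1 < curveTau a b u := by
  have h3 := h.gap_pos u hu
  have := h.ne_zero u hu
  have h4 : 0 < a u ^ 2 := by have := this.1; positivity
  rw [curveTau, lt_div_iff₀ h3]
  linarith

theorem exists_inverse (h : IsPosCurve n Λ K η a b c) : StrictMonoOn (curveTau a b) (below η) ∧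
    ∃ g : ℝ → ℝ, (∀ u ∈ below η, g (curveTau a b u) = u) ∧
      ∀ u ∈ below η, HasDerivAt g (4 * (a u ^ 2 * b u ^ 2) / (b u ^ 2 - a u ^ 2))⁻¹
        (curveTau a b u) :=
  exists_inverse_of_deriv_pos isOpen_below convex_below (fun _ hu => h.hasDerivAt_tau hu)
    fun _ hu => h.deriv_tau_pos hu

theorem abs_rad (h : IsPosCurve n Λ K η a b c) {u : ℝ} (hu : u ∈ below η) :
    |curveRad a b u| = Real.arcosh (curveTau a b u) / 2 := by
  rw [← h.cosh_two_mul_rad hu, ← Real.cosh_abs, Real.arcosh_cosh (abs_nonneg _), abs_mul, abs_two,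
    mul_div_cancel_left₀ _ two_ne_zero]

theorem abs_rad_lt_iff (h : IsPosCurve n Λ K η a b c) {u v : ℝ} (hu : u ∈ below η)
    (hv : v ∈ below η) : |curveRad a b u| < |curveRad a b v| ↔ u < v := by
  rw [h.abs_rad hu, h.abs_rad hv, div_lt_div_iff_of_pos_right two_pos,
    Real.arcosh_lt_arcosh (zero_lt_one.trans (h.one_lt_tau hu)) (zero_lt_one.trans (h.one_lt_tau hv)),
    h.exists_inverse.1.lt_iff_lt hu hv]

theorem abs_rad_lt_radius (h : IsPosCurve n Λ K η a b c) {u : ℝ} (hu : u ∈ below η) :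
    ((|curveRad a b u| : ℝ) : EReal) < curveRadius η a b := by
  obtain ⟨v, hv, hlt⟩ := exists_gt_mem_below hu
  exact (EReal.coe_lt_coe_iff.2 ((h.abs_rad_lt_iff hu hv).2 hlt)).trans_le
    (le_iSup₂ (f := fun v (_ : v ∈ below η) => ((|curveRad a b v| : ℝ) : EReal)) v hv)

theorem radius_pos (h : IsPosCurve n Λ K η a b c) : 0 < curveRadius η a b := by
  obtain ⟨u, hu⟩ := below_nonempty h.bot_lt
  exact lt_of_le_of_lt (EReal.coe_nonneg.2 (abs_nonneg _)) (h.abs_rad_lt_radius hu)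

theorem tau_mem_shell (h : IsPosCurve n Λ K η a b c) {u : ℝ} (hu : u ∈ below η) :
    curveTau a b u ∈ shell (curveRadius η a b) := by
  rw [← h.cosh_two_mul_rad hu]
  exact cosh_two_mul_mem_shell (h.abs_rad_lt_radius hu)

theorem exists_tau_eq (h : IsPosCurve n Λ K η a b c) {τ : ℝ}
    (hτ : τ ∈ shell (curveRadius η a b)) (h1 : 1 < τ) : ∃ u ∈ below η, curveTau a b u = τ := by
  obtain ⟨v, hv, hlt⟩ : ∃ v ∈ below η, τ < curveTau a b v := by
    obtain ⟨v, hv'⟩ := lt_iSup_iff.1 hτ.2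
    obtain ⟨hv, hlt⟩ := lt_iSup_iff.1 hv'
    rw [EReal.coe_lt_coe_iff, h.abs_rad hv, div_lt_div_iff_of_pos_right two_pos,
      Real.arcosh_lt_arcosh (zero_lt_one.trans h1) (zero_lt_one.trans (h.one_lt_tau hv))] at hlt
    exact ⟨v, hv, hlt⟩
  obtain ⟨w, hw1, hw2⟩ :=
    ((h.tendsto_tau.eventually_lt_const h1).and (eventually_mem_below h.bot_lt)).exists
  obtain ⟨u, hu, e⟩ := ordConnected_below.isPreconnected.intermediate_value hw2 hv
    (fun u hu => (h.hasDerivAt_tau hu).continuousAt.continuousWithinAt) ⟨hw1.le, hlt.le⟩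
  exact ⟨u, hu, e⟩

theorem bijOn_abs_rad (h : IsPosCurve n Λ K η a b c) :
    Set.BijOn (fun u => |curveRad a b u|) (below η)
      {s : ℝ | 0 < s ∧ (s : EReal) < curveRadius η a b} := by
  refine ⟨fun u hu => ⟨?_, h.abs_rad_lt_radius hu⟩, fun u hu v hv e => ?_, fun s hs => ?_⟩
  · change 0 < |_|
    rw [h.abs_rad hu]
    exact half_pos (Real.arcosh_pos (h.one_lt_tau hu))
  · rcases lt_trichotomy u v with hlt | rfl | hlt
    · exact absurd e ((h.abs_rad_lt_iff hu hv).2 hlt).ne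
    · rfl
    · exact absurd e.symm ((h.abs_rad_lt_iff hv hu).2 hlt).ne
  · obtain ⟨hs0, hs⟩ := hs
    have h1 : Real.cosh (2 * s) ∈ shell (curveRadius η a b) :=
      cosh_two_mul_mem_shell (by rwa [abs_of_pos hs0])
    obtain ⟨u, hu, e⟩ := h.exists_tau_eq h1 (Real.one_lt_cosh.2 (by positivity))
    refine ⟨u, hu, ?_⟩
    change |_| = s
    rw [h.abs_rad hu, e, Real.arcosh_cosh (by positivity)]
    ring

end IsPosCurve

end CurveData

/-! ### From an unstable curve to a profile. -/

section CurveProfile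

variable {n : ℕ} {Λ K : ℝ} {η R : EReal} {a b c : ℝ → ℝ}

theorem exists_primitive_shell (hR : 0 < R) {G : ℝ → ℝ} (hG : ContinuousOn G (shell R)) :
    ∃ F : ℝ → ℝ, F 1 = 0 ∧ ∀ τ ∈ shell R, HasDerivWithinAt F (G τ) (shell R) τ := by
  refine ⟨fun τ => ∫ x in (1 : ℝ)..τ, G x, intervalIntegral.integral_same, fun τ hτ => ?_⟩
  obtain ⟨τ₁, hτ₁, hlt⟩ := exists_gt_mem_shell hR hτ
  obtain ⟨p, hp, he⟩ := exists_continuous_extension hτ₁.1 (hG.mono (Icc_subset_shell hR hτ₁))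
  have heq : Set.EqOn (fun τ => ∫ x in (1 : ℝ)..τ, G x) (fun τ => ∫ x in (1 : ℝ)..τ, p x)
      (Set.Icc 1 τ₁) := fun σ hσ => intervalIntegral.integral_congr fun x hx => by
    rw [Set.uIcc_of_le hσ.1] at hx
    exact he ⟨hx.1, hx.2.trans hσ.2⟩
  rw [he ⟨hτ.1, hlt.le⟩]
  refine (intervalIntegral.integral_hasDerivAt_right (hp.intervalIntegrable 1 τ)
    hp.stronglyMeasurable.stronglyMeasurableAtFilter
    hp.continuousAt).hasDerivWithinAt.congr_of_eventuallyEq ?_ (heq ⟨hτ.1, hlt.le⟩)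
  filter_upwards [Icc_mem_nhdsWithin_shell (R := R) hlt] with σ hσ using heq hσ

namespace IsPosCurve

theorem tendsto_tau_within (h : IsPosCurve n Λ K η a b c) :
    Tendsto (curveTau a b) atBot (𝓝[shell (curveRadius η a b)] 1) :=
  tendsto_nhdsWithin_iff.2 ⟨h.tendsto_tau, by
    filter_upwards [eventually_mem_below h.bot_lt] with u hu using h.tau_mem_shell hu⟩

/-- The function `G` of the metric of a curve. -/
theorem exists_G (h : IsPosCurve n Λ K η a b c) : ∃ G : ℝ → ℝ, G 1 = K ^ 2 / 2 ∧
    (∀ u ∈ below η, G (curveTau a b u) = (b u ^ 2 - a u ^ 2) / 2) ∧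
    ContinuousOn G (shell (curveRadius η a b)) ∧
    ∀ u ∈ below η, HasDerivAt G ((b u ^ 2 - a u ^ 2) ^ 2 * (c u ^ 2 - a u ^ 2 - b u ^ 2) /
      (8 * (a u ^ 2 * b u ^ 2))) (curveTau a b u) := by
  obtain ⟨hmono, g, hg, hg'⟩ := h.exists_inverse
  let G : ℝ → ℝ := fun τ => if 1 < τ then (b (g τ) ^ 2 - a (g τ) ^ 2) / 2 else K ^ 2 / 2
  have h1 : G 1 = K ^ 2 / 2 := if_neg (lt_irrefl _)
  have hG : ∀ u ∈ below η, G (curveTau a b u) = (b u ^ 2 - a u ^ 2) / 2 := fun u hu => by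
    simp only [G, if_pos (h.one_lt_tau hu), hg u hu]
  have hd : ∀ u ∈ below η, HasDerivAt G ((b u ^ 2 - a u ^ 2) ^ 2 * (c u ^ 2 - a u ^ 2 - b u ^ 2) /
      (8 * (a u ^ 2 * b u ^ 2))) (curveTau a b u) := fun u hu => by
    have e1 : HasDerivAt (fun u => (b u ^ 2 - a u ^ 2) / 2)
        ((b u ^ 2 - a u ^ 2) * (c u ^ 2 - a u ^ 2 - b u ^ 2) / 2) (g (curveTau a b u)) := by
      rw [hg u hu]; exact (h.solution.hasDerivAt_gap hu).div_const 2
    obtain ⟨ha, hb, -⟩ := h.ne_zero u hu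
    have hm := (h.gap_pos u hu).ne'
    refine ((e1.comp _ (hg' u hu)).congr_deriv ?_).congr_of_eventuallyEq ?_
    · field_simp
      ring
    · filter_upwards [Ioi_mem_nhds (h.one_lt_tau hu)] with τ hτ using if_pos hτ
  refine ⟨G, h1, hG, fun τ hτ => ?_, hd⟩
  rcases hτ.1.eq_or_lt with e | hlt
  · subst e
    have hlim : Tendsto (fun u => (b u ^ 2 - a u ^ 2) / 2) atBot (𝓝 (K ^ 2 / 2)) := by
      simpa using ((h.tendsto_b.pow 2).sub (h.tendsto_a.pow 2)).div_const 2
    -- Values of `τ` close to `1` correspond to `u` close to `-∞` because `τ` is monotone in `u`; so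
    -- continuity at `1` is the limit of `(b²-a²)/2` along the curve.
    refine tendsto_def.2 fun s hs => ?_
    rw [h1] at hs
    obtain ⟨u₁, hu₁⟩ := eventually_atBot.1 ((hlim.eventually_mem hs).and
      (eventually_mem_below h.bot_lt))
    refine mem_nhdsWithin_iff_eventually.2 ?_
    have hu₁' := (hu₁ u₁ le_rfl).2
    filter_upwards [Iio_mem_nhds (h.one_lt_tau hu₁')] with σ hσ hσ'
    rcases hσ'.1.eq_or_lt with e | hlt
    · subst e
      rw [Set.mem_preimage, h1]
      exact mem_of_mem_nhds hs
    · obtain ⟨u, hu, rfl⟩ := h.exists_tau_eq hσ' hlt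
      rw [Set.mem_preimage, hG u hu]
      exact (hu₁ u ((hmono.lt_iff_lt hu hu₁').1 hσ).le).1
  · obtain ⟨u, hu, rfl⟩ := h.exists_tau_eq hτ hlt
    exact (hd u hu).continuousAt.continuousWithinAt

theorem hasDerivAt_potential (h : IsPosCurve n Λ K η a b c) {F G : ℝ → ℝ}
    (hG : ∀ u ∈ below η, G (curveTau a b u) = (b u ^ 2 - a u ^ 2) / 2)
    (hF : ∀ τ ∈ shell (curveRadius η a b), HasDerivWithinAt F (G τ) (shell (curveRadius η a b)) τ)
    {u : ℝ} (hu : u ∈ below η) :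
    HasDerivAt (fun u => F (curveTau a b u)) (2 * (a u ^ 2 * b u ^ 2)) u := by
  have e1 := (hF _ (h.tau_mem_shell hu)).hasDerivAt
    (shell_mem_nhds h.radius_pos (h.tau_mem_shell hu) (h.one_lt_tau hu))
  have hm := (h.gap_pos u hu).ne'
  refine (e1.comp u (h.hasDerivAt_tau hu)).congr_deriv ?_
  rw [hG u hu]
  field_simp
  ring

/-- The logarithmic derivatives of `(b²-a²)ⁿ`, `c²` and `exp(ΛF)` are `n(c²-a²-b²)`, `n(a²+b²-c²) -
2Λa²b²` and `2Λa²b²`, with sum zero. The constant is the limit at `-∞`, where `F = 0`. -/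
theorem conserved (h : IsPosCurve n Λ K η a b c) {F G : ℝ → ℝ} (hF1 : F 1 = 0)
    (hG : ∀ u ∈ below η, G (curveTau a b u) = (b u ^ 2 - a u ^ 2) / 2)
    (hF : ∀ τ ∈ shell (curveRadius η a b), HasDerivWithinAt F (G τ) (shell (curveRadius η a b)) τ)
    {u : ℝ} (hu : u ∈ below η) :
    (b u ^ 2 - a u ^ 2) ^ n * c u ^ 2 = (K ^ 2) ^ (n + 1) * Real.exp (-Λ * F (curveTau a b u)) := by
  have hd : ∀ v ∈ below η, HasDerivAt (fun v => (b v ^ 2 - a v ^ 2) ^ n * c v ^ 2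
      * Real.exp (Λ * F (curveTau a b v))) 0 v := fun v hv => by
    refine ((((h.solution.hasDerivAt_gap hv).fun_pow n).mul
      (h.solution.hasDerivAt_sq_c h.n_pos hv)).mul
      ((h.hasDerivAt_potential hG hF hv).const_mul Λ).exp).congr_deriv ?_
    simp only [Pi.mul_apply]
    have hn : (b v ^ 2 - a v ^ 2) ^ n = (b v ^ 2 - a v ^ 2) ^ (n - 1) * (b v ^ 2 - a v ^ 2) := by
      rw [← pow_succ, Nat.sub_add_cancel h.n_pos]
    rw [hn]
    ring
  have hF0 : Tendsto (fun v => F (curveTau a b v)) atBot (𝓝 0) := by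
    have := (hF 1 (one_mem_shell h.radius_pos)).continuousWithinAt
    rw [ContinuousWithinAt, hF1] at this
    exact this.comp h.tendsto_tau_within
  have hlim := ((((h.tendsto_b.pow 2).sub (h.tendsto_a.pow 2)).pow n).mul h.tendsto_sq_c).mul
    (hF0.const_mul Λ).rexp
  have e := eq_of_tendsto_of_hasDerivAt_zero h.bot_lt hd hlim hu
  simp only [ne_eq, OfNat.ofNat_ne_zero, not_false_eq_true, zero_pow, sub_zero, mul_zero,
    Real.exp_zero, mul_one] at e
  rw [pow_succ (K ^ 2), ← e, mul_assoc _ _ (Real.exp (-Λ * _)), ← Real.exp_add]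
  simp

/-- The conservation law is the profile equation for `τ > 1`, and `G` is continuous up to `τ = 1`.
Uniqueness for the singular equation then identifies `(cosh r · G)^(n+1)` with the integral formula,
which yields the equation and smoothness at `τ = 1`. -/
theorem exists_profile (h : IsPosCurve n Λ K η a b c) : ∃ (F G G' : ℝ → ℝ) (C : ℝ),
    IsEinsteinProfile n Λ (curveRadius η a b) F G G' C ∧ F 1 = 0 ∧
    (∀ u ∈ below η, G (curveTau a b u) = (b u ^ 2 - a u ^ 2) / 2) ∧
    ∀ u ∈ below η, c u ^ 2 = 2 * (curveTau a b u * G (curveTau a b u)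
      + (curveTau a b u ^ 2 - 1) * G' (curveTau a b u)) := by
  have hR := h.radius_pos
  have hu := uniqueDiffOn_shell hR
  obtain ⟨G, hG1, hG, hGc, hGd⟩ := h.exists_G
  obtain ⟨F, hF1, hF⟩ := exists_primitive_shell hR hGc
  -- One factor `1/2` for each `G = (b²-a²)/2` and one for `c²/2`.
  set C : ℝ := (K ^ 2 / 2) ^ (n + 1) with hC
  have hK := h.K_ne
  have hC0 : 0 < C := by positivity
  have hpos : ∀ τ ∈ shell (curveRadius η a b), 0 < G τ := fun τ hτ => by
    rcases hτ.1.eq_or_lt with e | hlt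
    · rw [← e, hG1]; positivity
    · obtain ⟨u, hu, rfl⟩ := h.exists_tau_eq hτ hlt
      rw [hG u hu]
      exact half_pos (h.gap_pos u hu)
  have hcons : ∀ u ∈ below η, G (curveTau a b u) ^ n * (c u ^ 2 / 2)
      = C * Real.exp (-Λ * F (curveTau a b u)) := fun u hu => by
    have e := h.conserved hF1 hG hF hu
    rw [hG u hu, hC, div_pow, div_pow, pow_succ (2 : ℝ) n]
    field_simp
    rw [e, neg_mul]
  -- So far `F` is only known to be `C¹`, which is enough to compare with the integral formula.
  have hFs : ContDiffOn ℝ (0 + 1) F (shell (curveRadius η a b)) :=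
    (contDiffOn_succ_iff_derivWithin hu).2 ⟨fun τ hτ => (hF τ hτ).differentiableWithinAt, by simp,
      contDiffOn_zero.2 (hGc.congr fun τ hτ => (hF τ hτ).derivWithin (hu τ hτ))⟩
  have hq := (contDiffOn_succ_iff_derivWithin hu).1
    (hFs.profileDensity (n := n) (Λ := Λ) (C := C))
  have hqd := fun σ hσ => (hq.1 σ hσ).hasDerivWithinAt
  have hI : ContinuousOn (paramInt n (profileDensity n Λ C F)) (shell (curveRadius η a b)) :=
    continuousOn_paramInt hR hq.1.continuousOn n
  have hhalf : ContinuousOn halfCosh (shell (curveRadius η a b)) :=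
    (contDiffOn_halfCosh 0).continuousOn
  have key : Set.EqOn (fun τ => (halfCosh τ * G τ) ^ (n + 1) / (n + 1))
      (paramInt n (profileDensity n Λ C F)) (shell (curveRadius η a b)) := by
    refine eq_of_singular_ode (n := n) hR (((hhalf.mul hGc).pow _).div_const _) hI
      (J' := fun τ => (halfCosh τ * G τ) ^ n * (1 / (4 * halfCosh τ) * G τ + halfCosh τ * deriv G τ))
      (q := profileDensity n Λ C F) (fun τ hτ h1 => ?_)
      (fun τ hτ h1 => (hasDerivWithinAt_paramInt hR hqd hq.2.2.continuousOn n hτ).hasDerivAt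
        (shell_mem_nhds hR hτ h1)) (fun τ hτ h1 => ?_)
      fun τ hτ _ => paramInt_eq hR hqd hq.2.2.continuousOn n hτ
    · obtain ⟨u, hu, rfl⟩ := h.exists_tau_eq hτ h1
      have hG' := (hGd u hu).differentiableAt.hasDerivAt
      refine ((((hasDerivAt_halfCosh hτ.1).mul hG').fun_pow (n + 1)).div_const
        ((n : ℝ) + 1)).congr_deriv ?_
      have : (n : ℝ) + 1 ≠ 0 := by positivity
      simp only [Pi.mul_apply, Nat.add_sub_cancel]
      push_cast
      field_simp
    · obtain ⟨u, hu, rfl⟩ := h.exists_tau_eq hτ h1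
      have hh := halfCosh_pos hτ.1
      have hh2 := halfCosh_sq hτ.1
      have hc := hcons u hu
      obtain ⟨ha, hb, -⟩ := h.ne_zero u hu
      have hm := (h.gap_pos u hu).ne'
      have e1 : (n : ℝ) + 1 ≠ 0 := by positivity
      -- The left side is `τG + (τ²-1)G'`, here computed from the derivative of `G` along the curve.
      have e2 : halfCosh (curveTau a b u) ^ 2 * G (curveTau a b u)
          + (curveTau a b u - 1) / 2 * G (curveTau a b u)
          + 2 * (curveTau a b u - 1) * halfCosh (curveTau a b u) ^ 2 * deriv G (curveTau a b u)
          = c u ^ 2 / 2 := by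
        rw [hh2, hG u hu, (hGd u hu).deriv, curveTau]
        field_simp
        ring
      unfold profileDensity
      rw [← hc, mul_div_cancel₀ _ e1, pow_succ, mul_pow, ← e2]
      field_simp
      ring
  have hprof := isEinsteinProfile_of_integral (n := n) (Λ := Λ) hR hF hpos hC0 fun τ hτ => by
    have e1 : (n : ℝ) + 1 ≠ 0 := by positivity
    rw [← key hτ, mul_div_cancel₀ _ e1]
  refine ⟨F, G, _, C, hprof, hF1, hG, fun u hu => ?_⟩
  have e1 := hprof.ode _ (h.tau_mem_shell hu)
  rw [← hcons u hu] at e1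
  have e2 := mul_left_cancel₀ (pow_pos (hpos _ (h.tau_mem_shell hu)) n).ne' e1
  linarith

end IsPosCurve

end CurveProfile

/-! ### Radius of the tube and completeness for an unstable curve. -/

section CurveGlobal

variable {n : ℕ} {Λ K L C : ℝ} {η : EReal} {a b c : ℝ → ℝ}

theorem monotoneOn_below_Ici {f f' : ℝ → ℝ} {u₀ : ℝ} (hf : ∀ u ∈ below η, HasDerivAt f (f' u) u)
    (h : ∀ u ∈ below η, u₀ ≤ u → 0 ≤ f' u) : MonotoneOn f (below η ∩ Set.Ici u₀) :=
  monotoneOn_of_hasDerivWithinAt_nonneg (convex_below.inter (convex_Ici u₀))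
    (fun u hu => (hf u hu.1).continuousAt.continuousWithinAt)
    (fun u hu => (hf u (interior_subset hu).1).hasDerivWithinAt)
    fun u hu => h u (interior_subset hu).1 (interior_subset hu).2

namespace IsPosCurve

theorem sq_pos (h : IsPosCurve n Λ K η a b c) {u : ℝ} (hu : u ∈ below η) :
    0 < a u ^ 2 ∧ 0 < b u ^ 2 ∧ 0 < c u ^ 2 := by
  obtain ⟨h1, h2, h3⟩ := h.ne_zero u hu
  exact ⟨by positivity, by positivity, by positivity⟩

theorem hasDerivAt_sq_mul (h : IsPosCurve n Λ K η a b c) {u : ℝ} (hu : u ∈ below η) :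
    HasDerivAt (fun u => a u ^ 2 * b u ^ 2) (2 * c u ^ 2 * (a u ^ 2 * b u ^ 2)) u :=
  ((h.solution.hasDerivAt_sq_a hu).mul (h.solution.hasDerivAt_sq_b hu)).congr_deriv (by ring)

/-- The ratio `w = a²b²/c²` controls both global questions: a lower bound on `w` limits `c²` in
`potential_unbounded`, an upper bound gives the inequality `c² ≥ ε a²b²` if `Λ < 0`. -/
theorem hasDerivAt_ratio (h : IsPosCurve n Λ K η a b c) {u : ℝ} (hu : u ∈ below η) :
    HasDerivAt (fun u => a u ^ 2 * b u ^ 2 / c u ^ 2)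
      (-n * (a u ^ 2 + b u ^ 2) * (a u ^ 2 * b u ^ 2 / c u ^ 2)
        + 2 * Λ * (a u ^ 2 * b u ^ 2) * (a u ^ 2 * b u ^ 2 / c u ^ 2)
        + (n + 2) * (a u ^ 2 * b u ^ 2)) u := by
  have hc := (h.ne_zero u hu).2.2
  refine ((h.hasDerivAt_sq_mul hu).div (h.solution.hasDerivAt_sq_c h.n_pos hu)
    (pow_ne_zero 2 hc)).congr_deriv ?_
  field_simp
  ring

/-- The potential is unbounded along an unstable curve. -/
theorem potential_unbounded (h : IsPosCurve n Λ K η a b c) (h0 : IsUnstableCurve n Λ K L η a b c)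
    (hΛ : Λ ≤ 0) {Φ : ℝ → ℝ} (hΦ : ∀ u ∈ below η, HasDerivAt Φ (2 * (a u ^ 2 * b u ^ 2)) u)
    (B : ℝ) : ∃ u ∈ below η, B < Φ u := by
  by_contra! hB
  obtain ⟨u₀, hu₀⟩ := below_nonempty h.bot_lt
  obtain ⟨hx₀, hy₀, hz₀⟩ := h.sq_pos hu₀
  have hmem : u₀ ∈ below η ∩ Set.Ici u₀ := ⟨hu₀, Set.mem_Ici.2 le_rfl⟩
  have hx : ∀ u ∈ below η, u₀ ≤ u → a u₀ ^ 2 ≤ a u ^ 2 := fun u hu hle =>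
    monotoneOn_below (fun u hu => h.solution.hasDerivAt_sq_a hu) (fun u hu =>
      mul_nonneg (sq_nonneg _) (by
        have := h.gap_pos u hu; have := sq_nonneg (c u); linarith)) hu₀ hu hle
  have hxy : ∀ u ∈ below η, u₀ ≤ u → a u₀ ^ 2 * b u₀ ^ 2 ≤ a u ^ 2 * b u ^ 2 := fun u hu hle =>
    monotoneOn_below (fun u hu => h.hasDerivAt_sq_mul hu) (fun u _ => by positivity) hu₀ hu hle
  set N : ℝ := 2 * n / a u₀ ^ 2 - 2 * Λ with hN
  have hN0 : 0 ≤ N := by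
    have : 0 ≤ 2 * n / a u₀ ^ 2 := by positivity
    linarith
  -- Because `a²` increases and `a² < b²`, one has `a² + b² ≤ 2a²b²/a(u₀)²`. Hence `w' ≥ -N a²b² w`,
  -- and `N a²b²` is the derivative of `NΦ/2`.
  have hw : MonotoneOn (fun u => a u ^ 2 * b u ^ 2 / c u ^ 2 * Real.exp (N / 2 * Φ u))
      (below η ∩ Set.Ici u₀) := by
    refine monotoneOn_below_Ici (fun u hu => (h.hasDerivAt_ratio hu).mul
      ((hΦ u hu).const_mul (N / 2)).exp) fun u hu hle => ?_
    obtain ⟨h1, h2, h3⟩ := h.sq_pos hu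
    set w := a u ^ 2 * b u ^ 2 / c u ^ 2 with hwdef
    have hw0 : 0 < w := by positivity
    have e1 : n * (a u ^ 2 + b u ^ 2) ≤ 2 * n / a u₀ ^ 2 * (a u ^ 2 * b u ^ 2) := by
      have h4 := hx u hu hle
      have h5 := h.gap_pos u hu
      rw [div_mul_eq_mul_div, le_div_iff₀ hx₀]
      have : (a u ^ 2 + b u ^ 2) * a u₀ ^ 2 ≤ 2 * (a u ^ 2 * b u ^ 2) := by nlinarith
      have := mul_le_mul_of_nonneg_left this (Nat.cast_nonneg (α := ℝ) n)
      linarith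
    have e2 := mul_le_mul_of_nonneg_right e1 hw0.le
    have e3 : 0 ≤ -n * (a u ^ 2 + b u ^ 2) * w + 2 * Λ * (a u ^ 2 * b u ^ 2) * w
        + (n + 2) * (a u ^ 2 * b u ^ 2) + N * (a u ^ 2 * b u ^ 2) * w := by
      have : 0 ≤ ((n : ℝ) + 2) * (a u ^ 2 * b u ^ 2) := by positivity
      rw [hN]
      linarith
    have := mul_nonneg e3 (Real.exp_pos (N / 2 * Φ u)).le
    linarith
  -- If `Φ ≤ B`, the monotone quantity bounds `w` from below.
  obtain ⟨Q, hQ0, hQ⟩ : ∃ Q, 0 < Q ∧ ∀ u ∈ below η, u₀ ≤ u → c u ^ 2 ≤ Q * (a u ^ 2 * b u ^ 2) := by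
    set w₀ := a u₀ ^ 2 * b u₀ ^ 2 / c u₀ ^ 2 * Real.exp (N / 2 * Φ u₀) with hw₀
    have hw₀0 : 0 < w₀ := by positivity
    refine ⟨Real.exp (N / 2 * B) / w₀, by positivity, fun u hu hle => ?_⟩
    have e1 : w₀ ≤ a u ^ 2 * b u ^ 2 / c u ^ 2 * Real.exp (N / 2 * Φ u) :=
      hw hmem ⟨hu, hle⟩ hle
    obtain ⟨h1, h2, h3⟩ := h.sq_pos hu
    have e2 : Real.exp (N / 2 * Φ u) ≤ Real.exp (N / 2 * B) :=
      Real.exp_le_exp.2 (mul_le_mul_of_nonneg_left (hB u hu) (by positivity))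
    have e3 := e1.trans (mul_le_mul_of_nonneg_left e2
      (by positivity : 0 ≤ a u ^ 2 * b u ^ 2 / c u ^ 2))
    rw [div_mul_eq_mul_div, le_div_iff₀ h3] at e3
    rw [div_mul_eq_mul_div, le_div_iff₀ hw₀0]
    linarith
  -- Now `(a²b²)' = 2c² a²b² ≤ QΦ' a²b²`, so `a²b² exp(-QΦ)` is nonincreasing.
  obtain ⟨P, hP0, hP⟩ : ∃ P, 0 < P ∧ ∀ u ∈ below η, u₀ ≤ u → a u ^ 2 * b u ^ 2 ≤ P := by
    refine ⟨a u₀ ^ 2 * b u₀ ^ 2 * Real.exp (-Q * Φ u₀) * Real.exp (Q * B), by positivity,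
      fun u hu hle => ?_⟩
    have hm := monotoneOn_below_Ici (u₀ := u₀) (f := fun u => -(a u ^ 2 * b u ^ 2
      * Real.exp (-Q * Φ u))) (fun u hu => ((h.hasDerivAt_sq_mul hu).mul
        ((hΦ u hu).const_mul (-Q)).exp).neg) fun u hu hle => by
        have e1 := hQ u hu hle
        obtain ⟨h1, h2, h3⟩ := h.sq_pos hu
        have e2 : 0 ≤ 2 * (a u ^ 2 * b u ^ 2) * (Q * (a u ^ 2 * b u ^ 2) - c u ^ 2) :=
          mul_nonneg (by positivity) (by linarith)
        have := mul_nonneg e2 (Real.exp_pos (-Q * Φ u)).le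
        linarith
    have e1 := neg_le_neg_iff.1 (hm hmem ⟨hu, hle⟩ hle)
    have e2 : 1 ≤ Real.exp (-Q * Φ u) * Real.exp (Q * B) := by
      rw [← Real.exp_add]
      refine Real.one_le_exp ?_
      have := mul_le_mul_of_nonneg_left (hB u hu) hQ0.le
      linarith
    calc a u ^ 2 * b u ^ 2 ≤ a u ^ 2 * b u ^ 2 * (Real.exp (-Q * Φ u) * Real.exp (Q * B)) :=
          le_mul_of_one_le_right (by positivity) e2
      _ ≤ _ := by
          rw [← mul_assoc]
          exact mul_le_mul_of_nonneg_right e1 (Real.exp_pos _).le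
  -- Since `a²` is bounded below, the bound on `a²b²` bounds `a`, `b` and `c`, which rules out a
  -- finite end. On an infinite interval `Φ' ≥ 2p > 0` makes `Φ` grow at least linearly.
  induction η with
  | bot => exact absurd h.bot_lt (lt_irrefl _)
  | coe e =>
    refine h0.not_bounded (u₀ := u₀) (M := P / a u₀ ^ 2 + Q * P + 1) (EReal.coe_lt_coe_iff.1 hu₀)
      fun u hu => ?_
    have hu' : u ∈ below (e : EReal) := EReal.coe_lt_coe_iff.2 hu.2
    have e1 := hP u hu' hu.1
    have e2 := hQ u hu' hu.1
    have e3 := hx u hu' hu.1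
    have e4 := h.gap_pos u hu'
    have e5 : b u ^ 2 ≤ P / a u₀ ^ 2 := by
      rw [le_div_iff₀ hx₀]
      nlinarith [sq_nonneg (b u)]
    have e6 : c u ^ 2 ≤ Q * P := e2.trans (mul_le_mul_of_nonneg_left e1 hQ0.le)
    have e7 : 0 ≤ Q * P := by positivity
    have e8 : 0 ≤ P / a u₀ ^ 2 := by positivity
    have key : ∀ t : ℝ, |t| ≤ t ^ 2 + 1 := fun t => by
      rw [← sq_abs]; nlinarith [sq_nonneg (|t| - 1)]
    exact ⟨(key _).trans (by linarith), (key _).trans (by linarith), (key _).trans (by linarith)⟩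
  | top =>
    set p := a u₀ ^ 2 * b u₀ ^ 2 with hp
    have hp0 : 0 < p := by positivity
    have hm := monotoneOn_below_Ici (η := ⊤) (u₀ := u₀) (f := fun u => Φ u - 2 * p * u)
      (fun u hu => (hΦ u hu).sub ((hasDerivAt_id u).const_mul (2 * p))) fun u hu hle => by
        have := hxy u hu hle
        linarith
    have hB0 := hB u₀ hu₀
    have hle : u₀ ≤ u₀ + (B - Φ u₀ + 1) / (2 * p) := by
      have : 0 ≤ (B - Φ u₀ + 1) / (2 * p) := div_nonneg (by linarith) (by positivity)
      linarith
    have e1 := hm hmem ⟨EReal.coe_lt_top _, hle⟩ hle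
    have e2 := hB _ (EReal.coe_lt_top (u₀ + (B - Φ u₀ + 1) / (2 * p)))
    simp only [mul_add, mul_div_cancel₀ _ (by positivity : 2 * p ≠ 0)] at e1
    linarith

theorem lt_radius (h : IsPosCurve n Λ K η a b c) {s u : ℝ} (hu : u ∈ below η)
    (hs : Real.cosh (2 * s) < curveTau a b u) : (s : EReal) < curveRadius η a b := by
  rw [← h.cosh_two_mul_rad hu, Real.cosh_lt_cosh, abs_mul, abs_mul, abs_two] at hs
  refine lt_of_le_of_lt (EReal.coe_le_coe_iff.2 ?_) (h.abs_rad_lt_radius hu)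
  linarith [le_abs_self s]

/-- Since `G ≤ 1 + C`, the potential grows at most linearly in `τ`; as it is unbounded, so is `τ`.
-/
theorem radius_eq_top {F G G' : ℝ → ℝ} (h : IsPosCurve n 0 K η a b c)
    (h0 : IsUnstableCurve n 0 K L η a b c)
    (hp : IsEinsteinProfile n 0 (curveRadius η a b) F G G' C) (hF1 : F 1 = 0)
    (hG : ∀ u ∈ below η, G (curveTau a b u) = (b u ^ 2 - a u ^ 2) / 2) :
    curveRadius η a b = ⊤ := by
  have hC := hp.C_pos
  have hFle : ∀ τ ∈ shell (curveRadius η a b), F τ ≤ (1 + C) * (τ - 1) := by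
    intro τ hτ
    have hm : MonotoneOn (fun τ => (1 + C) * (τ - 1) - F τ) (shell (curveRadius η a b)) := by
      refine monotoneOn_of_hasDerivWithinAt_nonneg (f' := fun τ => (1 + C) - G τ)
        (ordConnected_shell h.radius_pos).convex (fun τ hτ => ?_) (fun τ hτ => ?_)
        fun τ hτ => sub_nonneg.2 (hp.le_one_add (interior_subset hτ))
      · exact ((by fun_prop : Continuous fun τ : ℝ => (1 + C) * (τ - 1)).continuousWithinAt).sub
          (hp.derivF τ hτ).continuousWithinAt
      · exact ((((hasDerivAt_id τ).sub_const 1).const_mul (1 + C)).hasDerivWithinAt.sub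
          ((hp.derivF τ (interior_subset hτ)).mono interior_subset)).congr_deriv (by simp)
    have := hm (one_mem_shell h.radius_pos) hτ hτ.1
    simp only [sub_self, mul_zero, hF1] at this
    linarith
  refine EReal.eq_top_iff_forall_lt _ |>.2 fun s => ?_
  obtain ⟨u, hu, hlt⟩ := h.potential_unbounded h0 le_rfl
    (fun u hu => h.hasDerivAt_potential hG hp.derivF hu) ((1 + C) * Real.cosh (2 * s))
  refine h.lt_radius hu ?_
  have := hFle _ (h.tau_mem_shell hu)
  have h1 : 0 < 1 + C := by linarith
  have h2 : (1 + C) * Real.cosh (2 * s) < (1 + C) * (curveTau a b u - 1) := hlt.trans_le this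
  have := lt_of_mul_lt_mul_left h2 h1.le
  linarith

/-- With `w = a²b²/c²`, the function `((n+2)/(-2Λ) - w) exp(-ΛΦ)` is nondecreasing, and its limit at
`-∞` is positive because `w → 0`. Hence `w < (n+2)/(-2Λ)` throughout. -/
theorem sq_c_lower_bound (h : IsPosCurve n Λ K η a b c) (hΛ : Λ < 0) {Φ : ℝ → ℝ}
    (hΦ : ∀ u ∈ below η, HasDerivAt Φ (2 * (a u ^ 2 * b u ^ 2)) u)
    (hΦ0 : Tendsto Φ atBot (𝓝 0)) {u : ℝ} (hu : u ∈ below η) :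
    -2 * Λ / (n + 2) * (a u ^ 2 * b u ^ 2) ≤ c u ^ 2 := by
  have hΛ' : 0 < -2 * Λ := by linarith
  have hn : (0 : ℝ) < n + 2 := by positivity
  have hK := h.K_ne
  have hlim : Tendsto (fun u => ((n + 2) / (-2 * Λ) - a u ^ 2 * b u ^ 2 / c u ^ 2)
      * Real.exp (-Λ * Φ u)) atBot (𝓝 ((n + 2) / (-2 * Λ))) := by
    have := (((((h.tendsto_a.pow 2).mul (h.tendsto_b.pow 2)).div h.tendsto_sq_c
      (pow_ne_zero 2 hK)).const_sub ((n + 2) / (-2 * Λ))).mul (hΦ0.const_mul (-Λ)).rexp)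
    simpa using this
  have key := le_of_tendsto_atBot (f' := fun u => n * (a u ^ 2 + b u ^ 2)
      * (a u ^ 2 * b u ^ 2 / c u ^ 2) * Real.exp (-Λ * Φ u)) (fun u hu => ?_)
      (fun u _ => by positivity) hlim hu
  · have h1 : 0 < (n + 2) / (-2 * Λ) := by positivity
    have h2 := pos_of_mul_pos_left (h1.trans_le key) (Real.exp_pos _).le
    have h3 := (h.sq_pos hu).2.2
    rw [sub_pos, div_lt_div_iff₀ h3 hΛ'] at h2
    rw [div_mul_eq_mul_div, div_le_iff₀ hn]
    linarith
  · refine (((h.hasDerivAt_ratio hu).const_sub ((n + 2) / (-2 * Λ))).mul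
      ((hΦ u hu).const_mul (-Λ)).exp).congr_deriv ?_
    have : -2 * Λ ≠ 0 := hΛ'.ne'
    have e : ((n : ℝ) + 2) / (-2 * Λ) * (-2 * Λ) = n + 2 := div_mul_cancel₀ _ this
    linear_combination (a u ^ 2 * b u ^ 2) * Real.exp (-Λ * Φ u) * e

/-- `ab` has logarithmic derivative `c²`, so its sign is constant. Neither `a` nor `K` is assumed
positive, hence the sign `σ`. -/
theorem exists_sign (h : IsPosCurve n Λ K η a b c) : ∃ σ : ℝ, σ ^ 2 = 1 ∧
    ∀ u ∈ below η, 0 < σ * (a u * b u) := by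
  obtain ⟨ca, cb, cc⟩ := h.solution.continuousOn
  obtain ⟨u₀, hu₀⟩ := below_nonempty h.bot_lt
  have key : ∀ u ∈ below η, ∃ E, 0 < E ∧ a u * b u = a u₀ * b u₀ * E := fun u hu =>
    eq_mul_exp_of_linear (y := fun u => a u * b u) (q := fun u => c u ^ 2) (by fun_prop)
      (fun v hv => ((h.solution v hv).1.mul (h.solution v hv).2.1).congr_deriv (by ring)) hu₀ hu
  have hne : a u₀ * b u₀ ≠ 0 := mul_ne_zero (h.ne_zero u₀ hu₀).1 (h.ne_zero u₀ hu₀).2.1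
  rcases hne.lt_or_gt with hlt | hgt
  · refine ⟨-1, by norm_num, fun u hu => ?_⟩
    obtain ⟨E, hE, e⟩ := key u hu
    rw [e]
    nlinarith
  · refine ⟨1, by norm_num, fun u hu => ?_⟩
    obtain ⟨E, hE, e⟩ := key u hu
    rw [e, one_mul]
    positivity

/-- From `(1/(ab))' = -c²/(ab)` and `r' = ab` it follows that `1/|ab| + ε|r|` is nonincreasing,
which bounds `|r|` past `u₀`; before `u₀` it is smaller still. -/
theorem radius_lt_top (h : IsPosCurve n Λ K η a b c) {ε : ℝ} (hε : 0 < ε)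
    (hc : ∀ u ∈ below η, ε * (a u ^ 2 * b u ^ 2) ≤ c u ^ 2) : curveRadius η a b < ⊤ := by
  obtain ⟨σ, hσ, hpos⟩ := h.exists_sign
  obtain ⟨u₀, hu₀⟩ := below_nonempty h.bot_lt
  have habs : ∀ u ∈ below η, |curveRad a b u| = σ * curveRad a b u := fun u hu => by
    have h1 : 0 ≤ σ * curveRad a b u := le_of_tendsto_atBot
      (fun u hu => (h.hasDerivAt_rad hu).const_mul σ) (fun u hu => (hpos u hu).le)
      (by simpa using h.tendsto_rad.const_mul σ) hu
    have h2 : |σ| = 1 := by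
      rw [(sq_eq_sq_iff_abs_eq_abs σ 1).1 (by rw [hσ, one_pow]), abs_one]
    rw [← abs_of_nonneg h1, abs_mul, h2, one_mul]
  have hm := monotoneOn_below (f := fun u => -((σ * (a u * b u))⁻¹ + ε * (σ * curveRad a b u)))
    (f' := fun u => (c u ^ 2 - ε * (a u ^ 2 * b u ^ 2)) / (σ * (a u * b u))) (fun u hu => by
      have hp := (hpos u hu).ne'
      have hp2 := (h.solution u hu).1.mul (h.solution u hu).2.1
      refine ((((hp2.const_mul σ).inv hp).add
        (((h.hasDerivAt_rad hu).const_mul σ).const_mul ε)).neg).congr_deriv ?_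
      simp only [Pi.mul_apply]
      field_simp
      rw [hσ]
      ring) fun u hu => div_nonneg (sub_nonneg.2 (hc u hu)) (hpos u hu).le
  set M := (σ * (a u₀ * b u₀))⁻¹ + ε * (σ * curveRad a b u₀) with hM
  have hbd : ∀ u ∈ below η, |curveRad a b u| ≤ M / ε := fun u hu => by
    have hge : ∀ v ∈ below η, u₀ ≤ v → |curveRad a b v| ≤ M / ε := fun v hv hle => by
      have e1 := neg_le_neg_iff.1 (hm hu₀ hv hle)
      have e2 := inv_pos.2 (hpos v hv)
      rw [habs v hv, le_div_iff₀ hε]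
      linarith
    rcases le_total u₀ u with hle | hle
    · exact hge u hu hle
    · rcases hle.eq_or_lt with rfl | hlt
      · exact hge u hu le_rfl
      · exact ((h.abs_rad_lt_iff hu hu₀).2 hlt).le.trans (hge u₀ hu₀ le_rfl)
  exact (iSup₂_le fun u hu => EReal.coe_le_coe_iff.2 (hbd u hu)).trans_lt (EReal.coe_lt_top _)

/-- The exhaustion function is `(√ε/2) F`. Its gradient condition reads `(ε/2) G²(τ²-1) ≤ c²/2`, and
`G²(τ²-1) = a²b²`; it is proper because `F` is increasing in `τ` and unbounded. -/
theorem isCompleteMetric {F G G' : ℝ → ℝ} (h : IsPosCurve n Λ K η a b c)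
    (h0 : IsUnstableCurve n Λ K L η a b c) (hΛ : Λ ≤ 0)
    (hp : IsEinsteinProfile n Λ (curveRadius η a b) F G G' C)
    (hG : ∀ u ∈ below η, G (curveTau a b u) = (b u ^ 2 - a u ^ 2) / 2)
    (hG' : ∀ u ∈ below η, c u ^ 2 = 2 * (curveTau a b u * G (curveTau a b u)
      + (curveTau a b u ^ 2 - 1) * G' (curveTau a b u))) {ε : ℝ} (hε : 0 < ε)
    (hc : ∀ u ∈ below η, ε * (a u ^ 2 * b u ^ 2) ≤ c u ^ 2) :
    IsCompleteMetric (tube n (curveRadius η a b)) (radialMetric (n + 2) G G') := by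
  have hs : 0 < √ε / 2 := by positivity
  refine hp.isCompleteMetric (Θ := fun τ => √ε / 2 * F τ) (θ := fun τ => √ε / 2 * G τ)
    (fun τ hτ => (hp.derivF τ hτ).const_mul _) (continuousOn_const.mul hp.continuousOn_G)
    (fun τ hτ => ?_) fun B => ?_
  · rcases hτ.1.eq_or_lt with e | hlt
    · subst e
      have := hp.pos 1 hτ
      norm_num
      linarith
    · obtain ⟨u, hu, rfl⟩ := h.exists_tau_eq hτ hlt
      have e1 := hc u hu
      have hm := (h.gap_pos u hu).ne'
      have e2 : G (curveTau a b u) ^ 2 * (curveTau a b u ^ 2 - 1) = a u ^ 2 * b u ^ 2 := by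
        rw [hG u hu, curveTau]
        field_simp
        ring
      rw [hG' u hu] at e1
      rw [mul_pow, div_pow, Real.sq_sqrt hε.le]
      have e3 : 2 * (ε / 2 ^ 2 * G (curveTau a b u) ^ 2 * (curveTau a b u ^ 2 - 1))
          = ε / 2 * (a u ^ 2 * b u ^ 2) := by
        rw [← e2]; ring
      rw [e3]
      linarith
  · obtain ⟨u, hu, hlt⟩ := h.potential_unbounded h0 hΛ
      (fun u hu => h.hasDerivAt_potential hG hp.derivF hu) (B / (√ε / 2))
    refine ⟨_, h.tau_mem_shell hu, fun τ hτ hle => ?_⟩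
    by_contra! hτu
    have hm : MonotoneOn F (shell (curveRadius η a b)) :=
      monotoneOn_of_hasDerivWithinAt_nonneg (ordConnected_shell h.radius_pos).convex
        (fun τ hτ => (hp.derivF τ hτ).continuousWithinAt)
        (fun τ hτ => (hp.derivF τ (interior_subset hτ)).mono interior_subset)
        fun τ hτ => (hp.pos τ (interior_subset hτ)).le
    have e1 := hm (h.tau_mem_shell hu) hτ hτu.le
    rw [div_lt_iff₀ hs] at hlt
    nlinarith

theorem realizes {G G' : ℝ → ℝ} (h : IsPosCurve n Λ K η a b c)
    (hG : ∀ u ∈ below η, G (curveTau a b u) = (b u ^ 2 - a u ^ 2) / 2)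
    (hG' : ∀ u ∈ below η, c u ^ 2 = 2 * (curveTau a b u * G (curveTau a b u)
      + (curveTau a b u ^ 2 - 1) * G' (curveTau a b u))) :
    Realizes n η a b c (curveRad a b) (curveRadius η a b) (radialMetric (n + 2) G G') := by
  have hsq : ∀ u ∈ below η, Real.sinh (curveRad a b u) ^ 2 = a u ^ 2 / (b u ^ 2 - a u ^ 2) ∧
      Real.cosh (curveRad a b u) ^ 2 = b u ^ 2 / (b u ^ 2 - a u ^ 2) := fun u hu => by
    have e1 := h.cosh_two_mul_rad hu
    have e2 := Real.cosh_sq (curveRad a b u)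
    have hm := (h.gap_pos u hu).ne'
    rw [Real.cosh_two_mul, curveTau] at e1
    constructor
    · have : a u ^ 2 / (b u ^ 2 - a u ^ 2)
        = ((a u ^ 2 + b u ^ 2) / (b u ^ 2 - a u ^ 2) - 1) / 2 := by field_simp; ring
      rw [this]; linarith
    · have : b u ^ 2 / (b u ^ 2 - a u ^ 2)
        = ((a u ^ 2 + b u ^ 2) / (b u ^ 2 - a u ^ 2) + 1) / 2 := by field_simp; ring
      rw [this]; linarith
  refine realizes_of_profile h.ne_zero (fun u hu => h.hasDerivAt_rad hu) h.tendsto_rad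
    h.bijOn_abs_rad (fun u hu => ?_) (fun u hu => ?_) (fun u hu => ?_)
    (fun u hu => h.a_mul_cosh hu) fun _ _ _ _ _ _ => rfl
  · have hm := (h.gap_pos u hu).ne'
    rw [h.cosh_two_mul_rad hu, hG u hu, (hsq u hu).1]
    field_simp
  · have hm := (h.gap_pos u hu).ne'
    rw [h.cosh_two_mul_rad hu, hG u hu, (hsq u hu).2]
    field_simp
  · rw [h.cosh_two_mul_rad hu, hG' u hu]

end IsPosCurve

/-- Every unstable curve is realized by a complete Kähler-Einstein metric. -/
theorem StenzelTube.IsUnstableCurve.exists_metric (h0 : IsUnstableCurve n Λ K L η a b c)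
    (hn : 1 ≤ n) (hΛ : Λ ≤ 0) (hK : K ≠ 0) (hL : L = K ∨ L = -K) :
    ∃ (R : EReal) (r : ℝ → ℝ) (g : BilinField (n + 2)),
      0 < R ∧ (Λ = 0 → R = ⊤) ∧ (Λ < 0 → R < ⊤) ∧ Realizes n η a b c r R g ∧
      IsKahlerEinstein (n + 1) (tube n R) Λ g ∧ IsCompleteMetric (tube n R) g ∧
      (Λ = 0 → ∃ (k : ℝ) (f : ℝ → ℝ), IsStenzelFunction n k f ∧ IsStenzelMetric n f g) := by
  have h := h0.isPosCurve hn hK hL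
  obtain ⟨F, G, G', C, hp, hF1, hG, hG'⟩ := h.exists_profile
  refine ⟨curveRadius η a b, curveRad a b, radialMetric (n + 2) G G', h.radius_pos, ?_⟩
  rcases hΛ.eq_or_lt with rfl | hlt
  · have hR := h.radius_eq_top h0 hp hF1 hG
    have hreal := h.realizes hG hG'
    rw [hR] at hp hreal ⊢
    exact ⟨fun _ => rfl, fun hlt => absurd hlt (lt_irrefl _), hreal, hp.isKahlerEinstein,
      hp.isCompleteMetric_of_zero, fun _ => ⟨C, fun s => F (Real.cosh s), hp.isStenzelFunction,
        hp.isStenzelMetric fun _ _ => rfl⟩⟩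
  · have hΦ0 : Tendsto (fun u => F (curveTau a b u)) atBot (𝓝 0) := by
      have := (hp.derivF 1 (one_mem_shell h.radius_pos)).continuousWithinAt
      rw [ContinuousWithinAt, hF1] at this
      exact this.comp h.tendsto_tau_within
    have hε : 0 < -2 * Λ / (n + 2) := div_pos (by linarith) (by positivity)
    have hc := fun u hu => h.sq_c_lower_bound hlt
      (fun u hu => h.hasDerivAt_potential hG hp.derivF hu) hΦ0 (u := u) hu
    exact ⟨fun e => absurd e hlt.ne, fun _ => h.radius_lt_top hε hc, h.realizes hG hG',
      hp.isKahlerEinstein, h.isCompleteMetric h0 hΛ hp hG hG' hε hc, fun e => absurd e hlt.ne⟩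

end CurveGlobal

/-! ### From a Ricci-flat profile to an unstable curve. -/

section ProfileCurve

variable {n : ℕ} {C : ℝ} {F G G' : ℝ → ℝ}

/-- The curve parameter `u` as a function of `r`, up to an additive constant. -/
noncomputable def profileTime (G : ℝ → ℝ) (r : ℝ) : ℝ :=
  ∫ x in (1 : ℝ)..r, (G (Real.cosh (2 * x)) * Real.sinh (2 * x))⁻¹

/-- The end of the interval of existence of the curve of a profile. -/
noncomputable def profileEnd (G : ℝ → ℝ) : EReal :=
  ⨆ r ∈ Set.Ioi (0 : ℝ), (profileTime G r : EReal)

namespace IsEinsteinProfile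

theorem speed_pos (h : IsEinsteinProfile n 0 ⊤ F G G' C) {r : ℝ} (hr : 0 < r) :
    0 < G (Real.cosh (2 * r)) * Real.sinh (2 * r) :=
  mul_pos (h.pos _ (cosh_mem_shell_top _)) (Real.sinh_pos_iff.2 (by linarith))

theorem hasDerivAt_profileTime (h : IsEinsteinProfile n 0 ⊤ F G G' C) {r : ℝ} (hr : 0 < r) :
    HasDerivAt (profileTime G) (G (Real.cosh (2 * r)) * Real.sinh (2 * r))⁻¹ r := by
  have hG : Continuous fun x => G (Real.cosh (2 * x)) :=
    h.continuousOn_G.comp_continuous (by fun_prop) fun x => cosh_mem_shell_top _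
  have hc : ContinuousOn (fun x => (G (Real.cosh (2 * x)) * Real.sinh (2 * x))⁻¹) (Set.Ioi 0) :=
    ContinuousOn.inv₀ (hG.mul (by fun_prop)).continuousOn fun x hx => (h.speed_pos hx).ne'
  exact intervalIntegral.integral_hasDerivAt_right
    (hc.mono (Set.ordConnected_Ioi.uIcc_subset (Set.mem_Ioi.2 one_pos) hr)).intervalIntegrable
    (hc.stronglyMeasurableAtFilter isOpen_Ioi r hr) (hc.continuousAt (Ioi_mem_nhds hr))

theorem exists_profileRad (h : IsEinsteinProfile n 0 ⊤ F G G' C) :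
    StrictMonoOn (profileTime G) (Set.Ioi 0) ∧ ∃ ρ : ℝ → ℝ,
      (∀ r ∈ Set.Ioi (0 : ℝ), ρ (profileTime G r) = r) ∧ ∀ r ∈ Set.Ioi (0 : ℝ),
        HasDerivAt ρ (G (Real.cosh (2 * r)) * Real.sinh (2 * r)) (profileTime G r) := by
  obtain ⟨h1, ρ, h2, h3⟩ := exists_inverse_of_deriv_pos isOpen_Ioi (convex_Ioi (0 : ℝ))
    (fun r hr => h.hasDerivAt_profileTime hr) fun r hr => inv_pos.2 (h.speed_pos hr)
  exact ⟨h1, ρ, h2, fun r hr => (h3 r hr).congr_deriv (inv_inv _)⟩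

/-- The bound `G ≤ 1 + C` makes the time integrand at least `κ · 2/sinh 2r`, the derivative of `κ
log tanh r`, which tends to `-∞` as `r → 0`. So the zero section lies at `u = -∞`. -/
theorem exists_profileTime_lt (h : IsEinsteinProfile n 0 ⊤ F G G' C) (v : ℝ) :
    ∃ r ∈ Set.Ioi (0 : ℝ), profileTime G r < v := by
  have hC := h.C_pos
  set κ := (2 * (1 + C))⁻¹ with hκ
  have hκ0 : 0 < κ := by positivity
  have hd : ∀ r ∈ Set.Ioi (0 : ℝ), HasDerivAt (fun r => profileTime G r
      - κ * (Real.log (Real.sinh r) - Real.log (Real.cosh r)))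
      ((G (Real.cosh (2 * r)) * Real.sinh (2 * r))⁻¹
        - κ * (Real.cosh r / Real.sinh r - Real.sinh r / Real.cosh r)) r := fun r hr =>
    (h.hasDerivAt_profileTime hr).sub
      ((((Real.hasDerivAt_sinh r).log (Real.sinh_pos_iff.2 hr).ne').sub
        ((Real.hasDerivAt_cosh r).log (Real.cosh_pos r).ne')).const_mul κ)
  have hm : MonotoneOn (fun r => profileTime G r
      - κ * (Real.log (Real.sinh r) - Real.log (Real.cosh r))) (Set.Ioi 0) := by
    refine monotoneOn_of_hasDerivWithinAt_nonneg (convex_Ioi 0)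
      (fun r hr => (hd r hr).continuousAt.continuousWithinAt)
      (fun r hr => (hd r (interior_subset hr)).hasDerivWithinAt) fun r hr => ?_
    have hr' : 0 < r := interior_subset hr
    have hs := Real.sinh_pos_iff.2 hr'
    have hc := Real.cosh_pos r
    have e := Real.cosh_sq_sub_sinh_sq r
    have e1 : Real.cosh r / Real.sinh r - Real.sinh r / Real.cosh r
        = 2 / Real.sinh (2 * r) := by
      rw [Real.sinh_two_mul]
      field_simp
      linarith
    have hs2 := Real.sinh_pos_iff.2 (by linarith : 0 < 2 * r)
    rw [e1, sub_nonneg, hκ, ← div_eq_inv_mul, div_div, ← one_div, div_le_div_iff₀ (by positivity)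
      (h.speed_pos hr')]
    have := mul_le_mul_of_nonneg_right (h.le_one_add (cosh_mem_shell_top (2 * r))) hs2.le
    linarith
  have hlim : Tendsto (fun r => κ * Real.log (Real.sinh r)
      - κ * (Real.log (Real.sinh 1) - Real.log (Real.cosh 1))) (𝓝[>] 0) atBot := by
    refine tendsto_atBot_add_const_right _ _ ((Real.tendsto_log_nhdsGT_zero.comp ?_).const_mul_atBot
      hκ0)
    refine tendsto_nhdsWithin_iff.2 ⟨?_, ?_⟩
    · have := Real.continuous_sinh.tendsto 0
      rw [Real.sinh_zero] at this
      exact this.mono_left nhdsWithin_le_nhds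
    · filter_upwards [self_mem_nhdsWithin] with r hr using Real.sinh_pos_iff.2 hr
  obtain ⟨r, hr1, hr2⟩ := ((hlim.eventually_lt_atBot v).and (Ioo_mem_nhdsGT one_pos)).exists
  refine ⟨r, hr2.1, lt_of_le_of_lt ?_ hr1⟩
  have e1 := hm hr2.1 (Set.mem_Ioi.2 one_pos) hr2.2.le
  have e2 : profileTime G 1 = 0 := intervalIntegral.integral_same
  have e3 : 0 ≤ κ * Real.log (Real.cosh r) :=
    mul_nonneg hκ0.le (Real.log_nonneg (Real.one_le_cosh r))
  simp only [e2] at e1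
  linarith

theorem mem_below_profileEnd (h : IsEinsteinProfile n 0 ⊤ F G G' C) {v : ℝ} :
    v ∈ below (profileEnd G) ↔ v ∈ profileTime G '' Set.Ioi 0 := by
  constructor
  · intro hv
    obtain ⟨r₂, hv'⟩ := lt_iSup_iff.1 (show (v : EReal) < profileEnd G from hv)
    obtain ⟨hr₂, hlt⟩ := lt_iSup_iff.1 hv'
    obtain ⟨r₁, hr₁, hlt₁⟩ := h.exists_profileTime_lt v
    exact isPreconnected_Ioi.intermediate_value hr₁ hr₂
      (fun r hr => (h.hasDerivAt_profileTime hr).continuousAt.continuousWithinAt)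
      ⟨hlt₁.le, (EReal.coe_lt_coe_iff.1 hlt).le⟩
  · rintro ⟨r, hr, rfl⟩
    have hr1 : r + 1 ∈ Set.Ioi (0 : ℝ) := Set.mem_Ioi.2 (by linarith [Set.mem_Ioi.1 hr])
    exact (EReal.coe_lt_coe_iff.2 (h.exists_profileRad.1 hr hr1 (by linarith))).trans_le
      (le_iSup₂ (f := fun r (_ : r ∈ Set.Ioi (0 : ℝ)) => (profileTime G r : EReal)) (r + 1) hr1)

/-- Every profile with vanishing Einstein constant comes from an unstable curve. -/
theorem exists_curve (h : IsEinsteinProfile n 0 ⊤ F G G' C) (hn : 1 ≤ n)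
    {g : BilinField (n + 2)} (hg : EqOnTangent (tube n ⊤) g (radialMetric (n + 2) G G')) :
    ∃ (K : ℝ) (η : EReal) (a b c r : ℝ → ℝ),
      0 < K ∧ IsUnstableCurve n 0 K K η a b c ∧ Realizes n η a b c r ⊤ g := by
  obtain ⟨hmono, ρ, hρ, hρd⟩ := h.exists_profileRad
  have hmem : ∀ {v : ℝ}, v ∈ below (profileEnd G) → 0 < ρ v ∧ profileTime G (ρ v) = v := by
    intro v hv
    obtain ⟨r, hr, rfl⟩ := h.mem_below_profileEnd.1 hv
    rw [hρ r hr]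
    exact ⟨hr, rfl⟩
  have hτ : ∀ v, Real.cosh (2 * ρ v) ∈ shell ⊤ := fun v => cosh_mem_shell_top _
  have hGpos : ∀ v, 0 < G (Real.cosh (2 * ρ v)) := fun v => h.pos _ (hτ v)
  have hbot : ⊥ < profileEnd G :=
    (EReal.bot_lt_coe _).trans (h.mem_below_profileEnd.2 ⟨1, Set.mem_Ioi.2 one_pos, rfl⟩)
  have hρ' : ∀ v ∈ below (profileEnd G),
      HasDerivAt ρ (G (Real.cosh (2 * ρ v)) * Real.sinh (2 * ρ v)) v := fun v hv => by
    have := hρd _ (hmem hv).1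
    rwa [(hmem hv).2] at this
  have hρ0 : Tendsto ρ atBot (𝓝 0) := by
    refine tendsto_order.2 ⟨fun x hx => ?_, fun x hx => ?_⟩
    · filter_upwards [eventually_mem_below hbot] with v hv using hx.trans (hmem hv).1
    · filter_upwards [eventually_mem_below hbot, eventually_lt_atBot (profileTime G x)] with v hv hlt
      rw [← (hmem hv).2] at hlt
      exact (hmono.lt_iff_lt (hmem hv).1 hx).1 hlt
  have hτd : ∀ v ∈ below (profileEnd G), HasDerivAt (fun v => Real.cosh (2 * ρ v))
      (2 * G (Real.cosh (2 * ρ v)) * Real.sinh (2 * ρ v) ^ 2) v := fun v hv =>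
    ((hρ' v hv).const_mul 2).cosh.congr_deriv (by ring)
  have hGd : ∀ v ∈ below (profileEnd G), HasDerivAt (fun v => G (Real.cosh (2 * ρ v)))
      (2 * G (Real.cosh (2 * ρ v)) * (G' (Real.cosh (2 * ρ v)) * Real.sinh (2 * ρ v) ^ 2)) v :=
    fun v hv => by
      have h1 : 1 < Real.cosh (2 * ρ v) :=
        Real.one_lt_cosh.2 (by have := (hmem hv).1; positivity)
      exact (((h.derivG _ (hτ v)).hasDerivAt
        (shell_mem_nhds h.R_pos (hτ v) h1)).comp v (hτd v hv)).congr_deriv (by ring)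
  -- `A² = b² - a²`, so that `a = A sinh ρ` and `b = A cosh ρ`. The formula for `c` is `c² = 2(τG +
  -- (τ²-1)G')` rewritten by the profile equation; it makes positivity evident and involves no
  -- derivative of `G`.
  let A : ℝ → ℝ := fun v => √(2 * G (Real.cosh (2 * ρ v)))
  let c : ℝ → ℝ := fun v => √(2 * C / G (Real.cosh (2 * ρ v)) ^ n)
  have hA : ∀ v, A v ^ 2 = 2 * G (Real.cosh (2 * ρ v)) := fun v =>
    Real.sq_sqrt (by have := hGpos v; positivity)
  have hA0 : ∀ v, 0 < A v := fun v => Real.sqrt_pos.2 (by have := hGpos v; positivity)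
  have hC0 := h.C_pos
  have hc : ∀ v, c v ^ 2 = 2 * (Real.cosh (2 * ρ v) * G (Real.cosh (2 * ρ v))
      + (Real.cosh (2 * ρ v) ^ 2 - 1) * G' (Real.cosh (2 * ρ v))) := fun v => by
    have e := h.ode _ (hτ v)
    have hp := hGpos v
    rw [neg_zero, zero_mul, Real.exp_zero, mul_one] at e
    rw [Real.sq_sqrt (by positivity), ← e]
    field_simp
  have hc0 : ∀ v, 0 < c v := fun v => Real.sqrt_pos.2 (by have := hGpos v; positivity)
  have hAd : ∀ v ∈ below (profileEnd G), HasDerivAt A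
      (A v * (G' (Real.cosh (2 * ρ v)) * Real.sinh (2 * ρ v) ^ 2)) v := fun v hv => by
    have hp := hGpos v
    refine (((hGd v hv).const_mul 2).sqrt (by positivity)).congr_deriv ?_
    have e := hA v
    have e0 := hA0 v
    change _ / (2 * A v) = _
    rw [div_eq_iff (by positivity)]
    linear_combination (-2 * (G' (Real.cosh (2 * ρ v)) * Real.sinh (2 * ρ v) ^ 2)) * e
  have hcd : ∀ v ∈ below (profileEnd G), HasDerivAt c
      (-n * c v * (G' (Real.cosh (2 * ρ v)) * Real.sinh (2 * ρ v) ^ 2)) v := fun v hv => by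
    have hp := hGpos v
    have e0 := hc0 v
    have e : c v ^ 2 = 2 * C / G (Real.cosh (2 * ρ v)) ^ n := Real.sq_sqrt (by positivity)
    refine ((((hGd v hv).fun_pow n).fun_inv (by positivity)).const_mul (2 * C)
      |>.sqrt (by positivity)).congr_deriv ?_
    change _ / (2 * c v) = _
    have hn' : G (Real.cosh (2 * ρ v)) ^ n
        = G (Real.cosh (2 * ρ v)) ^ (n - 1) * G (Real.cosh (2 * ρ v)) := by
      rw [← pow_succ, Nat.sub_add_cancel hn]
    rw [div_eq_iff (by positivity)]
    have e2 : -n * c v * (G' (Real.cosh (2 * ρ v)) * Real.sinh (2 * ρ v) ^ 2) * (2 * c v)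
      = -2 * n * (G' (Real.cosh (2 * ρ v)) * Real.sinh (2 * ρ v) ^ 2) * c v ^ 2 := by ring
    rw [e2, e, hn']
    field_simp
  have hab : ∀ v, A v * Real.sinh (ρ v) * (A v * Real.cosh (ρ v))
      = G (Real.cosh (2 * ρ v)) * Real.sinh (2 * ρ v) := fun v => by
    rw [Real.sinh_two_mul]
    linear_combination Real.sinh (ρ v) * Real.cosh (ρ v) * hA v
  have hsol : IsSolution n 0 (profileEnd G) (fun v => A v * Real.sinh (ρ v))
      (fun v => A v * Real.cosh (ρ v)) c := fun v hv => by
    have e1 := Real.cosh_sq_sub_sinh_sq (ρ v)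
    have e2 := Real.cosh_two_mul (ρ v)
    have e3 := Real.cosh_sq_sub_sinh_sq (2 * ρ v)
    have e4 := Real.sinh_two_mul (ρ v)
    have e5 := hA v
    have e6 := hc v
    refine ⟨((hAd v hv).mul (hρ' v hv).sinh).congr_deriv ?_,
      ((hAd v hv).mul (hρ' v hv).cosh).congr_deriv ?_, (hcd v hv).congr_deriv ?_⟩
    · have e7 : (A v * Real.cosh (ρ v)) ^ 2 + c v ^ 2 - (A v * Real.sinh (ρ v)) ^ 2
          = 4 * G (Real.cosh (2 * ρ v)) * Real.cosh (ρ v) ^ 2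
            + 2 * Real.sinh (2 * ρ v) ^ 2 * G' (Real.cosh (2 * ρ v)) := by
        rw [e6]
        linear_combination (Real.cosh (ρ v) ^ 2 - Real.sinh (ρ v) ^ 2) * e5
          + 2 * G (Real.cosh (2 * ρ v)) * e2
          + 2 * G' (Real.cosh (2 * ρ v)) * e3
      rw [e7, e4]
      ring
    · have e7 : c v ^ 2 + (A v * Real.sinh (ρ v)) ^ 2 - (A v * Real.cosh (ρ v)) ^ 2
          = 4 * G (Real.cosh (2 * ρ v)) * Real.sinh (ρ v) ^ 2
            + 2 * Real.sinh (2 * ρ v) ^ 2 * G' (Real.cosh (2 * ρ v)) := by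
        rw [e6]
        linear_combination (-Real.cosh (ρ v) ^ 2 + Real.sinh (ρ v) ^ 2) * e5
          + 2 * G (Real.cosh (2 * ρ v)) * e2
          + 2 * G' (Real.cosh (2 * ρ v)) * e3
      rw [e7, e4]
      ring
    · have e7 : (A v * Real.sinh (ρ v)) ^ 2 + (A v * Real.cosh (ρ v)) ^ 2 - c v ^ 2
          = -2 * Real.sinh (2 * ρ v) ^ 2 * G' (Real.cosh (2 * ρ v)) := by
        rw [e6]
        linear_combination (Real.cosh (ρ v) ^ 2 + Real.sinh (ρ v) ^ 2) * e5
          - 2 * G (Real.cosh (2 * ρ v)) * e2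
          - 2 * G' (Real.cosh (2 * ρ v)) * e3
      rw [e7]
      ring
  have hG1 : 0 < G 1 := h.pos 1 (one_mem_shell h.R_pos)
  have hτlim : Tendsto (fun v => G (Real.cosh (2 * ρ v))) atBot (𝓝 (G 1)) := by
    have h1 : Continuous fun x => G (Real.cosh (2 * x)) :=
      h.continuousOn_G.comp_continuous (by fun_prop) fun x => cosh_mem_shell_top _
    have h2 : Tendsto (fun v => G (Real.cosh (2 * ρ v))) atBot _ := (h1.tendsto 0).comp hρ0
    simpa using h2
  have hAlim : Tendsto A atBot (𝓝 √(2 * G 1)) := (hτlim.const_mul 2).sqrt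
  refine ⟨√(2 * G 1), profileEnd G, fun v => A v * Real.sinh (ρ v), fun v => A v * Real.cosh (ρ v),
    c, ρ, by positivity, ⟨hbot, hsol, ?_, ?_, ?_, ?_, ?_⟩, ?_⟩
  -- A prolongation past a finite end `e` would bound `ab = dρ/dv` near `e`, hence bound `ρ`; but
  -- `ρ` takes every positive value.
  · intro η' a' b' c' hle hsol' heq
    by_contra hne
    have hlt : profileEnd G < η' := lt_of_le_of_ne hle (Ne.symm hne)
    obtain ⟨e, he⟩ : ∃ e : ℝ, profileEnd G = e :=
      ⟨(profileEnd G).toReal, (EReal.coe_toReal (hlt.trans_le le_top).ne hbot.ne').symm⟩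
    rw [he] at hlt heq
    have hcont : ContinuousAt (fun v => a' v * b' v) e :=
      (hsol' e hlt).1.continuousAt.mul (hsol' e hlt).2.1.continuousAt
    obtain ⟨δ, hδ, hball⟩ := Metric.eventually_nhds_iff.1
      (hcont.eventually_lt continuousAt_const (lt_add_one (a' e * b' e)))
    set M := a' e * b' e + 1
    have hbd : ∀ v ∈ below (e : EReal), e - δ / 2 ≤ v →
        G (Real.cosh (2 * ρ v)) * Real.sinh (2 * ρ v) ≤ M := fun v hv hle => by
      have hv' := EReal.coe_lt_coe_iff.1 hv
      obtain ⟨h1, h2, -⟩ := heq v hv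
      rw [← hab v, ← h1, ← h2]
      exact (hball (by rw [Real.dist_eq, abs_lt]; constructor <;> linarith)).le
    have hv₀ : e - δ / 2 ∈ below (profileEnd G) := by
      rw [he]; exact EReal.coe_lt_coe_iff.2 (by linarith)
    have hM0 : 0 < M := (h.speed_pos (hmem hv₀).1).trans_le (hbd _ (he ▸ hv₀) le_rfl)
    have hm := monotoneOn_below_Ici (η := (e : EReal)) (u₀ := e - δ / 2)
      (f := fun v => M * v - ρ v) (fun v hv => ((hasDerivAt_id v).const_mul M).sub
        (hρ' v (he ▸ hv))) fun v hv hle => by have := hbd v hv hle; linarith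
    -- On an interval of length `δ/2` the increase of `ρ` is at most `Mδ/2`, so this value cannot be
    -- reached.
    set s := ρ (e - δ / 2) + M * δ with hs
    have hs0 : 0 < s := by have := (hmem hv₀).1; positivity
    have hv : profileTime G s ∈ below (profileEnd G) := h.mem_below_profileEnd.2 ⟨s, hs0, rfl⟩
    have hge : e - δ / 2 ≤ profileTime G s := by
      rw [← (hmem hv₀).2]
      refine hmono.monotoneOn (hmem hv₀).1 hs0 ?_
      have : 0 < M * δ := by positivity
      linarith
    have hmv := hm ⟨he ▸ hv₀, Set.mem_Ici.2 le_rfl⟩ ⟨he ▸ hv, hge⟩ hge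
    have hlt' : profileTime G s < e := EReal.coe_lt_coe_iff.1 (he ▸ hv)
    simp only [hρ s hs0] at hmv
    have := mul_lt_mul_of_pos_left hlt' hM0
    have : 0 < M * δ := by positivity
    linarith
  · simpa using hAlim.mul (Real.continuous_sinh.tendsto 0 |>.comp hρ0)
  · simpa using hAlim.mul (Real.continuous_cosh.tendsto 0 |>.comp hρ0)
  -- At `τ = 1` the profile equation reads `G(1)^(n+1) = C`, which makes the limits of `b` and `c`
  -- equal.
  · have e := h.ode 1 (one_mem_shell h.R_pos)
    have e2 : 2 * C / G 1 ^ n = 2 * G 1 := by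
      have : C = G 1 ^ n * G 1 := by simpa using e.symm
      rw [this]
      field_simp
    rw [← e2]
    exact ((tendsto_const_nhds (x := 2 * C)).div (hτlim.pow n) (by positivity)).sqrt
  · intro hcon
    obtain ⟨v, hv⟩ := below_nonempty hbot
    exact (mul_pos (hA0 v) (Real.sinh_pos_iff.2 (hmem hv).1)).ne' (hcon v hv).1
  · refine realizes_of_profile (fun v hv => ⟨(mul_pos (hA0 v) (Real.sinh_pos_iff.2 (hmem hv).1)).ne',
      (mul_pos (hA0 v) (Real.cosh_pos _)).ne', (hc0 v).ne'⟩)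
      (fun v hv => (hρ' v hv).congr_deriv (hab v).symm) hρ0 ⟨fun v hv => ?_, fun v hv w hw e => ?_,
        fun s hs => ?_⟩ (fun v _ => ?_) (fun v _ => ?_) (fun v _ => hc v) (fun v _ => by ring) hg
    · exact ⟨abs_pos.2 (hmem hv).1.ne', EReal.coe_lt_top _⟩
    · simp only [abs_of_pos (hmem hv).1, abs_of_pos (hmem hw).1] at e
      rw [← (hmem hv).2, e, (hmem hw).2]
    · refine ⟨profileTime G s, h.mem_below_profileEnd.2 ⟨s, hs.1, rfl⟩, ?_⟩
      simp only [hρ s hs.1, abs_of_pos hs.1]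
    · rw [mul_pow, hA]
    · rw [mul_pow, hA]

end IsEinsteinProfile

end ProfileCurve
theorem mainTheorem2 (n : ℕ) (hn : 1 ≤ n) :
    -- every unstable curve gives a complete Kähler-Einstein metric on a tube in the quadric,
    -- which is one of Stenzel's metrics on the whole quadric if the Einstein constant is zero
    (∀ (Λ K L : ℝ) (η : EReal) (a b c : ℝ → ℝ),
      Λ ≤ 0 → K ≠ 0 → (L = K ∨ L = -K) → IsUnstableCurve n Λ K L η a b c →
      ∃ (R : EReal) (r : ℝ → ℝ) (g : BilinField (n + 2)),
        0 < R ∧ (Λ = 0 → R = ⊤) ∧ (Λ < 0 → R < ⊤) ∧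
        Realizes n η a b c r R g ∧
        IsKahlerEinstein (n + 1) (tube n R) Λ g ∧
        IsCompleteMetric (tube n R) g ∧
        (Λ = 0 → ∃ (k : ℝ) (f : ℝ → ℝ), IsStenzelFunction n k f ∧ IsStenzelMetric n f g)) ∧
    -- every solution of Stenzel's equation gives a metric on the quadric
    (∀ (k : ℝ) (f : ℝ → ℝ), IsStenzelFunction n k f →
      ∃ g : BilinField (n + 2), IsStenzelMetric n f g) ∧
    -- every such metric is complete, Ricci-flat Kähler, and is given by an unstable curve
    (∀ (k : ℝ) (f : ℝ → ℝ) (g : BilinField (n + 2)),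
      IsStenzelFunction n k f → IsStenzelMetric n f g →
      IsKahlerEinstein (n + 1) (quadric n) 0 g ∧
      IsCompleteMetric (quadric n) g ∧
      ∃ (K : ℝ) (η : EReal) (a b c r : ℝ → ℝ),
        0 < K ∧ IsUnstableCurve n 0 K K η a b c ∧ Realizes n η a b c r ⊤ g) := by
  refine ⟨fun Λ K L η a b c hΛ hK hL h => h.exists_metric hn hΛ hK hL, fun k f hf => ?_,
    fun k f g hf hg => ?_⟩
  · obtain ⟨F, G, G', h, hF⟩ := hf.exists_profile
    exact ⟨_, h.isStenzelMetric hF⟩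
  · obtain ⟨F, G, G', h, hF⟩ := hf.exists_profile
    -- The potential determines `g` only on tangent vectors of the quadric, so all conclusions are
    -- transferred from `radialMetric` by the congruence lemmas.
    have hpull := hg.pull_eq h hF
    have hE := h.isKahlerEinstein
    have hcomplete := h.isCompleteMetric_of_zero
    have hT : EqOnTangent (quadric n) g (radialMetric (n + 2) G G') :=
      EqOnTangent.of_pull_eq hpull
    rw [tube_top] at hE hcomplete
    exact ⟨IsKahlerEinstein.congr hpull hE, IsCompleteMetric.congr subset_rfl hT hcomplete,
      h.exists_curve hn (by rwa [tube_top])⟩
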